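/- Let $V$ be a set of $n\ge 1$ vertices partitioned into nonempty colour classes $1,\dots,\chi$. A clustering (partition) $F$ of $V$ is \emph{fair} if every cluster $S$ satisfies $c_1(S):\cdots:c_\chi(S)=c_1(V):\cdots:c_\chi(V)$, where $c_i(S)$ is the number of vertices of colour $i$ in $S$. For two clusterings let $\mathrm{dist}(C,D)$ be the number of unordered pairs of vertices that are together in one and separated in the other. Given clusterings $C_1,\dots,C_m$ of $V$ and an integer $\ell\ge 1$, a $\beta$-approximate fair consensus clustering is a fair clustering $F$ with $$\Bigl(\sum_{i=1}^m \mathrm{dist}(C_i,F)^\ell\Bigr)^{1/\ell}\le \beta\Bigl(\sum_{i=1}^m \mathrm{dist}(C_i,F')^\ell\Bigr)^{1/\ell}\quad\text{for all fair clusterings }F'.$$ An \emph{$\alpha$-approximate closest fair clustering algorithm} returns, for a clustering $C$, a fair clustering $F$ with $\mathrm{dist}(C,F)\le\alpha\,\mathrm{dist}(C,F')$ for all fair $F'$. A \emph{$\gamma$-approximate fair correlation clustering algorithm} returns, for a complete graph on $V$ with edges labelled $+$ or $-$, a fair clustering whose cost (number of $-$ edges inside clusters plus number of $+$ edges between clusters)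 is at most $\gamma$ times the cost of every fair clustering. In the \emph{pairwise streaming model} the input $C_1,\dots,C_m$ is presented in one pass, in arbitrary order, as triples $(p,j,b)$, where $p=\{u,v\}$ is a pair of vertices, $j\in\{1,\dots,m\}$, and $b=0$ if $u,v$ are in the same cluster of $C_j$, $b=1$ otherwise; every pair $\{u,v\}$ of distinct vertices is presented for every $j$. Space is the number of working-memory words, of $O(\log(n+m))$ bits each. Query time is the number of word-RAM steps performed after the end of the stream, where a call of the closest fair clustering algorithm is an oracle call (one step), and a call of the fair correlation clustering algorithm on $n$ vertices is charged its running time $T(n)$ (plus one step). Oracle queries and answers are written on separate tapes that are not kept between stream elements, and the output on a separate write-only tape. The colours are read-only input, and the algorithm may draw independent uniform indices from $\{1,\dots,m\}$. \textbf{Theorem.} Let $\alpha,\gamma\ge 1$ be real numbers and let $\ell\ge 1$ be an integer. There is a randomized one-pass streaming algorithm (one program, uniform in all instances) such that, for all $n\ge 1$, $m\ge 2$, all colourings of $V$ as above, and given oracle access to an $\alpha$-approximate closest fair clustering algorithm and to a $\gamma$-approximate fair correlation clustering algorithm with running time $T(n)$, for every stream presenting clusterings $C_1,\dots,C_m$ of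 $V$: the algorithm always uses $O(n\log m)$ space and has query time $$O\bigl(n^2\log^4 m+T(n)\log^3 m\bigr),$$ and with probability at least $1-\frac1m$ it outputs an $(\alpha+1.995)$-approximate fair consensus clustering of $C_1,\dots,C_m$. The constants in the $O$-notation, and in the word size, depend only on $\alpha$, $\gamma$ and $\ell$. (The resources bounded are space and query time; no bound on the time per stream element is asserted.) -/

import Mathlib

namespace FairConsensus

/-! ### Clusterings, fairness, and the three optimisation problems -/

/-- A clustering of the vertex set `Fin n`: a partition, given by the relation
`u` and `v` lie in the same cluster. -/
abbrev Clustering (n : ℕ) := Setoid (Fin n)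

/-- The clustering described by an array of cluster labels. -/
abbrev ofLabels {n : ℕ} (f : Fin n → ℕ) : Clustering n := Setoid.ker f

/-- The number of unordered pairs that are together in one clustering and separated in the other
(an unordered pair of distinct vertices is represented by `p.1 < p.2`). -/
noncomputable def pairDist {n : ℕ} (C D : Clustering n) : ℕ :=
  {p : Fin n × Fin n | p.1 < p.2 ∧ ((C.r p.1 p.2 ∧ ¬ D.r p.1 p.2) ∨
    (¬ C.r p.1 p.2 ∧ D.r p.1 p.2))}.ncard

/-- The number of vertices of colour `i` in `S`. -/
noncomputable def colorCount {n χ : ℕ} (color : Fin n → Fin χ) (i : Fin χ)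
    (S : Set (Fin n)) : ℕ :=
  {v | v ∈ S ∧ color v = i}.ncard

/-- Proportional fairness: in every cluster `S` the colour counts satisfy
`c₁(S) : ⋯ : c_χ(S) = c₁(V) : ⋯ : c_χ(V)` (ratios compared by cross-multiplication). -/
def IsFair {n χ : ℕ} (color : Fin n → Fin χ) (F : Clustering n) : Prop :=
  ∀ S ∈ F.classes, ∀ i j : Fin χ,
    colorCount color i S * colorCount color j Set.univ =
      colorCount color j S * colorCount color i Set.univ

/-- `F` is an `α`-close fair clustering to `C`. -/
def IsCloseFair {n χ : ℕ} (color : Fin n → Fin χ) (α : ℝ) (C F : Clustering n) : Prop :=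
  IsFair color F ∧ ∀ F' : Clustering n, IsFair color F' →
    (pairDist C F : ℝ) ≤ α * (pairDist C F' : ℝ)

/-- The cost of a clustering on an unweighted correlation clustering instance: the complete graph
in which the edges of `G` are labelled `+` and all other edges `-`. -/
noncomputable def corrCost {n : ℕ} (G : SimpleGraph (Fin n)) (C : Clustering n) : ℕ :=
  {p : Fin n × Fin n | p.1 < p.2 ∧ ((C.r p.1 p.2 ∧ ¬ G.Adj p.1 p.2) ∨
    (¬ C.r p.1 p.2 ∧ G.Adj p.1 p.2))}.ncard

/-- `F` is a `γ`-approximate (unweighted) fair correlation clustering of `G`. -/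
def IsApproxFairCorr {n χ : ℕ} (color : Fin n → Fin χ) (γ : ℝ) (G : SimpleGraph (Fin n))
    (F : Clustering n) : Prop :=
  IsFair color F ∧ ∀ F' : Clustering n, IsFair color F' →
    (corrCost G F : ℝ) ≤ γ * (corrCost G F' : ℝ)

/-- The consensus objective `(∑ᵢ dist(Cᵢ, F)^ℓ)^(1/ℓ)`. -/
noncomputable def consensusCost {n m : ℕ} (ℓ : ℕ) (C : Fin m → Clustering n)
    (F : Clustering n) : ℝ :=
  (∑ i, (pairDist (C i) F : ℝ) ^ ℓ) ^ (1 / (ℓ : ℝ))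

/-- `F` is a `β`-approximate fair consensus clustering of `C₁, …, C_m`. -/
def IsApproxFairConsensus {n m χ : ℕ} (color : Fin n → Fin χ) (ℓ : ℕ) (β : ℝ)
    (C : Fin m → Clustering n) (F : Clustering n) : Prop :=
  IsFair color F ∧ ∀ F' : Clustering n, IsFair color F' →
    consensusCost ℓ C F ≤ β * consensusCost ℓ C F'

/-! ### The pairwise streaming model -/

/-- A stream element `(p, j, b)`: a pair `p = (u, v)`, the index `j` of an input clustering, and the
bit `b` saying whether `u` and `v` lie in the same cluster (`b = 0`) or not (`b = 1`). -/
structure Item (n m : ℕ) where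
  u : Fin n
  v : Fin n
  j : Fin m
  b : Fin 2

/-- `L` is a stream presenting `C₁, …, C_m`, in arbitrary order: all its elements are truthful,
and every unordered pair of distinct vertices is presented (in one of its two orientations) for
every `j`. Repetitions are harmless and allowed. -/
def IsStream {n m : ℕ} (C : Fin m → Clustering n) (L : List (Item n m)) : Prop :=
  (∀ x ∈ L, x.b = 0 ↔ (C x.j).r x.u x.v) ∧
  ∀ (j : Fin m) (u v : Fin n), u ≠ v → ∃ x ∈ L, x.j = j ∧ s(x.u, x.v) = s(u, v)

/-! ### A word RAM with bounded memory, random indices and two oracles -/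

/-- Unit-cost word operations. -/
inductive Op
  | add | sub | mul | div | mod | lt | eq

/-- Subtraction is truncated; comparisons return `1` or `0`. -/
def Op.apply : Op → ℕ → ℕ → ℕ
  | .add, x, y => x + y
  | .sub, x, y => x - y
  | .mul, x, y => x * y
  | .div, x, y => x / y
  | .mod, x, y => x % y
  | .lt, x, y => if x < y then 1 else 0
  | .eq, x, y => if x = y then 1 else 0

/-- Expressions: constants, registers, cells of the working memory, the two input sizes,
the colour of a vertex (read-only input), the four components of the current stream element,
cells of the last oracle answer, and word operations. -/
inductive Expr
  | const (k : ℕ)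
  | reg (r : ℕ)
  | mem (a : Expr)
  | numVertices
  | numClusterings
  | color (a : Expr)
  | item (i : Fin 4)
  | answer (a : Expr)
  | bin (o : Op) (a b : Expr)

/-- Time needed to evaluate an expression: one step per node. -/
def Expr.size : Expr → ℕ
  | .mem a => a.size + 1
  | .color a => a.size + 1
  | .answer a => a.size + 1
  | .bin _ a b => a.size + b.size + 1
  | _ => 1

/-- Programs. A program is a fixed finite object, independent of the input sizes. -/
inductive Cmd
  | skip
  | assign (r : ℕ) (e : Expr)      -- register `r` becomes `e`
  | store (a e : Expr)             -- memory cell `a` becomes `e`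
  | sample (r : ℕ)                 -- register `r` becomes a fresh uniform index below `m`
  | ask (a e : Expr)               -- cell `a` of the (write-only) oracle query becomes `e`
  | callClosest                    -- closest fair clustering oracle
  | callFairCorr                   -- fair correlation clustering oracle
  | output (a e : Expr)            -- cell `a` of the (write-only) output becomes `e`
  | seq (c d : Cmd)
  | ite (e : Expr) (c d : Cmd)
  | loop (e : Expr) (c : Cmd)      -- while `e` is nonzero, execute `c`

/-- What is fixed during a run: the problem instance, the oracles with the running time charged for
one call of the second, and the resource limits: number of memory cells and largest word. -/
structure Env (n : ℕ) where
  m : ℕ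
  color : Fin n → ℕ
  closest : (Fin n → ℕ) → (Fin n → Fin n)
  fairCorr : SimpleGraph (Fin n) → (Fin n → Fin n)
  corrTime : ℕ
  memLimit : ℕ
  wordLimit : ℕ

structure State where
  reg : ℕ → ℕ
  mem : ℕ → ℕ
  coins : List ℕ          -- the random indices that have not been drawn yet
  item : Fin 4 → ℕ
  qry : ℕ → ℕ
  ans : ℕ → ℕ
  out : ℕ → ℕ

/-- A value, provided that it fits into one machine word; otherwise the machine gets stuck. -/
def Env.word {n : ℕ} (E : Env n) (x : ℕ) : Option ℕ :=
  if x < E.wordLimit then some x else none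

/-- Value of an expression; `none` if a value overflows or an address is out of range. -/
def Expr.eval {n : ℕ} (E : Env n) (s : State) : Expr → Option ℕ
  | .const k => E.word k
  | .reg r => E.word (s.reg r)
  | .mem a => (a.eval E s).bind fun i => if i < E.memLimit then E.word (s.mem i) else none
  | .numVertices => E.word n
  | .numClusterings => E.word E.m
  | .color a => (a.eval E s).bind fun i => if h : i < n then E.word (E.color ⟨i, h⟩) else none
  | .item i => E.word (s.item i)
  | .answer a => (a.eval E s).bind fun i => if i < n then E.word (s.ans i) else none
  | .bin o a b => (a.eval E s).bind fun x => (b.eval E s).bind fun y => E.word (o.apply x y)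

/-- An array of labels, extended by `0`. -/
def labelsToCells {n : ℕ} (f : Fin n → Fin n) (i : ℕ) : ℕ :=
  if h : i < n then (f ⟨i, h⟩ : ℕ) else 0

/-- The correlation clustering instance written on the oracle query: for `u < v`, the edge `{u, v}`
is positive iff cell `u * n + v` is nonzero. -/
def queryGraph (n : ℕ) (q : ℕ → ℕ) : SimpleGraph (Fin n) :=
  SimpleGraph.fromRel fun u v => u < v ∧ q ((u : ℕ) * n + v) ≠ 0

/-- `Exec E c s s' t`: started in state `s`, the program `c` halts in state `s'` after `t` steps
without ever exceeding the limits. An oracle call reads and erases the query and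
leaves an array of `n` cluster labels as its answer. -/
inductive Exec {n : ℕ} (E : Env n) : Cmd → State → State → ℕ → Prop
  | skip (s : State) : Exec E .skip s s 1
  | assign (s : State) (r : ℕ) (e : Expr) (x : ℕ) (hx : e.eval E s = some x) :
      Exec E (.assign r e) s { s with reg := Function.update s.reg r x } (e.size + 1)
  | store (s : State) (a e : Expr) (i x : ℕ) (hi : a.eval E s = some i)
      (hlim : i < E.memLimit) (hx : e.eval E s = some x) :
      Exec E (.store a e) s { s with mem := Function.update s.mem i x } (a.size + e.size + 1)
  | sample (s : State) (r x : ℕ) (l : List ℕ) (hc : s.coins = x :: l) :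
      Exec E (.sample r) s { s with reg := Function.update s.reg r x, coins := l } 1
  | ask (s : State) (a e : Expr) (i x : ℕ) (hi : a.eval E s = some i)
      (hx : e.eval E s = some x) :
      Exec E (.ask a e) s { s with qry := Function.update s.qry i x } (a.size + e.size + 1)
  | callClosest (s : State) :
      Exec E .callClosest s
        { s with ans := labelsToCells (E.closest fun u => s.qry u), qry := fun _ => 0 } 1
  | callFairCorr (s : State) :
      Exec E .callFairCorr s
        { s with ans := labelsToCells (E.fairCorr (queryGraph n s.qry)), qry := fun _ => 0 }
        (E.corrTime + 1)
  | output (s : State) (a e : Expr) (i x : ℕ) (hi : a.eval E s = some i)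
      (hx : e.eval E s = some x) :
      Exec E (.output a e) s { s with out := Function.update s.out i x } (a.size + e.size + 1)
  | seq (c d : Cmd) (s s' s'' : State) (t t' : ℕ) (hc : Exec E c s s' t)
      (hd : Exec E d s' s'' t') : Exec E (.seq c d) s s'' (t + t')
  | iteTrue (e : Expr) (c d : Cmd) (s s' : State) (x t : ℕ) (hx : e.eval E s = some x)
      (h0 : x ≠ 0) (hc : Exec E c s s' t) : Exec E (.ite e c d) s s' (e.size + 1 + t)
  | iteFalse (e : Expr) (c d : Cmd) (s s' : State) (t : ℕ) (hx : e.eval E s = some 0)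
      (hd : Exec E d s s' t) : Exec E (.ite e c d) s s' (e.size + 1 + t)
  | loopDone (e : Expr) (c : Cmd) (s : State) (hx : e.eval E s = some 0) :
      Exec E (.loop e c) s s (e.size + 1)
  | loopStep (e : Expr) (c : Cmd) (s s' s'' : State) (x t t' : ℕ) (hx : e.eval E s = some x)
      (h0 : x ≠ 0) (hc : Exec E c s s' t) (hl : Exec E (.loop e c) s' s'' t') :
      Exec E (.loop e c) s s'' (e.size + 1 + t + t')

/-! ### Streaming algorithms -/

/-- A one-pass streaming algorithm: a program run before the stream, a program run on each stream
element, and a program run when the stream has ended. -/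
structure StreamAlg where
  init : Cmd
  update : Cmd
  query : Cmd

/-- Registers and memory are zero at the start. -/
def State.initial (coins : List ℕ) : State where
  reg := fun _ => 0
  mem := fun _ => 0
  coins := coins
  item := fun _ => 0
  qry := fun _ => 0
  ans := fun _ => 0
  out := fun _ => 0

/-- Between two phases only the registers and the working memory are kept; the components of the
next stream element (if any) become readable. -/
def State.next (s : State) (item : Fin 4 → ℕ) : State :=
  { s with item := item, qry := fun _ => 0, ans := fun _ => 0, out := fun _ => 0 }

def Item.code {n m : ℕ} (x : Item n m) : Fin 4 → ℕ := ![(x.u : ℕ), x.v, x.j, x.b]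

/-- Processing the stream, element by element. -/
inductive Consumes {n m : ℕ} (E : Env n) (c : Cmd) : List (Item n m) → State → State → Prop
  | nil (s : State) : Consumes E c [] s s
  | cons (x : Item n m) (L : List (Item n m)) (s s' s'' : State) (t : ℕ)
      (hx : Exec E c (s.next x.code) s' t) (hL : Consumes E c L s' s'') :
      Consumes E c (x :: L) s s''

/-- With the given random indices, the algorithm passes over the stream `L` without ever exceeding
the limits of `E`, and then produces the label array `labels` with query time `t`. -/
def Runs {n m : ℕ} (E : Env n) (A : StreamAlg) (coins : List ℕ) (L : List (Item n m))
    (labels : Fin n → ℕ) (t : ℕ) : Prop :=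
  ∃ (s₀ s₁ s₂ : State) (t₀ : ℕ),
    Exec E A.init (State.initial coins) s₀ t₀ ∧
    Consumes E A.update L s₀ s₁ ∧
    Exec E A.query (s₁.next fun _ => 0) s₂ t ∧
    ∀ u : Fin n, labels u = s₂.out u

end FairConsensus

/-! A clustering is identified with the set of vertex pairs that it keeps together, which turns
`pairDist` into the Hamming distance `hd` of finite sets. Let F be an optimal fair clustering, d_i
the distance from the i-th input to F, and M the power mean of the d_i. Since α ≥ 1, it suffices to
achieve the factor 2.995.

Candidates. For a tuple T of constantly many inputs, let Y(T) be a fair clustering that minimises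
the largest distance to the members of T (`tupleCandidate`). If all members of T are within 1.01 M
of F, they are also within 1.01 M of Y(T), so Y(T) is at most about 2M from F. By Minkowski's
inequality a candidate within 1.99 M of F has factor at most 2.99. This happens if some member of T
is within 0.98 M of F, which is frequent if a positive fraction of the inputs is that close.
Otherwise almost all inputs have distance at least 0.98 M. An input then costs clearly less than
three times its distance, unless its difference from F hardly overlaps the difference of Y(T) from
F. Such bad inputs are rare by a leave-one-out argument. Among k + 1 inputs at most three are bad
for the candidate built without them (`card_bad_le_three`), because bad inputs have almost disjoint
differences from F, which cannot all fill a large part of one candidate's difference. Averaging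
(`leave_one_out`) shows that for at least half of the tuples considered only a small fraction of all
inputs is bad. Hence a positive fraction of all tuples is good (`exists_good_tuples`).

Selection. Among O(log m) random tuples one is good with high probability. A further O(log m) random
inputs, the validators, compare the candidates in pairs. Powers of distances vary too much for a
direct estimate, so distances are truncated at a large multiple of the distance between the two
candidates compared. Beyond the truncation the two distances agree up to a factor close to one, and
below it a Chernoff bound applies with constant accuracy (`card_beats_wrongly_le`). A candidate with
the most wins reaches the good one in at most two comparisons, so its factor is at most 1.0003 *
1.0003 * 2.993 < 2.995 (`exists_sampling_constants`).

Machine. Each sampled clustering is stored as n labels, the label of w being the least vertex so far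
known to share its cluster, and these labels are exact at the end of the stream. Time per stream
element is not bounded, so after each element the candidates are recomputed by exhaustive search.
The oracle applied to a fair clustering must return that clustering, whatever α is, because distance
zero is attainable. Calling it on all n ^ n labellings therefore lists every fair clustering
(`tupleCandidate_le`). The tournament is rerun as well, and the query only copies the stored winner.
Halting within the limits is proved with the predicate `Ends`; steps are counted for the query
alone. -/

namespace FairConsensus

/-! ### The Hamming metric on finite sets -/

section Hamming

variable {β : Type*} [DecidableEq β]

/-- The Hamming distance of two finite sets. -/
def hd (A B : Finset β) : ℕ := (symmDiff A B).card

theorem hd_comm (A B : Finset β) : hd A B = hd B A := by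
  rw [hd, hd, symmDiff_comm]

theorem hd_triangle (A B C : Finset β) : hd A C ≤ hd A B + hd B C := by
  unfold hd
  refine le_trans (Finset.card_le_card ?_) (Finset.card_union_le _ _)
  exact symmDiff_triangle A B C

theorem eq_of_hd_eq_zero {A B : Finset β} (h : hd A B = 0) : A = B := by
  simpa [hd] using h

theorem hd_triangle_real (A B C : Finset β) : (hd A C : ℝ) ≤ hd A B + hd B C := by
  exact_mod_cast hd_triangle A B C

theorem card_symmDiff_add (a z : Finset β) :
    (symmDiff a z).card + 2 * (a ∩ z).card = a.card + z.card := by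
  have h1 : symmDiff a z = (a \ z) ∪ (z \ a) := rfl
  have h2 : Disjoint (a \ z) (z \ a) := by
    rw [Finset.disjoint_left]
    intro x hx hx'
    simp at hx hx'
    tauto
  rw [h1, Finset.card_union_of_disjoint h2]
  have := Finset.card_sdiff_add_card_inter a z
  have h3 := Finset.card_sdiff_add_card_inter z a
  rw [Finset.inter_comm z a] at h3
  omega

/-- Translation by `F` moves `F` to the empty set. The overlap of the two differences is then
exactly what is saved against the triangle inequality through `F`. -/
theorem hd_shift (c F y : Finset β) :
    (hd c y : ℝ) = hd c F + hd y F - 2 * ((symmDiff c F ∩ symmDiff y F).card : ℝ) := by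
  have h := card_symmDiff_add (symmDiff c F) (symmDiff y F)
  have h1 : symmDiff (symmDiff c F) (symmDiff y F) = symmDiff c y := by
    rw [symmDiff_symmDiff_symmDiff_comm]; simp
  rw [h1] at h
  have h' : (hd c y : ℝ) + 2 * ((symmDiff c F ∩ symmDiff y F).card : ℝ) = hd c F + hd y F := by
    unfold hd; exact_mod_cast h
  linarith

/-- A Bonferroni inequality inside `z`: three sets can each fill a large part of `z` only if some of
them overlap. -/
theorem card_inter_three_le (a b c z : Finset β) :
    (a ∩ z).card + (b ∩ z).card + (c ∩ z).card ≤
      z.card + (a ∩ b).card + (a ∩ c).card + (b ∩ c).card := by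
  have h1 := Finset.card_union_add_card_inter (a ∩ z) (b ∩ z)
  have h2 := Finset.card_union_add_card_inter ((a ∩ z) ∪ (b ∩ z)) (c ∩ z)
  have h3 : ((a ∩ z ∪ b ∩ z) ∪ c ∩ z).card ≤ z.card := Finset.card_le_card (by
    intro x hx; simp at hx; tauto)
  have h4 : ((a ∩ z) ∩ (b ∩ z)).card ≤ (a ∩ b).card := Finset.card_le_card (by
    intro x hx; simp at hx ⊢; tauto)
  have h5 : ((a ∩ z ∪ b ∩ z) ∩ (c ∩ z)).card ≤ ((a ∩ c) ∪ (b ∩ c)).card :=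
    Finset.card_le_card (by intro x hx; simp at hx ⊢; tauto)
  have h6 := Finset.card_union_le (a ∩ c) (b ∩ c)
  omega

/-- The sets `a ∩ b` and `b ∩ z` lie in `b` and meet only inside `a ∩ z`. So if `z` covers most of
`b` but little of `a`, then `a` and `b` are nearly disjoint. -/
theorem card_inter_le_add_sdiff (a b z : Finset β) :
    (a ∩ b).card + (b ∩ z).card ≤ (a ∩ z).card + b.card := by
  have h1 := Finset.card_union_add_card_inter (a ∩ b) (b ∩ z)
  have h2 : ((a ∩ b) ∪ (b ∩ z)).card ≤ b.card := Finset.card_le_card (by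
    intro x hx; simp at hx; tauto)
  have h3 : ((a ∩ b) ∩ (b ∩ z)).card ≤ (a ∩ z).card := Finset.card_le_card (by
    intro x hx; simp at hx ⊢; tauto)
  omega

end Hamming

/-! ### A leave-one-out estimate -/

/-- Exchangeability: a fresh element together with a `k`-tuple is a `(k + 1)`-tuple with a marked
position, and all positions contribute equally. A bound inside every single `(k + 1)`-tuple thus
controls the average number of bad elements, without a union bound over the possible candidates. -/
theorem leave_one_out {ι : Type*} [Fintype ι] [DecidableEq ι] (k : ℕ) (Bad : ι → (Fin k → ι) → Prop)
    [∀ x T, Decidable (Bad x T)] (b : ℕ)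
    (h : ∀ τ : Fin (k + 1) → ι,
      (Finset.univ.filter fun i : Fin (k + 1) => Bad (τ i) (i.removeNth τ)).card ≤ b) :
    (k + 1) * ∑ T : Fin k → ι, (Finset.univ.filter fun x => Bad x T).card ≤
      b * Fintype.card ι ^ (k + 1) := by
  have h1 : ∀ i : Fin (k + 1), (∑ τ : Fin (k + 1) → ι, if Bad (τ i) (i.removeNth τ) then 1 else 0)
      = ∑ T : Fin k → ι, (Finset.univ.filter fun x => Bad x T).card := by
    intro i
    -- Splitting `τ` into its entry at position `i` and the rest removes the dependence on `i`.
    rw [← (Fin.insertNthEquiv (fun _ : Fin (k + 1) => ι) i).sum_comp, Fintype.sum_prod_type_right]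
    refine Finset.sum_congr rfl fun T _ => ?_
    rw [Finset.card_filter]
    refine Finset.sum_congr rfl fun x _ => ?_
    simp [Fin.insertNthEquiv]
  calc (k + 1) * ∑ T : Fin k → ι, (Finset.univ.filter fun x => Bad x T).card
      = ∑ i : Fin (k + 1), ∑ τ : Fin (k + 1) → ι, (if Bad (τ i) (i.removeNth τ) then 1 else 0) := by
        rw [Finset.sum_congr rfl fun i _ => h1 i]; simp
    _ = ∑ τ : Fin (k + 1) → ι,
        (Finset.univ.filter fun i : Fin (k + 1) => Bad (τ i) (i.removeNth τ)).card := by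
        rw [Finset.sum_comm]
        refine Finset.sum_congr rfl fun τ _ => ?_
        rw [Finset.card_filter]
    _ ≤ ∑ τ : Fin (k + 1) → ι, b := Finset.sum_le_sum fun τ _ => h τ
    _ = b * Fintype.card ι ^ (k + 1) := by simp [mul_comm]

theorem exists_four_of_three_lt_card {ι : Type*} [DecidableEq ι] (s : Finset ι) (h : 3 < s.card) :
    ∃ a b c d, a ∈ s ∧ b ∈ s ∧ c ∈ s ∧ d ∈ s ∧ a ≠ b ∧ a ≠ c ∧ a ≠ d ∧ b ≠ c ∧ b ≠ d ∧ c ≠ d := by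
  obtain ⟨a, ha⟩ : s.Nonempty := Finset.card_pos.mp (by omega)
  have h2 : 2 < (s.erase a).card := by rw [Finset.card_erase_of_mem ha]; omega
  obtain ⟨b, hb, c, hc, d, hd, hbc, hbd, hcd⟩ := Finset.two_lt_card.mp h2
  simp only [Finset.mem_erase] at hb hc hd
  exact ⟨a, b, c, d, ha, hb.2, hc.2, hd.2, Ne.symm hb.1, Ne.symm hc.1, Ne.symm hd.1, hbc, hbd, hcd⟩

/-! ### Power sums -/

/-- Minkowski's inequality for a constant summand. As `M` is the power mean, `d i + h * M` is `1 +
h` times a convex combination of `d i` and `M`, and convexity of the power gives the bound without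
taking roots. -/
theorem sum_pow_le_of_le_add {ι : Type*} (s : Finset ι) (ℓ : ℕ) (x d : ι → ℝ)
    (hx : ∀ i ∈ s, 0 ≤ x i) (hd : ∀ i ∈ s, 0 ≤ d i) (h M : ℝ) (h0 : 0 ≤ h) (hM : 0 ≤ M)
    (hsum : ∑ i ∈ s, d i ^ ℓ = s.card * M ^ ℓ) (hle : ∀ i ∈ s, x i ≤ d i + h * M) :
    ∑ i ∈ s, x i ^ ℓ ≤ (1 + h) ^ ℓ * ∑ i ∈ s, d i ^ ℓ := by
  have hp : (0 : ℝ) < 1 + h := by linarith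
  have key : ∀ i ∈ s, x i ^ ℓ ≤ (1 + h) ^ ℓ * (1 / (1 + h) * d i ^ ℓ + h / (1 + h) * M ^ ℓ) := by
    intro i hi
    have hc := (convexOn_pow ℓ : ConvexOn ℝ (Set.Ici 0) fun x : ℝ => x ^ ℓ).2
      (Set.mem_Ici.mpr (hd i hi)) (Set.mem_Ici.mpr hM)
      (show (0 : ℝ) ≤ 1 / (1 + h) by positivity) (show (0 : ℝ) ≤ h / (1 + h) by positivity)
      (by field_simp)
    simp only [smul_eq_mul] at hc
    calc x i ^ ℓ ≤ (d i + h * M) ^ ℓ := pow_le_pow_left₀ (hx i hi) (hle i hi) ℓ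
      _ = (1 + h) ^ ℓ * (1 / (1 + h) * d i + h / (1 + h) * M) ^ ℓ := by
        rw [← mul_pow]; congr 1; field_simp
      _ ≤ _ := mul_le_mul_of_nonneg_left hc (by positivity)
  calc ∑ i ∈ s, x i ^ ℓ
      ≤ ∑ i ∈ s, (1 + h) ^ ℓ * (1 / (1 + h) * d i ^ ℓ + h / (1 + h) * M ^ ℓ) :=
        Finset.sum_le_sum key
    _ = (1 + h) ^ ℓ * (1 / (1 + h) * ∑ i ∈ s, d i ^ ℓ + h / (1 + h) * (s.card * M ^ ℓ)) := by
        rw [← Finset.mul_sum, Finset.sum_add_distrib, ← Finset.mul_sum]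
        simp; left; ring
    _ = (1 + h) ^ ℓ * ∑ i ∈ s, d i ^ ℓ := by
        rw [← hsum]; congr 1; field_simp

/-! ### A bounded number of random samples yields a good candidate -/

section Candidates

variable {β : Type*} [DecidableEq β]

/-- A candidate that is far from `F` but close to the other samples has a large overlap with their
differences from `F`, whereas the omitted bad sample nearly misses it. Hence the bad samples have
almost disjoint differences. Four of them are contradictory: three would each cover `0.98 * M` of
the fourth one's candidate, and 2.94 exceeds 2.011 + 3 * 0.13. -/
theorem card_bad_le_three {ι : Type*} {k : ℕ} (c : ι → Finset β) (F : Finset β) (M : ℝ)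
    (Y : (Fin k → ι) → Finset β) (hc : ∀ i, (hd (c i) F : ℝ) ≤ 1.01 * M)
    (hr : ∀ T, (hd (Y T) F : ℝ) ≤ 2.011 * M)
    (hY : ∀ T j, (hd (c (T j)) (Y T) : ℝ) ≤ 1.01 * M)
    (τ : Fin (k + 1) → ι)
    [DecidablePred fun i : Fin (k + 1) => 1.99 * M < (hd (Y (i.removeNth τ)) F : ℝ) ∧
      ((symmDiff (c (τ i)) F ∩ symmDiff (Y (i.removeNth τ)) F).card : ℝ) ≤ 0.1 * M] :
    (Finset.univ.filter fun i : Fin (k + 1) => 1.99 * M < (hd (Y (i.removeNth τ)) F : ℝ) ∧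
      ((symmDiff (c (τ i)) F ∩ symmDiff (Y (i.removeNth τ)) F).card : ℝ) ≤ 0.1 * M).card ≤ 3 := by
  by_contra! hcon
  obtain ⟨i, j₁, j₂, j₃, hi, h₁, h₂, h₃, hi1, hi2, hi3, h12, h13, h23⟩ :=
    exists_four_of_three_lt_card _ hcon
  simp only [Finset.mem_filter, Finset.mem_univ, true_and] at hi h₁ h₂ h₃
  have hM : 0 < M := by
    have := hr (i.removeNth τ)
    linarith [hi.1]
  have hclose : ∀ i j : Fin (k + 1), i ≠ j →
      (hd (c (τ j)) (Y (i.removeNth τ)) : ℝ) ≤ 1.01 * M := by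
    intro i j hij
    obtain ⟨l, hl⟩ := Fin.exists_succAbove_eq (Ne.symm hij)
    have := hY (i.removeNth τ) l
    rwa [Fin.removeNth_apply, hl] at this
  set a : Fin (k + 1) → Finset β := fun j => symmDiff (c (τ j)) F with ha
  set z : Fin (k + 1) → Finset β := fun i => symmDiff (Y (i.removeNth τ)) F with hz
  have hcard : ∀ j, ((a j).card : ℝ) = hd (c (τ j)) F := fun j => rfl
  have hzcard : ∀ i, ((z i).card : ℝ) = hd (Y (i.removeNth τ)) F := fun i => rfl
  -- The triangle inequality gives `a j` at least `0.98 * M` elements, so the overlap is at least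
  -- (0.98 + 1.99 - 1.01) / 2 = 0.98 times `M`.
  have hin : ∀ i j, i ≠ j → 1.99 * M < (z i).card → 0.98 * M ≤ ((a j ∩ z i).card : ℝ) := by
    intro i j hij hzi
    have h1 := hclose i j hij
    have h2 := hd_shift (c (τ j)) F (Y (i.removeNth τ))
    have h3 := hd_triangle_real (Y (i.removeNth τ)) (c (τ j)) F
    rw [hd_comm (Y (i.removeNth τ)) (c (τ j))] at h3
    rw [hzcard] at hzi
    change (hd (c (τ j)) (Y (i.removeNth τ)) : ℝ) = hd (c (τ j)) F + hd (Y (i.removeNth τ)) F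
      - 2 * ((a j ∩ z i).card : ℝ) at h2
    linarith
  -- The constant is 0.1 + 1.01 - 0.98 = 0.13.
  have hpair : ∀ j j', j ≠ j' → 1.99 * M < (z j).card → ((a j ∩ z j).card : ℝ) ≤ 0.1 * M →
      ((a j ∩ a j').card : ℝ) ≤ 0.13 * M := by
    intro j j' hjj hzj hbad
    have h1 := hin j j' hjj hzj
    have h2 : ((a j ∩ a j').card : ℝ) + (a j' ∩ z j).card ≤ (a j ∩ z j).card + (a j').card := by
      exact_mod_cast card_inter_le_add_sdiff (a j) (a j') (z j)
    have h3 := hc (τ j')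
    rw [← hcard] at h3
    linarith
  have h4 : ((a j₁ ∩ z i).card : ℝ) + (a j₂ ∩ z i).card + (a j₃ ∩ z i).card ≤
      (z i).card + (a j₁ ∩ a j₂).card + (a j₁ ∩ a j₃).card + (a j₂ ∩ a j₃).card := by
    exact_mod_cast card_inter_three_le (a j₁) (a j₂) (a j₃) (z i)
  have h5 := hr (i.removeNth τ)
  rw [← hzcard] at h5
  have := hin i j₁ hi1 hi.1
  have := hin i j₂ hi2 hi.1
  have := hin i j₃ hi3 hi.1
  have := hpair j₁ j₂ h12 h₁.1 h₁.2
  have := hpair j₁ j₃ h13 h₁.1 h₁.2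
  have := hpair j₂ j₃ h23 h₂.1 h₂.2
  linarith

/-- The power mean of finitely many nonnegative numbers. -/
theorem exists_power_mean {m : ℕ} (hm : 1 ≤ m) (ℓ : ℕ) (hℓ : 1 ≤ ℓ) (d : Fin m → ℝ)
    (hd : ∀ i, 0 ≤ d i) : ∃ M : ℝ, 0 ≤ M ∧ ∑ i, d i ^ ℓ = m * M ^ ℓ := by
  have h0 : 0 ≤ (∑ i, d i ^ ℓ) / m :=
    div_nonneg (Finset.sum_nonneg fun i _ => pow_nonneg (hd i) ℓ) (Nat.cast_nonneg m)
  refine ⟨((∑ i, d i ^ ℓ) / m) ^ (1 / (ℓ : ℝ)), by positivity, ?_⟩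
  have hm' : (m : ℝ) ≠ 0 := by positivity
  rw [← Real.rpow_natCast, ← Real.rpow_mul h0, one_div, inv_mul_cancel₀ (by positivity),
    Real.rpow_one]
  field_simp

/-- Markov's inequality for the power mean. -/
theorem card_le_power_mean {m : ℕ} (ℓ : ℕ) (hℓ : 1 ≤ ℓ) (d : Fin m → ℝ)
    (hd : ∀ i, 0 ≤ d i) (M : ℝ) (hM : 0 ≤ M) (hsum : ∑ i, d i ^ ℓ = m * M ^ ℓ)
    [DecidablePred fun i => d i ≤ 1.001 * M] :
    (m : ℝ) / 1002 ≤ ((Finset.univ.filter fun i => d i ≤ 1.001 * M).card : ℝ) := by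
  have hsplit := Finset.card_filter_add_card_filter_not (s := Finset.univ)
    (fun i : Fin m => d i ≤ 1.001 * M)
  simp only [Finset.card_univ, Fintype.card_fin] at hsplit
  have hsplit' : ((Finset.univ.filter fun i => d i ≤ 1.001 * M).card : ℝ) +
      ((Finset.univ.filter fun i => ¬ d i ≤ 1.001 * M).card : ℝ) = m := by exact_mod_cast hsplit
  -- For `M = 0` all distances vanish; Markov's inequality would divide by `M ^ ℓ`.
  rcases hM.eq_or_lt with h0 | hpos
  · have hall : ∀ i, d i ≤ 1.001 * M := by
      intro i
      have hz : ∑ i, d i ^ ℓ = 0 := by rw [hsum, ← h0, zero_pow (by omega)]; simp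
      have := (Finset.sum_eq_zero_iff_of_nonneg (fun i _ => pow_nonneg (hd i) ℓ)).mp hz i
        (Finset.mem_univ i)
      rw [pow_eq_zero_iff (by omega)] at this
      rw [this, ← h0]; simp
    have : (Finset.univ.filter fun i => ¬ d i ≤ 1.001 * M) = ∅ :=
      Finset.filter_eq_empty_iff.mpr fun i _ => by simpa using hall i
    rw [this] at hsplit'
    simp only [Finset.card_empty, Nat.cast_zero, add_zero] at hsplit'
    rw [hsplit']
    have : (0 : ℝ) ≤ m := Nat.cast_nonneg m
    linarith
  · have h1 : ((Finset.univ.filter fun i => ¬ d i ≤ 1.001 * M).card : ℝ) * (1.001 * M) ^ ℓ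
        ≤ m * M ^ ℓ := by
      rw [← hsum, ← nsmul_eq_mul, ← Finset.sum_const]
      refine le_trans (Finset.sum_le_sum fun i hi => ?_)
        (Finset.sum_le_sum_of_subset_of_nonneg (Finset.filter_subset _ _)
          fun i _ _ => pow_nonneg (hd i) ℓ)
      simp only [Finset.mem_filter, not_le] at hi
      exact pow_le_pow_left₀ (by positivity) hi.2.le ℓ
    have h2 : (1.001 : ℝ) ≤ 1.001 ^ ℓ := by
      calc (1.001 : ℝ) = 1.001 ^ 1 := by norm_num
        _ ≤ 1.001 ^ ℓ := pow_le_pow_right₀ (by norm_num) hℓ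
    rw [mul_pow, ← mul_assoc] at h1
    have h3 := le_of_mul_le_mul_right h1 (by positivity)
    -- At most `m / 1.001` indices exceed the bound, which leaves at least `m / 1001`.
    have h4 : ((Finset.univ.filter fun i => ¬ d i ≤ 1.001 * M).card : ℝ) * 1.001 ≤ m :=
      le_trans (mul_le_mul_of_nonneg_left h2 (by positivity)) h3
    linarith

end Candidates

/-! ### A positive fraction of all tuples yields a factor below three -/

section Candidates

variable {β : Type*} [DecidableEq β]

-- The first entry of a tuple plays a special role: it controls the distance of the candidate from
-- the optimum. Good tuples are therefore counted from below by first entry, with the other entries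
-- restricted to `B`.
open Classical in
theorem sum_card_cons_le {m k : ℕ} (B : Fin m → Prop) (P : (Fin (k + 1) → Fin m) → Prop)
    (J : Finset (Fin m)) :
    ∑ j ∈ J, (Finset.univ.filter fun T : Fin k → {i // B i} =>
      P (Fin.cons j fun t => (T t).1)).card ≤ (Finset.univ.filter P).card := by
  rw [← Finset.card_sigma]
  refine Finset.card_le_card_of_injOn (fun x => Fin.cons x.1 fun t => (x.2 t).1) ?_ ?_
  · intro x hx
    simp only [Finset.coe_sigma, Set.mem_sigma_iff, Finset.mem_coe, Finset.mem_filter,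
      Finset.mem_univ, true_and] at hx ⊢
    exact hx.2
  · rintro ⟨j, T⟩ _ ⟨j', T'⟩ _ h
    simp only at h
    obtain ⟨h1, h2⟩ := Fin.cons_injective2 h
    subst h1
    congr 1
    funext t
    exact Subtype.ext (congrFun h2 t)

/-- The pointwise part of the estimate for a candidate none of whose inputs is bad. -/
theorem sum_pow_le_of_few_failures {m : ℕ} (ℓ : ℕ) (d x : Fin m → ℝ) (M ρ : ℝ) (hM : 0 ≤ M)
    (hd : ∀ i, 0 ≤ d i) (hx : ∀ i, 0 ≤ x i) (hsum : ∑ i, d i ^ ℓ = m * M ^ ℓ)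
    (s : Finset (Fin m)) (hs : (s.card : ℝ) ≤ 2 * ρ * m)
    (hgood : ∀ i, i ∉ s → x i ≤ 2.992 * d i) (hbad : ∀ i ∈ s, x i ≤ 3.1 * M ∨ x i ≤ 2.992 * d i)
    (hρ : 2 * ρ * 3.1 ^ ℓ ≤ 2.993 ^ ℓ - 2.992 ^ ℓ) :
    ∑ i, x i ^ ℓ ≤ 2.993 ^ ℓ * ∑ i, d i ^ ℓ := by
  classical
  have h1 : ∀ i, x i ^ ℓ ≤ 2.992 ^ ℓ * d i ^ ℓ + if i ∈ s then (3.1 * M) ^ ℓ else 0 := by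
    intro i
    have hgd : x i ≤ 2.992 * d i → x i ^ ℓ ≤ 2.992 ^ ℓ * d i ^ ℓ := fun h => by
      rw [← mul_pow]; exact pow_le_pow_left₀ (hx i) h ℓ
    by_cases hi : i ∈ s
    · simp only [hi, if_true]
      rcases hbad i hi with h | h
      · have := pow_le_pow_left₀ (hx i) h ℓ
        have h0 : (0 : ℝ) ≤ 2.992 ^ ℓ * d i ^ ℓ := by have := hd i; positivity
        linarith
      · have h0 : (0 : ℝ) ≤ (3.1 * M) ^ ℓ := by positivity
        linarith [hgd h]
    · simp only [hi, if_false, add_zero]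
      exact hgd (hgood i hi)
  calc ∑ i, x i ^ ℓ ≤ ∑ i, (2.992 ^ ℓ * d i ^ ℓ + if i ∈ s then (3.1 * M) ^ ℓ else 0) :=
        Finset.sum_le_sum fun i _ => h1 i
    _ = 2.992 ^ ℓ * ∑ i, d i ^ ℓ + s.card * (3.1 * M) ^ ℓ := by
        rw [Finset.sum_add_distrib, ← Finset.mul_sum]; simp
    _ ≤ 2.992 ^ ℓ * ∑ i, d i ^ ℓ + (2 * ρ * m) * (3.1 * M) ^ ℓ := by gcongr
    _ = 2.992 ^ ℓ * ∑ i, d i ^ ℓ + (2 * ρ * 3.1 ^ ℓ) * (m * M ^ ℓ) := by rw [mul_pow]; ring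
    _ ≤ 2.992 ^ ℓ * ∑ i, d i ^ ℓ + (2.993 ^ ℓ - 2.992 ^ ℓ) * (m * M ^ ℓ) := by gcongr
    _ = 2.993 ^ ℓ * ∑ i, d i ^ ℓ := by rw [hsum]; ring

open Classical in
/-- If `Y T` is at least as close to the inputs with indices in `T` as `F` is (in the maximum
norm), then a constant fraction of all tuples `T` gives an approximation `Y T` of `F`
by a factor less than three. -/
theorem exists_good_tuples (ℓ : ℕ) (hℓ : 1 ≤ ℓ) :
    ∃ (k : ℕ) (p : ℝ), 0 < p ∧ p ≤ 1 ∧ ∀ {β : Type} [DecidableEq β] (m : ℕ) (_ : 1 ≤ m)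
      (c : Fin m → Finset β) (F : Finset β) (Y : (Fin (k + 1) → Fin m) → Finset β)
      (_ : ∀ T j, ∃ i, hd (c (T j)) (Y T) ≤ hd (c (T i)) F),
      p * (m : ℝ) ^ (k + 1) ≤ ((Finset.univ.filter fun T : Fin (k + 1) → Fin m =>
        ∑ i, (hd (c i) (Y T) : ℝ) ^ ℓ ≤ 2.993 ^ ℓ * ∑ i, (hd (c i) F : ℝ) ^ ℓ).card : ℝ) := by
  -- Chosen so that `2 * ρ * m` failures at cost `3.1 * M` each use up exactly the gap between
  -- `2.992 ^ ℓ` and `2.993 ^ ℓ`.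
  set ρ : ℝ := (2.993 ^ ℓ - 2.992 ^ ℓ) / (2 * 3.1 ^ ℓ) with hρ
  have hρ0 : 0 < ρ := by
    apply div_pos _ (by positivity)
    have : (2.992 : ℝ) ^ ℓ < 2.993 ^ ℓ := pow_lt_pow_left₀ (by norm_num) (by norm_num) (by omega)
    linarith
  have hρ2 : 2 * ρ * 3.1 ^ ℓ ≤ 2.993 ^ ℓ - 2.992 ^ ℓ := by
    rw [hρ]; apply le_of_eq; field_simp
  -- With `k + 1 ≥ 6 / ρ` the average number of bad inputs, at most `3 * m / (k + 1)`, is at most `ρ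
  -- * m / 2`; Markov's inequality then keeps half of the tuples.
  obtain ⟨k, hk⟩ := exists_nat_ge (6 / ρ)
  have hk' : 6 ≤ ((k : ℝ) + 1) * ρ := by
    rw [div_le_iff₀ hρ0] at hk; linarith
  -- The factors are the fraction of usable first entries, the half of the continuations that is
  -- good, and the fraction at least 1/1002 of inputs in `B` for each further entry.
  refine ⟨k, min ρ (1 / 1002) / 2 * (1 / 1002) ^ k, by positivity, ?_, ?_⟩
  · have h1 : min ρ (1 / 1002) / 2 ≤ (1 : ℝ) := by
      have := min_le_right ρ (1 / 1002); linarith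
    have h2 : ((1 : ℝ) / 1002) ^ k ≤ 1 := pow_le_one₀ (by norm_num) (by norm_num)
    calc _ ≤ (1 : ℝ) * 1 := mul_le_mul h1 h2 (by positivity) (by norm_num)
      _ = 1 := one_mul 1
  intro β _ m hm c F Y hY
  classical
  set d : Fin m → ℝ := fun i => (hd (c i) F : ℝ) with hdd
  have hd0 : ∀ i, 0 ≤ d i := fun i => Nat.cast_nonneg _
  obtain ⟨M, hM, hsum⟩ := exists_power_mean hm ℓ hℓ d hd0
  set Good : (Fin (k + 1) → Fin m) → Prop := fun T =>
    ∑ i, (hd (c i) (Y T) : ℝ) ^ ℓ ≤ 2.993 ^ ℓ * ∑ i, d i ^ ℓ with hGood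
  set B : Fin m → Prop := fun i => d i ≤ 1.01 * M with hB
  have hm0 : (0 : ℝ) < m := by exact_mod_cast hm
  set J : Finset (Fin m) := Finset.univ.filter fun i => d i ≤ 1.001 * M with hJ
  have hJcard : (m : ℝ) / 1002 ≤ J.card := by
    have := card_le_power_mean ℓ hℓ d hd0 M hM hsum
    exact this
  have hBcard : (m : ℝ) / 1002 ≤ Fintype.card {i // B i} := by
    refine hJcard.trans ?_
    rw [Fintype.card_subtype]
    exact_mod_cast Finset.card_le_card fun i hi => by
      simp only [hJ, Finset.mem_filter, Finset.mem_univ, true_and, hB] at hi ⊢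
      linarith
  have hBpow : ((m : ℝ) / 1002) ^ k ≤ (Fintype.card {i // B i} : ℝ) ^ k :=
    pow_le_pow_left₀ (by positivity) hBcard k
  -- the tuple built from `j` and `T`, and the distance of its candidate from `F`
  set cons : Fin m → (Fin k → {i // B i}) → Fin (k + 1) → Fin m :=
    fun j T => Fin.cons j fun t => (T t).1 with hcons
  -- The minimax property: the candidate is as central for its tuple as `F`, and all entries are
  -- within `1.01 * M` of `F`.
  have hclose : ∀ j (T : Fin k → {i // B i}), d j ≤ 1.01 * M → ∀ t,
      (hd (c (cons j T t)) (Y (cons j T)) : ℝ) ≤ 1.01 * M := by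
    intro j T hj t
    obtain ⟨i, hi⟩ := hY (cons j T) t
    have h1 : (hd (c (cons j T t)) (Y (cons j T)) : ℝ) ≤ d (cons j T i) := Nat.cast_le.mpr hi
    refine h1.trans ?_
    refine Fin.cases ?_ (fun i' => ?_) i
    · exact hj
    · exact (T i').2
  -- The triangle inequality is applied through the first entry, so a closer first entry gives a
  -- closer candidate.
  have hr : ∀ (x : ℝ) j (T : Fin k → {i // B i}), x ≤ 1.01 → d j ≤ x * M →
      (hd (Y (cons j T)) F : ℝ) ≤ (1.01 + x) * M := by
    intro x j T hx hj
    have hj' : d j ≤ 1.01 * M := hj.trans (by gcongr)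
    have h1 := hclose j T hj' 0
    have h2 := hd_triangle_real (Y (cons j T)) (c j) F
    rw [hd_comm (Y (cons j T)) (c j)] at h2
    have h3 : cons j T 0 = j := rfl
    rw [h3] at h1
    have : (hd (c j) F : ℝ) = d j := rfl
    linarith
  -- Here Minkowski's inequality alone suffices, with factor 1 + 1.99 < 2.993.
  have hnear : ∀ T, (hd (Y T) F : ℝ) ≤ 1.99 * M → Good T := by
    intro T hT
    have h1 := sum_pow_le_of_le_add Finset.univ ℓ (fun i => (hd (c i) (Y T) : ℝ)) d
      (fun i _ => Nat.cast_nonneg _) (fun i _ => hd0 i) 1.99 M (by norm_num) hM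
      (by simpa using hsum) (fun i _ => by
        have := hd_triangle_real (c i) F (Y T)
        rw [hd_comm F (Y T)] at this
        have h3 : (hd (c i) F : ℝ) = d i := rfl
        linarith)
    refine h1.trans ?_
    have h2 : (1 + 1.99 : ℝ) ^ ℓ ≤ 2.993 ^ ℓ := pow_le_pow_left₀ (by norm_num) (by norm_num) ℓ
    exact mul_le_mul_of_nonneg_right h2 (Finset.sum_nonneg fun i _ => pow_nonneg (hd0 i) ℓ)
  -- it suffices to have many good first components, each with half of all continuations
  have hcount : ∀ J' : Finset (Fin m), min ρ (1 / 1002) * m ≤ (J'.card : ℝ) →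
      (∀ j ∈ J', (Fintype.card {i // B i} : ℝ) ^ k / 2 ≤
        ((Finset.univ.filter fun T => Good (cons j T)).card : ℝ)) →
      min ρ (1 / 1002) / 2 * (1 / 1002) ^ k * (m : ℝ) ^ (k + 1) ≤
        ((Finset.univ.filter Good).card : ℝ) := by
    intro J' h1 h2
    have h3 : ((∑ j ∈ J', (Finset.univ.filter fun T => Good (cons j T)).card : ℕ) : ℝ) ≤
        ((Finset.univ.filter Good).card : ℝ) := by
      refine Nat.cast_le.mpr ?_
      convert sum_card_cons_le B Good J'
    refine le_trans ?_ h3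
    push_cast
    calc min ρ (1 / 1002) / 2 * (1 / 1002) ^ k * (m : ℝ) ^ (k + 1)
        = (min ρ (1 / 1002) * m) * (((m : ℝ) / 1002) ^ k / 2) := by
          rw [div_pow, div_pow]; ring
      _ ≤ (J'.card : ℝ) * ((Fintype.card {i // B i} : ℝ) ^ k / 2) := by gcongr
      _ = ∑ j ∈ J', (Fintype.card {i // B i} : ℝ) ^ k / 2 := by simp
      _ ≤ _ := Finset.sum_le_sum h2
  suffices hsuff : min ρ (1 / 1002) / 2 * (1 / 1002) ^ k * (m : ℝ) ^ (k + 1) ≤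
      ((Finset.univ.filter Good).card : ℝ) by
    convert hsuff using 3
  set S : Finset (Fin m) := Finset.univ.filter fun i => d i < 0.98 * M with hS
  -- If many inputs are within `0.98 * M`, any of them as first entry gives radius (1.01 + 0.98) *
  -- M. If they are few, they can all be counted among the failures.
  by_cases hcase : ρ * m ≤ (S.card : ℝ)
  · refine hcount S (le_trans ?_ hcase) fun j hj => ?_
    · gcongr; exact min_le_left _ _
    · have hj' : d j < 0.98 * M := by simpa [hS] using hj
      have : (Finset.univ.filter fun T => Good (cons j T)) = Finset.univ :=
        Finset.filter_true_of_mem fun T _ => hnear _ (by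
          have := hr 0.98 j T (by norm_num) hj'.le
          linarith)
      rw [this]
      simp only [Finset.card_univ, Fintype.card_fun, Fintype.card_fin, Nat.cast_pow]
      have : (0 : ℝ) ≤ (Fintype.card {i // B i} : ℝ) ^ k := by positivity
      linarith
  · push Not at hcase
    refine hcount J (le_trans ?_ hJcard) fun j hj => ?_
    · have := mul_le_mul_of_nonneg_right (min_le_right ρ (1 / 1002)) hm0.le
      linarith
    have hj' : d j ≤ 1.001 * M := by simpa [hJ] using hj
    have hr' : ∀ T : Fin k → {i // B i}, (hd (Y (cons j T)) F : ℝ) ≤ 2.011 * M := fun T => by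
      have := hr 1.001 j T (by norm_num) hj'
      linarith
    set Bad : {i // B i} → (Fin k → {i // B i}) → Prop := fun x T =>
      1.99 * M < (hd (Y (cons j T)) F : ℝ) ∧
      ((symmDiff (c x) F ∩ symmDiff (Y (cons j T)) F).card : ℝ) ≤ 0.1 * M with hBad
    have hloo := leave_one_out k Bad 3 fun τ =>
      card_bad_le_three (fun i : {i // B i} => c i) F M (fun T => Y (cons j T)) (fun i => i.2) hr'
        (fun T t => hclose j T (hj'.trans (by gcongr; norm_num)) t.succ) τ
    have hnb : ∀ T : Fin k → {i // B i},
        ((Finset.univ.filter fun x => Bad x T).card : ℝ) ≤ ρ * m → Good (cons j T) := by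
      intro T hT
      by_cases hfar : 1.99 * M < (hd (Y (cons j T)) F : ℝ)
      swap
      · exact hnear _ (not_lt.mp hfar)
      set s : Finset (Fin m) := S ∪ (Finset.univ.filter fun x => Bad x T).image Subtype.val with hs
      refine sum_pow_le_of_few_failures ℓ d _ M ρ hM hd0 (fun i => Nat.cast_nonneg _) hsum s ?_
        ?_ ?_ hρ2
      · have h1 : (s.card : ℝ) ≤ S.card + ((Finset.univ.filter fun x => Bad x T).card : ℝ) := by
          exact_mod_cast (Finset.card_union_le _ _).trans
            (Nat.add_le_add_left Finset.card_image_le _)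
        linarith
      · intro i hi
        simp only [hs, hS, Finset.mem_union, Finset.mem_filter, Finset.mem_univ, true_and,
          Finset.mem_image, Subtype.exists, exists_and_right, exists_eq_right, not_or, not_lt,
          not_exists] at hi
        have htri := hd_triangle_real (c i) F (Y (cons j T))
        rw [hd_comm F (Y (cons j T))] at htri
        have hdi : (hd (c i) F : ℝ) = d i := rfl
        have := hr' T
        -- Inside `B` the overlap saves `0.2 * M`, and `d i ≥ 0.98 * M` absorbs the remaining `1.811
        -- * M`. Outside `B` no saving is needed: `2.011 * M ≤ 1.992 * d i` because `d i > 1.01 *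
        -- M`.
        by_cases hBi : B i
        · have hnb := hi.2 hBi
          simp only [hBad, not_and, not_le] at hnb
          have h1 := hnb hfar
          have h2 := hd_shift (c i) F (Y (cons j T))
          linarith [hi.1]
        · simp only [hB, not_le] at hBi
          linarith
      · intro i hi
        -- A failure inside `B` costs at most 1.01 + 2.011 < 3.1 times `M`.
        by_cases hBi : B i
        · left
          have htri := hd_triangle_real (c i) F (Y (cons j T))
          rw [hd_comm F (Y (cons j T))] at htri
          have hdi : (hd (c i) F : ℝ) = d i := rfl
          have := hr' T
          simp only [hB] at hBi
          linarith
        · right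
          have htri := hd_triangle_real (c i) F (Y (cons j T))
          rw [hd_comm F (Y (cons j T))] at htri
          have hdi : (hd (c i) F : ℝ) = d i := rfl
          have := hr' T
          simp only [hB, not_le] at hBi
          linarith
    -- Markov's inequality over `T`
    have hsplit := Finset.card_filter_add_card_filter_not (s := Finset.univ)
      (fun T : Fin k → {i // B i} => Good (cons j T))
    simp only [Finset.card_univ, Fintype.card_fun, Fintype.card_fin] at hsplit
    have hsplit' : ((Finset.univ.filter fun T : Fin k → {i // B i} => Good (cons j T)).card : ℝ) +
        ((Finset.univ.filter fun T : Fin k → {i // B i} => ¬ Good (cons j T)).card : ℝ) =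
        (Fintype.card {i // B i} : ℝ) ^ k := by exact_mod_cast hsplit
    have hmk : ((Finset.univ.filter fun T : Fin k → {i // B i} => ¬ Good (cons j T)).card : ℝ) *
        (ρ * m) ≤ ∑ T : Fin k → {i // B i}, ((Finset.univ.filter fun x => Bad x T).card : ℝ) := by
      rw [← nsmul_eq_mul, ← Finset.sum_const]
      refine le_trans (Finset.sum_le_sum fun T hT => ?_)
        (Finset.sum_le_sum_of_subset_of_nonneg (Finset.filter_subset _ _)
          fun i _ _ => Nat.cast_nonneg _)
      by_contra hcon
      exact (Finset.mem_filter.mp hT).2 (hnb T (not_le.mp hcon).le)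
    have hloo' : ((k : ℝ) + 1) * ∑ T : Fin k → {i // B i},
        ((Finset.univ.filter fun x => Bad x T).card : ℝ) ≤
        3 * (Fintype.card {i // B i} : ℝ) ^ (k + 1) := by exact_mod_cast hloo
    have hBm : (Fintype.card {i // B i} : ℝ) ≤ m := by
      have := Fintype.card_subtype_le B
      rw [Fintype.card_fin] at this
      exact_mod_cast this
    set u : ℝ := ((Finset.univ.filter fun T : Fin k → {i // B i} => ¬ Good (cons j T)).card : ℝ)
    have hu : u * (6 * m) ≤ 3 * (Fintype.card {i // B i} : ℝ) ^ k * m := by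
      calc u * (6 * m) ≤ u * ((((k : ℝ) + 1) * ρ) * m) := by gcongr
        _ = ((k : ℝ) + 1) * (u * (ρ * m)) := by ring
        _ ≤ ((k : ℝ) + 1) * ∑ T : Fin k → {i // B i},
            ((Finset.univ.filter fun x => Bad x T).card : ℝ) := by gcongr
        _ ≤ 3 * (Fintype.card {i // B i} : ℝ) ^ (k + 1) := hloo'
        _ = 3 * (Fintype.card {i // B i} : ℝ) ^ k * Fintype.card {i // B i} := by ring
        _ ≤ _ := by gcongr
    have hu2 : u * 6 ≤ 3 * (Fintype.card {i // B i} : ℝ) ^ k := by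
      rw [← mul_assoc] at hu
      exact le_of_mul_le_mul_right hu hm0
    linarith

end Candidates

/-! ### Selecting a candidate with validation samples -/

section Selection

/-- A Chernoff bound for sampling with replacement, stated as a count. -/
theorem card_sum_nonpos_le {m : ℕ} (V : ℕ) (X : Fin m → ℝ) (hX : ∀ i, |X i| ≤ 1) (ε : ℝ)
    (hε : 0 < ε) (hε1 : ε ≤ 1) (hmean : ε * m ≤ ∑ i, X i)
    [DecidablePred fun v : Fin V → Fin m => ∑ j, X (v j) ≤ 0] :
    ((Finset.univ.filter fun v : Fin V → Fin m => ∑ j, X (v j) ≤ 0).card : ℝ) ≤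
      (m : ℝ) ^ V * Real.exp (-(ε ^ 2 / 4 * V)) := by
  -- The exponential moment at `-ε / 2`, by the bound `1 + x + x ^ 2` for the exponential on `|x| ≤
  -- 1`. On average the linear term gains `ε ^ 2 / 2` and the square loses at most `ε ^ 2 / 4`.
  have h1 : ∀ i, Real.exp (-(ε / 2) * X i) ≤ 1 - ε / 2 * X i + ε ^ 2 / 4 := by
    intro i
    have hab := abs_le.mp (hX i)
    have habs : |-(ε / 2) * X i| ≤ 1 := by
      rw [abs_mul, abs_neg, abs_of_pos (by linarith : 0 < ε / 2)]
      exact mul_le_one₀ (by linarith) (abs_nonneg _) (hX i)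
    have h := (abs_le.mp (Real.abs_exp_sub_one_sub_id_le habs)).2
    have hsq : (-(ε / 2) * X i) ^ 2 ≤ ε ^ 2 / 4 := by
      have : X i ^ 2 ≤ 1 := by rw [sq_le_one_iff_abs_le_one]; exact hX i
      calc (-(ε / 2) * X i) ^ 2 = ε ^ 2 / 4 * X i ^ 2 := by ring
        _ ≤ ε ^ 2 / 4 * 1 := by gcongr
        _ = ε ^ 2 / 4 := mul_one _
    linarith
  have h2 : ∑ i, Real.exp (-(ε / 2) * X i) ≤ m * Real.exp (-(ε ^ 2 / 4)) := by
    calc ∑ i, Real.exp (-(ε / 2) * X i) ≤ ∑ i, (1 - ε / 2 * X i + ε ^ 2 / 4) :=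
          Finset.sum_le_sum fun i _ => h1 i
      _ = m * (1 + ε ^ 2 / 4) - ε / 2 * ∑ i, X i := by
          rw [Finset.sum_add_distrib, Finset.sum_sub_distrib, ← Finset.mul_sum]
          simp; ring
      _ ≤ m * (1 + ε ^ 2 / 4) - ε / 2 * (ε * m) := by gcongr
      _ = m * (-(ε ^ 2 / 4) + 1) := by ring
      _ ≤ m * Real.exp (-(ε ^ 2 / 4)) := by gcongr; exact Real.add_one_le_exp _
  calc ((Finset.univ.filter fun v : Fin V → Fin m => ∑ j, X (v j) ≤ 0).card : ℝ)
      = ∑ v ∈ Finset.univ.filter fun v : Fin V → Fin m => ∑ j, X (v j) ≤ 0, (1 : ℝ) := by simp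
    _ ≤ ∑ v ∈ Finset.univ.filter fun v : Fin V → Fin m => ∑ j, X (v j) ≤ 0,
          ∏ j, Real.exp (-(ε / 2) * X (v j)) := by
        refine Finset.sum_le_sum fun v hv => ?_
        rw [← Real.exp_sum, ← Finset.mul_sum]
        refine Real.one_le_exp ?_
        exact mul_nonneg_of_nonpos_of_nonpos (by linarith) (Finset.mem_filter.mp hv).2
    _ ≤ ∑ v : Fin V → Fin m, ∏ j, Real.exp (-(ε / 2) * X (v j)) :=
        Finset.sum_le_sum_of_subset_of_nonneg (Finset.filter_subset _ _)
          fun v _ _ => Finset.prod_nonneg fun j _ => (Real.exp_pos _).le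
    _ = (∑ i, Real.exp (-(ε / 2) * X i)) ^ V := (Fintype.sum_pow (fun i => Real.exp (-(ε / 2) * X i)) V).symm
    _ ≤ (m * Real.exp (-(ε ^ 2 / 4))) ^ V :=
        pow_le_pow_left₀ (Finset.sum_nonneg fun i _ => (Real.exp_pos _).le) h2 V
    _ = (m : ℝ) ^ V * Real.exp (-(ε ^ 2 / 4 * V)) := by
        rw [mul_pow, ← Real.exp_nat_mul]; congr 2; ring

/-- In a tournament, a vertex of maximal out-degree reaches every vertex in at most two steps. -/
theorem exists_two_step_of_max_wins {ι : Type*} [Fintype ι] [DecidableEq ι] (r : ι → ι → Prop)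
    [∀ x y, Decidable (r x y)] (htot : ∀ x y, r x y ∨ r y x) (x : ι)
    (hx : ∀ y, (Finset.univ.filter (r y)).card ≤ (Finset.univ.filter (r x)).card) (y : ι) :
    ∃ z, r x z ∧ r z y := by
  by_contra! hcon
  -- If `y` were out of reach, it would beat everything that `x` beats and also itself, which `x`
  -- does not beat; this contradicts maximality.
  have hxy : ¬ r x y := fun h => hcon y h ((htot y y).elim id id)
  have hss : Finset.univ.filter (r x) ⊂ Finset.univ.filter (r y) := by
    refine Finset.ssubset_iff_subset_ne.mpr ⟨fun z hz => ?_, fun heq => ?_⟩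
    · simp only [Finset.mem_filter, Finset.mem_univ, true_and] at hz ⊢
      exact (htot z y).resolve_left (hcon z hz)
    · have : y ∈ Finset.univ.filter (r y) := by simpa using (htot y y).elim id id
      rw [← heq] at this
      exact hxy (by simpa using this)
  exact absurd (hx y) (not_le.mpr (Finset.card_lt_card hss))

variable {β : Type*} [DecidableEq β]

/-- The sum of the `ℓ`-th powers of the distances from `y`, truncated at `A`. -/
def truncSum (ℓ A : ℕ) {m V : ℕ} (c : Fin m → Finset β) (v : Fin V → Fin m) (y : Finset β) : ℕ :=
  ∑ j, min (hd (c (v j)) y) A ^ ℓ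

/-- `y` is not worse than `y'` on the sample `v`; distances are truncated at a multiple of the
distance between `y` and `y'`. -/
def Beats (ℓ C : ℕ) {m V : ℕ} (c : Fin m → Finset β) (v : Fin V → Fin m) (y y' : Finset β) :
    Prop :=
  truncSum ℓ (C * hd y y') c v y ≤ truncSum ℓ (C * hd y y') c v y'

theorem beats_total (ℓ C : ℕ) {m V : ℕ} (c : Fin m → Finset β) (v : Fin V → Fin m)
    (y y' : Finset β) : Beats ℓ C c v y y' ∨ Beats ℓ C c v y' y := by
  unfold Beats
  rw [hd_comm y' y]
  exact le_total _ _

/-- Below the threshold `C * D` truncation changes nothing; above it the additive error `D` is at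
most the fraction `1 / C` of the distance. Comparing truncated powers therefore decides the full
comparison up to the factor `(1 + 1 / C) ^ ℓ`. -/
theorem pow_le_trunc {ℓ : ℕ} {x x' D C : ℝ} (hC : 0 < C) (hx : 0 ≤ x)
    (hD : 0 ≤ D) (h : x ≤ x' + D) :
    x ^ ℓ ≤ (1 + 1 / C) ^ ℓ * (x' ^ ℓ + min x (C * D) ^ ℓ - min x' (C * D) ^ ℓ) := by
  have hl : (1 : ℝ) ≤ (1 + 1 / C) ^ ℓ :=
    one_le_pow₀ (by have : 0 < 1 / C := by positivity
                    linarith)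
  have hCD : C * D * (1 / C) = D := by field_simp
  have hA : 0 ≤ C * D := by positivity
  rcases le_total x (C * D) with h1 | h1 <;> rcases le_total x' (C * D) with h2 | h2
  · rw [min_eq_left h1, min_eq_left h2]
    have : 0 ≤ x ^ ℓ := by positivity
    nlinarith
  · rw [min_eq_left h1, min_eq_right h2]
    have h3 : (C * D) ^ ℓ ≤ x' ^ ℓ := pow_le_pow_left₀ hA h2 ℓ
    have : 0 ≤ x ^ ℓ := by positivity
    nlinarith
  · rw [min_eq_right h1, min_eq_left h2]
    calc x ^ ℓ ≤ ((1 + 1 / C) * (C * D)) ^ ℓ := pow_le_pow_left₀ hx (by nlinarith) ℓ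
      _ = _ := by rw [mul_pow]; ring
  · rw [min_eq_right h1, min_eq_right h2]
    calc x ^ ℓ ≤ ((1 + 1 / C) * x') ^ ℓ := by
          refine pow_le_pow_left₀ hx ?_ ℓ
          have : C * D * (1 / C) ≤ x' * (1 / C) := by gcongr
          linarith
      _ = _ := by rw [mul_pow]; ring

/-- The truncation factor. -/
abbrev truncFactor : ℕ := 10000

/-- The accuracy with which truncated sums have to be estimated. -/
noncomputable def accuracy (ℓ : ℕ) : ℝ := 1 / 100000 / (1.0001 ^ ℓ * 20000 ^ ℓ)

theorem accuracy_pos (ℓ : ℕ) : 0 < accuracy ℓ := by unfold accuracy; positivity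

theorem accuracy_le_one (ℓ : ℕ) : accuracy ℓ ≤ 1 := by
  unfold accuracy
  have h1 : (1 : ℝ) ≤ 1.0001 ^ ℓ := one_le_pow₀ (by norm_num)
  have h2 : (1 : ℝ) ≤ 20000 ^ ℓ := one_le_pow₀ (by norm_num)
  rw [div_le_one (by positivity)]
  nlinarith

/-- The threshold scales with the distance `D` of the two candidates because every input is at
distance at least `D / 2` from one of them. So `m * D ^ ℓ` is at most `2 ^ ℓ` times the sum of both
objectives, and `accuracy` makes the allowed error a tiny fraction of that sum. The sample `id`
stands for the whole input. -/
theorem sum_pow_le_of_truncSum_le {m : ℕ} (ℓ : ℕ) (hℓ : 1 ≤ ℓ) (c : Fin m → Finset β)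
    (y y' : Finset β)
    (h : (truncSum ℓ (truncFactor * hd y y') c id y : ℝ) ≤
      truncSum ℓ (truncFactor * hd y y') c id y' +
        accuracy ℓ * m * ((truncFactor * hd y y' : ℕ) : ℝ) ^ ℓ) :
    ∑ i, (hd (c i) y : ℝ) ^ ℓ ≤ 1.0003 ^ ℓ * ∑ i, (hd (c i) y' : ℝ) ^ ℓ := by
  set S := ∑ i, (hd (c i) y : ℝ) ^ ℓ with hS
  set S' := ∑ i, (hd (c i) y' : ℝ) ^ ℓ with hS'
  have hS0 : 0 ≤ S := Finset.sum_nonneg fun i _ => by positivity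
  have hS0' : 0 ≤ S' := Finset.sum_nonneg fun i _ => by positivity
  set D : ℝ := (hd y y' : ℝ) with hD
  have hpt : ∀ i, (hd (c i) y : ℝ) ^ ℓ ≤ 1.0001 ^ ℓ * ((hd (c i) y' : ℝ) ^ ℓ +
      min (hd (c i) y : ℝ) (10000 * D) ^ ℓ - min (hd (c i) y' : ℝ) (10000 * D) ^ ℓ) := by
    intro i
    have h1 := hd_triangle_real (c i) y' y
    rw [hd_comm y' y] at h1
    have := pow_le_trunc (ℓ := ℓ) (C := 10000) (by norm_num) (Nat.cast_nonneg (hd (c i) y))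
      (Nat.cast_nonneg _) h1
    norm_num at this ⊢
    exact this
  have hsum : S ≤ 1.0001 ^ ℓ * (S' + (truncSum ℓ (truncFactor * hd y y') c id y : ℝ) -
      truncSum ℓ (truncFactor * hd y y') c id y') := by
    calc S ≤ ∑ i, 1.0001 ^ ℓ * ((hd (c i) y' : ℝ) ^ ℓ +
      min (hd (c i) y : ℝ) (10000 * D) ^ ℓ - min (hd (c i) y' : ℝ) (10000 * D) ^ ℓ) :=
          Finset.sum_le_sum fun i _ => hpt i
      _ = _ := by
        rw [← Finset.mul_sum, Finset.sum_sub_distrib, Finset.sum_add_distrib]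
        simp [truncSum, hD, hS']
  have hDle : m * D ^ ℓ ≤ 2 ^ ℓ * (S + S') := by
    have : ∀ i, D ^ ℓ ≤ 2 ^ ℓ * ((hd (c i) y : ℝ) ^ ℓ + (hd (c i) y' : ℝ) ^ ℓ) := by
      intro i
      have h1 := hd_triangle_real y (c i) y'
      rw [hd_comm y (c i)] at h1
      have h2 : (0 : ℝ) ≤ (hd (c i) y : ℝ) ^ ℓ := by positivity
      have h3 : (0 : ℝ) ≤ (hd (c i) y' : ℝ) ^ ℓ := by positivity
      rcases le_total (hd (c i) y : ℝ) (hd (c i) y') with h4 | h4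
      · calc D ^ ℓ ≤ (2 * (hd (c i) y' : ℝ)) ^ ℓ :=
              pow_le_pow_left₀ (Nat.cast_nonneg _) (by linarith) ℓ
          _ = 2 ^ ℓ * (hd (c i) y' : ℝ) ^ ℓ := mul_pow _ _ _
          _ ≤ _ := by gcongr; linarith
      · calc D ^ ℓ ≤ (2 * (hd (c i) y : ℝ)) ^ ℓ :=
              pow_le_pow_left₀ (Nat.cast_nonneg _) (by linarith) ℓ
          _ = 2 ^ ℓ * (hd (c i) y : ℝ) ^ ℓ := mul_pow _ _ _
          _ ≤ _ := by gcongr; linarith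
    calc m * D ^ ℓ = ∑ _i : Fin m, D ^ ℓ := by simp
      _ ≤ ∑ i, 2 ^ ℓ * ((hd (c i) y : ℝ) ^ ℓ + (hd (c i) y' : ℝ) ^ ℓ) :=
          Finset.sum_le_sum fun i _ => this i
      _ = _ := by rw [← Finset.mul_sum, Finset.sum_add_distrib]
  have hacc : 1.0001 ^ ℓ * (accuracy ℓ * m * ((truncFactor * hd y y' : ℕ) : ℝ) ^ ℓ) ≤
      1 / 100000 * (S + S') := by
    calc 1.0001 ^ ℓ * (accuracy ℓ * m * ((truncFactor * hd y y' : ℕ) : ℝ) ^ ℓ)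
        = 1 / 100000 / 2 ^ ℓ * (m * D ^ ℓ) := by
          unfold accuracy
          push_cast
          rw [mul_pow, show (20000 : ℝ) = 2 * 10000 by norm_num, mul_pow]
          field_simp
          norm_num [hD]
      _ ≤ 1 / 100000 / 2 ^ ℓ * (2 ^ ℓ * (S + S')) := by gcongr
      _ = 1 / 100000 * (S + S') := by field_simp
  have hl : (1 : ℝ) ≤ 1.0001 ^ ℓ := one_le_pow₀ (by norm_num)
  have hmain : S ≤ 1.0001 ^ ℓ * S' + 1 / 100000 * (S + S') := by
    have : 1.0001 ^ ℓ * (S' + (truncSum ℓ (truncFactor * hd y y') c id y : ℝ) -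
      truncSum ℓ (truncFactor * hd y y') c id y') ≤ 1.0001 ^ ℓ * (S' +
        accuracy ℓ * m * ((truncFactor * hd y y' : ℕ) : ℝ) ^ ℓ) := by
      gcongr; linarith
    linarith
  -- Solving for `S` costs the factor (1 + 1/100000) / (1 - 1/100000) < 1.0001.
  have h2 : S ≤ 1.0001 * (1.0001 ^ ℓ * S') := by
    have : S' ≤ 1.0001 ^ ℓ * S' := le_mul_of_one_le_left hS0' hl
    linarith
  refine h2.trans ?_
  rw [← mul_assoc]
  refine mul_le_mul_of_nonneg_right ?_ hS0'
  calc (1.0001 : ℝ) * 1.0001 ^ ℓ ≤ 1.0001 ^ ℓ * 1.0001 ^ ℓ := by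
        gcongr
        calc (1.0001 : ℝ) = 1.0001 ^ 1 := by norm_num
          _ ≤ 1.0001 ^ ℓ := pow_le_pow_right₀ (by norm_num) hℓ
    _ = (1.0001 * 1.0001) ^ ℓ := (mul_pow _ _ _).symm
    _ ≤ 1.0003 ^ ℓ := pow_le_pow_left₀ (by norm_num) (by norm_num) ℓ

open Classical in
/-- It is unlikely that a sample misjudges two given candidates. -/
theorem card_beats_wrongly_le {m : ℕ} (ℓ V : ℕ) (c : Fin m → Finset β) (y y' : Finset β)
    (h : (truncSum ℓ (truncFactor * hd y y') c id y' : ℝ) +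
        accuracy ℓ * m * ((truncFactor * hd y y' : ℕ) : ℝ) ^ ℓ <
      truncSum ℓ (truncFactor * hd y y') c id y) :
    ((Finset.univ.filter fun v : Fin V → Fin m => Beats ℓ truncFactor c v y y').card : ℝ) ≤
      (m : ℝ) ^ V * Real.exp (-(accuracy ℓ ^ 2 / 4 * V)) := by
  set A : ℕ := truncFactor * hd y y' with hA
  -- Coinciding candidates cannot be separated strictly. So the threshold is positive, and dividing
  -- by `A ^ ℓ` gives variables in [-1, 1].
  have hA0 : 0 < A := by
    rcases Nat.eq_zero_or_pos A with h0 | h0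
    · exfalso
      have hz : hd y y' = 0 := by
        rw [hA] at h0; simpa using h0
      have := eq_of_hd_eq_zero hz
      subst this
      have : 0 ≤ accuracy ℓ * m * ((A : ℕ) : ℝ) ^ ℓ := by
        have := accuracy_pos ℓ; positivity
      linarith
    · exact h0
  have hAp : (0 : ℝ) < (A : ℝ) ^ ℓ := by positivity
  set X : Fin m → ℝ := fun i =>
    (((min (hd (c i) y) A ^ ℓ : ℕ) : ℝ) - ((min (hd (c i) y') A ^ ℓ : ℕ) : ℝ)) / (A : ℝ) ^ ℓ with hX
  have hbd : ∀ z : Finset β, ∀ i, ((min (hd (c i) z) A ^ ℓ : ℕ) : ℝ) ≤ (A : ℝ) ^ ℓ := fun z i => by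
    exact_mod_cast Nat.pow_le_pow_left (min_le_right _ _) ℓ
  have hXabs : ∀ i, |X i| ≤ 1 := by
    intro i
    rw [hX, abs_div, abs_of_pos hAp, div_le_one hAp, abs_le]
    have h1 := hbd y i
    have h2 := hbd y' i
    have h3 : (0 : ℝ) ≤ ((min (hd (c i) y) A ^ ℓ : ℕ) : ℝ) := Nat.cast_nonneg _
    have h4 : (0 : ℝ) ≤ ((min (hd (c i) y') A ^ ℓ : ℕ) : ℝ) := Nat.cast_nonneg _
    constructor <;> linarith
  have hsumX : ∀ (W : ℕ) (v : Fin W → Fin m), ∑ j, X (v j) =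
      ((truncSum ℓ A c v y : ℝ) - truncSum ℓ A c v y') / (A : ℝ) ^ ℓ := by
    intro W v
    rw [hX, ← Finset.sum_div, Finset.sum_sub_distrib]
    simp [truncSum]
  have hmean : accuracy ℓ * m ≤ ∑ i, X i := by
    have := hsumX m id
    simp only [id] at this
    rw [this, le_div_iff₀ hAp]
    have h' : (truncSum ℓ A c id y' : ℝ) + accuracy ℓ * m * (A : ℝ) ^ ℓ < truncSum ℓ A c id y := h
    change accuracy ℓ * m * (A : ℝ) ^ ℓ ≤ (truncSum ℓ A c id y : ℝ) - truncSum ℓ A c id y'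
    linarith
  refine le_trans (Nat.cast_le.mpr (Finset.card_le_card ?_))
    (card_sum_nonpos_le V X hXabs (accuracy ℓ) (accuracy_pos ℓ) (accuracy_le_one ℓ) hmean)
  intro v hv
  simp only [Finset.mem_filter, Finset.mem_univ, true_and] at hv ⊢
  rw [hsumX]
  refine div_nonpos_of_nonpos_of_nonneg ?_ hAp.le
  have : (truncSum ℓ A c v y : ℝ) ≤ truncSum ℓ A c v y' := by exact_mod_cast hv
  linarith

end Selection

/-! ### Failure probability of sampling and tournament together -/

section Sampling

/-- Since `e ^ 2 ≥ 4`, the exponent `2 * L` already gives `4 ^ L ≥ m ^ 2`. Sample sizes can thus be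
multiples of the integer `L`, a rounded-up binary logarithm. -/
theorem exp_two_bound {m L : ℕ} (hm : 1 ≤ m) (hL : m ≤ 2 ^ L) {x : ℝ} (hx : 2 * (L : ℝ) ≤ x) :
    Real.exp (-x) ≤ 1 / (m : ℝ) ^ 2 := by
  have h4 : (4 : ℝ) ≤ Real.exp 2 := by
    have h1 : (2 : ℝ) ≤ Real.exp 1 := by
      have := Real.add_one_le_exp (1 : ℝ); linarith
    have h2 : Real.exp 2 = Real.exp 1 * Real.exp 1 := by rw [← Real.exp_add]; norm_num
    rw [h2]; nlinarith
  have hmL : (m : ℝ) ≤ 2 ^ L := by exact_mod_cast hL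
  have hm0 : (0 : ℝ) < m := by exact_mod_cast hm
  have h5 : (m : ℝ) ^ 2 ≤ Real.exp x := by
    calc (m : ℝ) ^ 2 ≤ (2 ^ L) ^ 2 := by gcongr
      _ = 4 ^ L := by rw [← pow_mul, mul_comm, pow_mul]; norm_num
      _ ≤ Real.exp 2 ^ L := by gcongr
      _ = Real.exp (2 * L) := by rw [← Real.exp_nat_mul]; ring_nf
      _ ≤ Real.exp x := Real.exp_le_exp.mpr hx
  rw [Real.exp_neg, ← one_div]
  exact one_div_le_one_div_of_le (by positivity) h5

open Classical in
/-- With probability at least `1 - 1/m`, every candidate that wins the largest number of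
comparisons is a good approximation of `F`. -/
theorem exists_sampling_constants (ℓ : ℕ) (hℓ : 1 ≤ ℓ) :
    ∃ k a b : ℕ, 1 ≤ a ∧ ∀ {β : Type} [DecidableEq β] (m : ℕ) (_ : 2 ≤ m) (L : ℕ) (_ : m ≤ 2 ^ L)
      (c : Fin m → Finset β) (F : Finset β) (Y : (Fin (k + 1) → Fin m) → Finset β)
      (_ : ∀ T j, ∃ i, hd (c (T j)) (Y T) ≤ hd (c (T i)) F),
      (1 - 1 / (m : ℝ)) * (((m : ℝ) ^ (k + 1)) ^ (a * L) * (m : ℝ) ^ (b * L)) ≤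
        ((Finset.univ.filter fun ω : (Fin (a * L) → Fin (k + 1) → Fin m) × (Fin (b * L) → Fin m) =>
          ∀ g, (∀ h, (Finset.univ.filter fun i =>
              Beats ℓ truncFactor c ω.2 (Y (ω.1 h)) (Y (ω.1 i))).card ≤
            (Finset.univ.filter fun i =>
              Beats ℓ truncFactor c ω.2 (Y (ω.1 g)) (Y (ω.1 i))).card) →
          ∑ i, (hd (c i) (Y (ω.1 g)) : ℝ) ^ ℓ ≤
            2.995 ^ ℓ * ∑ i, (hd (c i) F : ℝ) ^ ℓ).card : ℝ) := by
  obtain ⟨k, p, hp0, hp1, hgood⟩ := exists_good_tuples ℓ hℓ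
  -- All `a * L` groups fail with probability at most `exp (-p * a * L)`, and `a * p ≥ 2` makes this
  -- at most `1 / m ^ 2`.
  obtain ⟨a, ha⟩ := exists_nat_ge (2 / p)
  have hacc := accuracy_pos ℓ
  -- The union bound over pairs of groups costs `G ^ 2 ≤ exp (2 * a * L)`; the summand 2 in the
  -- numerator leaves `exp (-2 * L)`.
  obtain ⟨b, hb⟩ := exists_nat_ge ((2 * a + 2) / (accuracy ℓ ^ 2 / 4))
  have ha1 : 2 ≤ (a : ℝ) * p := by rwa [div_le_iff₀ hp0] at ha
  have hb1 : 2 * (a : ℝ) + 2 ≤ b * (accuracy ℓ ^ 2 / 4) := by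
    rwa [div_le_iff₀ (by positivity)] at hb
  have hapos : 1 ≤ a := by
    rcases Nat.eq_zero_or_pos a with h | h
    · rw [h] at ha1; norm_num at ha1
    · exact h
  refine ⟨k, a, b, hapos, ?_⟩
  intro β _ m hm L hL c F Y hY
  have hm0 : (0 : ℝ) < m := by positivity
  set G := a * L with hG
  set V := b * L with hV
  set N : ℝ := (m : ℝ) ^ (k + 1) with hN
  have hN0 : 0 < N := by positivity
  set Good : (Fin (k + 1) → Fin m) → Prop := fun T =>
    ∑ i, (hd (c i) (Y T) : ℝ) ^ ℓ ≤ 2.993 ^ ℓ * ∑ i, (hd (c i) F : ℝ) ^ ℓ with hGood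
  have hg := hgood m (by omega) c F Y hY
  -- the exceptional sets
  set A : Finset ((Fin G → Fin (k + 1) → Fin m) × (Fin V → Fin m)) :=
    (Fintype.piFinset fun _ => Finset.univ.filter fun T => ¬ Good T) ×ˢ Finset.univ with hA
  set Wrong : Finset β → Finset β → Prop := fun y y' =>
    (truncSum ℓ (truncFactor * hd y y') c id y' : ℝ) +
        accuracy ℓ * m * ((truncFactor * hd y y' : ℕ) : ℝ) ^ ℓ <
      truncSum ℓ (truncFactor * hd y y') c id y with hWrong
  set P : Fin G → Fin G → Finset ((Fin G → Fin (k + 1) → Fin m) × (Fin V → Fin m)) :=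
    fun g h => Finset.univ.filter fun ω => Wrong (Y (ω.1 g)) (Y (ω.1 h)) ∧
      Beats ℓ truncFactor c ω.2 (Y (ω.1 g)) (Y (ω.1 h)) with hP
  have hAcard : (A.card : ℝ) ≤ N ^ G * (m : ℝ) ^ V * (1 / (m : ℝ) ^ 2) := by
    have hnot : ((Finset.univ.filter fun T => ¬ Good T).card : ℝ) ≤ (1 - p) * N := by
      have hsplit := Finset.card_filter_add_card_filter_not (s := Finset.univ) Good
      simp only [Finset.card_univ, Fintype.card_fun, Fintype.card_fin] at hsplit
      have hsplit' : ((Finset.univ.filter Good).card : ℝ) +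
          ((Finset.univ.filter fun T => ¬ Good T).card : ℝ) = N := by
        rw [hN]; exact_mod_cast hsplit
      have hg' : p * N ≤ ((Finset.univ.filter Good).card : ℝ) := by
        convert hg using 3
      linarith
    have h1 : (1 - p) ^ G ≤ 1 / (m : ℝ) ^ 2 := by
      calc (1 - p) ^ G ≤ Real.exp (-p) ^ G := by
            refine pow_le_pow_left₀ (by linarith) ?_ G
            have := Real.add_one_le_exp (-p); linarith
        _ = Real.exp (-(p * G)) := by rw [← Real.exp_nat_mul]; ring_nf
        _ ≤ _ := exp_two_bound (by omega) hL (by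
            rw [hG]; push_cast
            calc 2 * (L : ℝ) ≤ (a * p) * L := by gcongr
              _ = p * (a * L) := by ring)
    have h2 : (A.card : ℝ) =
        ((Finset.univ.filter fun T => ¬ Good T).card : ℝ) ^ G * (m : ℝ) ^ V := by
      rw [hA, Finset.card_product, Fintype.card_piFinset]
      simp
    rw [h2]
    calc ((Finset.univ.filter fun T => ¬ Good T).card : ℝ) ^ G * (m : ℝ) ^ V
        ≤ ((1 - p) * N) ^ G * (m : ℝ) ^ V := by gcongr
      _ = (1 - p) ^ G * (N ^ G * (m : ℝ) ^ V) := by rw [mul_pow]; ring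
      _ ≤ (1 / (m : ℝ) ^ 2) * (N ^ G * (m : ℝ) ^ V) := by gcongr
      _ = _ := mul_comm _ _
  have hPcard : ∀ g h, ((P g h).card : ℝ) ≤
      N ^ G * ((m : ℝ) ^ V * Real.exp (-(accuracy ℓ ^ 2 / 4 * V))) := by
    intro g h
    -- With the groups fixed first, the two candidates are constants and only the validators remain
    -- random.
    have hsum : ((P g h).card : ℝ) = ∑ T : Fin G → Fin (k + 1) → Fin m,
        ((Finset.univ.filter fun v : Fin V → Fin m => Wrong (Y (T g)) (Y (T h)) ∧
          Beats ℓ truncFactor c v (Y (T g)) (Y (T h))).card : ℝ) := by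
      rw [hP, Finset.card_filter, Fintype.sum_prod_type]
      push_cast
      refine Finset.sum_congr rfl fun T _ => ?_
      rw [Finset.card_filter]
      push_cast
      rfl
    rw [hsum]
    calc _ ≤ ∑ T : Fin G → Fin (k + 1) → Fin m,
          ((m : ℝ) ^ V * Real.exp (-(accuracy ℓ ^ 2 / 4 * V))) := by
          refine Finset.sum_le_sum fun T _ => ?_
          by_cases hw : Wrong (Y (T g)) (Y (T h))
          · simp only [hw, true_and]
            exact card_beats_wrongly_le ℓ V c _ _ hw
          · simp only [hw, false_and, Finset.filter_false, Finset.card_empty, Nat.cast_zero]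
            positivity
      _ = _ := by simp [hN]
  set Bd : Finset ((Fin G → Fin (k + 1) → Fin m) × (Fin V → Fin m)) :=
    A ∪ Finset.univ.biUnion fun g => Finset.univ.biUnion fun h => P g h with hBd
  have hexp : (G : ℝ) * (G * Real.exp (-(accuracy ℓ ^ 2 / 4 * V))) ≤ 1 / (m : ℝ) ^ 2 := by
    have h1 : (G : ℝ) ≤ Real.exp G := by have := Real.add_one_le_exp (G : ℝ); linarith
    calc (G : ℝ) * (G * Real.exp (-(accuracy ℓ ^ 2 / 4 * V)))
        ≤ Real.exp G * (Real.exp G * Real.exp (-(accuracy ℓ ^ 2 / 4 * V))) := by gcongr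
      _ = Real.exp (-(accuracy ℓ ^ 2 / 4 * V - 2 * G)) := by
          rw [← Real.exp_add, ← Real.exp_add]; ring_nf
      _ ≤ _ := exp_two_bound (by omega) hL (by
          rw [hV, hG]; push_cast
          have : (2 * (a : ℝ) + 2) * L ≤ b * (accuracy ℓ ^ 2 / 4) * L := by gcongr
          linarith)
  have hBdcard : (Bd.card : ℝ) ≤ 1 / (m : ℝ) * (N ^ G * (m : ℝ) ^ V) := by
    have h1 : (Bd.card : ℝ) ≤ A.card + ∑ g, ∑ h, ((P g h).card : ℝ) := by
      have : Bd.card ≤ A.card + ∑ g, ∑ h, (P g h).card :=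
        (Finset.card_union_le _ _).trans (Nat.add_le_add_left
          (Finset.card_biUnion_le.trans (Finset.sum_le_sum fun g _ => Finset.card_biUnion_le)) _)
      exact_mod_cast this
    have h2 : ∑ g, ∑ h, ((P g h).card : ℝ) ≤ N ^ G * (m : ℝ) ^ V * (1 / (m : ℝ) ^ 2) := by
      calc ∑ g, ∑ h, ((P g h).card : ℝ) ≤ ∑ _g : Fin G, ∑ _h : Fin G,
            N ^ G * ((m : ℝ) ^ V * Real.exp (-(accuracy ℓ ^ 2 / 4 * V))) :=
            Finset.sum_le_sum fun g _ => Finset.sum_le_sum fun h _ => hPcard g h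
        _ = N ^ G * (m : ℝ) ^ V * ((G : ℝ) * (G * Real.exp (-(accuracy ℓ ^ 2 / 4 * V)))) := by
            simp; ring
        _ ≤ _ := by gcongr
    -- The two kinds of failure have probability at most `1 / m ^ 2` each, and `m ≥ 2`.
    have h3 : 2 * (1 / (m : ℝ) ^ 2) ≤ 1 / m := by
      have : (2 : ℝ) ≤ m := by exact_mod_cast hm
      rw [mul_one_div, div_le_div_iff₀ (by positivity) hm0]
      nlinarith
    calc (Bd.card : ℝ) ≤ (2 * (1 / (m : ℝ) ^ 2)) * (N ^ G * (m : ℝ) ^ V) := by linarith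
      _ ≤ _ := by gcongr
  have hcompl : ((Bdᶜ).card : ℝ) = N ^ G * (m : ℝ) ^ V - Bd.card := by
    rw [Finset.card_compl, Nat.cast_sub (Finset.card_le_univ _)]
    simp [hN]
  refine le_trans (b := ((Bdᶜ).card : ℝ)) (by rw [hcompl]; linarith) ?_
  refine Nat.cast_le.mpr (Finset.card_le_card fun ω hω => ?_)
  simp only [hBd, Finset.mem_compl, Finset.mem_union, Finset.mem_biUnion, Finset.mem_univ,
    true_and, not_or, not_exists, hP, Finset.mem_filter, not_and] at hω
  simp only [Finset.mem_filter, Finset.mem_univ, true_and]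
  intro g hmax
  obtain ⟨hω1, hω2⟩ := hω
  obtain ⟨g₀, hg₀⟩ : ∃ g₀, Good (ω.1 g₀) := by
    by_contra! hcon
    exact hω1 (by simpa [hA] using hcon)
  have hstep : ∀ g h, Beats ℓ truncFactor c ω.2 (Y (ω.1 g)) (Y (ω.1 h)) →
      ∑ i, (hd (c i) (Y (ω.1 g)) : ℝ) ^ ℓ ≤
        1.0003 ^ ℓ * ∑ i, (hd (c i) (Y (ω.1 h)) : ℝ) ^ ℓ := by
    intro g h hb
    refine sum_pow_le_of_truncSum_le ℓ hℓ c _ _ (not_lt.mp fun hw => hω2 g h hw hb)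
  obtain ⟨z, hz1, hz2⟩ := exists_two_step_of_max_wins
    (fun g h => Beats ℓ truncFactor c ω.2 (Y (ω.1 g)) (Y (ω.1 h)))
    (fun g h => beats_total ℓ truncFactor c ω.2 _ _) g hmax g₀
  have hF0 : 0 ≤ ∑ i, (hd (c i) F : ℝ) ^ ℓ := Finset.sum_nonneg fun i _ => by positivity
  calc ∑ i, (hd (c i) (Y (ω.1 g)) : ℝ) ^ ℓ
      ≤ 1.0003 ^ ℓ * ∑ i, (hd (c i) (Y (ω.1 z)) : ℝ) ^ ℓ := hstep g z hz1
    _ ≤ 1.0003 ^ ℓ * (1.0003 ^ ℓ * ∑ i, (hd (c i) (Y (ω.1 g₀)) : ℝ) ^ ℓ) := by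
        gcongr; exact hstep z g₀ hz2
    _ ≤ 1.0003 ^ ℓ * (1.0003 ^ ℓ * (2.993 ^ ℓ * ∑ i, (hd (c i) F : ℝ) ^ ℓ)) := by
        gcongr
    _ = (1.0003 * (1.0003 * 2.993)) ^ ℓ * ∑ i, (hd (c i) F : ℝ) ^ ℓ := by
        rw [mul_pow, mul_pow]; ring
    _ ≤ 2.995 ^ ℓ * ∑ i, (hd (c i) F : ℝ) ^ ℓ := by
        gcongr
        norm_num

end Sampling

/-! ### A total-correctness calculus for the word RAM -/

section Logic

variable {n : ℕ}

/-- The value of an expression when all limits are ignored. -/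
def Expr.val (E : Env n) (s : State) : Expr → ℕ
  | .const k => k
  | .reg r => s.reg r
  | .mem a => s.mem (a.val E s)
  | .numVertices => n
  | .numClusterings => E.m
  | .color a => if h : a.val E s < n then E.color ⟨a.val E s, h⟩ else 0
  | .item i => s.item i
  | .answer a => s.ans (a.val E s)
  | .bin o a b => o.apply (a.val E s) (b.val E s)

/-- The evaluation of an expression stays within the limits. -/
def Expr.Ok (E : Env n) (s : State) : Expr → Prop
  | .const k => k < E.wordLimit
  | .reg r => s.reg r < E.wordLimit
  | .mem a => a.Ok E s ∧ a.val E s < E.memLimit ∧ s.mem (a.val E s) < E.wordLimit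
  | .numVertices => n < E.wordLimit
  | .numClusterings => E.m < E.wordLimit
  | .color a => a.Ok E s ∧ a.val E s < n ∧ (Expr.color a).val E s < E.wordLimit
  | .item i => s.item i < E.wordLimit
  | .answer a => a.Ok E s ∧ a.val E s < n ∧ s.ans (a.val E s) < E.wordLimit
  | .bin o a b => a.Ok E s ∧ b.Ok E s ∧ o.apply (a.val E s) (b.val E s) < E.wordLimit

/-- Separates values from limit checks: from here on the partial evaluation is replaced by the total
function `val`, and the limits become side conditions. -/
theorem Expr.eval_eq {E : Env n} {s : State} {e : Expr} (h : e.Ok E s) :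
    e.eval E s = some (e.val E s) := by
  induction e with
  | const k => simp_all [Expr.eval, Expr.Ok, Expr.val, Env.word]
  | reg r => simp_all [Expr.eval, Expr.Ok, Expr.val, Env.word]
  | mem a ih => simp_all [Expr.eval, Expr.Ok, Expr.val, Env.word]
  | numVertices => simp_all [Expr.eval, Expr.Ok, Expr.val, Env.word]
  | numClusterings => simp_all [Expr.eval, Expr.Ok, Expr.val, Env.word]
  | color a ih =>
    obtain ⟨h1, h2, h3⟩ := h
    simp only [Expr.val, dif_pos h2] at h3 ⊢
    simp [Expr.eval, ih h1, h2, Env.word, h3]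
  | item i => simp_all [Expr.eval, Expr.Ok, Expr.val, Env.word]
  | answer a ih => simp_all [Expr.eval, Expr.Ok, Expr.val, Env.word]
  | bin o a b iha ihb => simp_all [Expr.eval, Expr.Ok, Expr.val, Env.word]

theorem val_lt_ne_zero {E : Env n} {s : State} {a b : Expr} :
    (Expr.bin .lt a b).val E s ≠ 0 ↔ a.val E s < b.val E s := by
  simp only [Expr.val, Op.apply]; split_ifs <;> simp_all

theorem val_lt_eq_zero {E : Env n} {s : State} {a b : Expr} :
    (Expr.bin .lt a b).val E s = 0 ↔ b.val E s ≤ a.val E s := by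
  simp only [Expr.val, Op.apply]; split_ifs <;> simp_all

theorem val_eq_ne_zero {E : Env n} {s : State} {a b : Expr} :
    (Expr.bin .eq a b).val E s ≠ 0 ↔ a.val E s = b.val E s := by
  simp only [Expr.val, Op.apply]; split_ifs <;> simp_all

theorem val_eq_eq_zero {E : Env n} {s : State} {a b : Expr} :
    (Expr.bin .eq a b).val E s = 0 ↔ a.val E s ≠ b.val E s := by
  simp only [Expr.val, Op.apply]; split_ifs <;> simp_all

/-- The state with register `r` set to `x`. -/
def State.setReg (s : State) (r x : ℕ) : State := { s with reg := Function.update s.reg r x }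

/-- The state with memory cell `i` set to `x`. -/
def State.setMem (s : State) (i x : ℕ) : State := { s with mem := Function.update s.mem i x }

/-- The state with cell `i` of the query set to `x`. -/
def State.setQry (s : State) (i x : ℕ) : State := { s with qry := Function.update s.qry i x }

@[simp] theorem State.setReg_reg (s : State) (r x r' : ℕ) :
    (s.setReg r x).reg r' = if r' = r then x else s.reg r' := by
  simp [State.setReg, Function.update_apply]

@[simp] theorem State.setReg_mem (s : State) (r x : ℕ) : (s.setReg r x).mem = s.mem := rfl
@[simp] theorem State.setReg_item (s : State) (r x : ℕ) : (s.setReg r x).item = s.item := rfl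
@[simp] theorem State.setReg_coins (s : State) (r x : ℕ) : (s.setReg r x).coins = s.coins := rfl
@[simp] theorem State.setReg_qry (s : State) (r x : ℕ) : (s.setReg r x).qry = s.qry := rfl

@[simp] theorem State.setMem_mem (s : State) (i x i' : ℕ) :
    (s.setMem i x).mem i' = if i' = i then x else s.mem i' := by
  simp [State.setMem, Function.update_apply]

@[simp] theorem State.setMem_reg (s : State) (i x : ℕ) : (s.setMem i x).reg = s.reg := rfl

@[simp] theorem State.setQry_qry (s : State) (i x i' : ℕ) :
    (s.setQry i x).qry i' = if i' = i then x else s.qry i' := by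
  simp [State.setQry, Function.update_apply]

@[simp] theorem State.setQry_reg (s : State) (i x : ℕ) : (s.setQry i x).reg = s.reg := rfl

/-- Started in `s`, the program `c` halts within the limits in a state satisfying `Q`. -/
def Ends (E : Env n) (c : Cmd) (s : State) (Q : State → Prop) : Prop :=
  ∃ s' t, Exec E c s s' t ∧ Q s'

variable {E : Env n} {s : State} {Q R : State → Prop}

theorem Ends.mono {c : Cmd} (h : Ends E c s R) (hRQ : ∀ s', R s' → Q s') : Ends E c s Q := by
  obtain ⟨s', t, hx, hR⟩ := h
  exact ⟨s', t, hx, hRQ s' hR⟩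

theorem Ends.skip (h : Q s) : Ends E .skip s Q := ⟨s, 1, .skip s, h⟩

theorem Ends.assign {r : ℕ} {e : Expr} (he : e.Ok E s) (h : Q (s.setReg r (e.val E s))) :
    Ends E (.assign r e) s Q :=
  ⟨_, _, .assign s r e _ (Expr.eval_eq he), h⟩

theorem Ends.store {a e : Expr} (ha : a.Ok E s) (hlim : a.val E s < E.memLimit) (he : e.Ok E s)
    (h : Q (s.setMem (a.val E s) (e.val E s))) : Ends E (.store a e) s Q :=
  ⟨_, _, .store s a e _ _ (Expr.eval_eq ha) hlim (Expr.eval_eq he), h⟩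

theorem Ends.ask {a e : Expr} (ha : a.Ok E s) (he : e.Ok E s)
    (h : Q (s.setQry (a.val E s) (e.val E s))) : Ends E (.ask a e) s Q :=
  ⟨_, _, .ask s a e _ _ (Expr.eval_eq ha) (Expr.eval_eq he), h⟩

theorem Ends.sample {r x : ℕ} {l : List ℕ} (hc : s.coins = x :: l)
    (h : Q { s.setReg r x with coins := l }) : Ends E (.sample r) s Q :=
  ⟨_, _, .sample s r x l hc, h⟩

theorem Ends.callClosest
    (h : Q { s with ans := labelsToCells (E.closest fun u => s.qry u), qry := fun _ => 0 }) :
    Ends E .callClosest s Q :=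
  ⟨_, _, .callClosest s, h⟩

theorem Ends.seq {c d : Cmd} (h : Ends E c s fun s' => Ends E d s' Q) : Ends E (.seq c d) s Q := by
  obtain ⟨s', t, hx, s'', t', hx', hQ⟩ := h
  exact ⟨s'', _, .seq c d s s' s'' t t' hx hx', hQ⟩

theorem Ends.ite {e : Expr} {c d : Cmd} (he : e.Ok E s) (h1 : e.val E s ≠ 0 → Ends E c s Q)
    (h2 : e.val E s = 0 → Ends E d s Q) : Ends E (.ite e c d) s Q := by
  by_cases h0 : e.val E s = 0
  · obtain ⟨s', t, hx, hQ⟩ := h2 h0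
    exact ⟨s', _, .iteFalse e c d s s' t (by rw [Expr.eval_eq he, h0]) hx, hQ⟩
  · obtain ⟨s', t, hx, hQ⟩ := h1 h0
    exact ⟨s', _, .iteTrue e c d s s' _ t (Expr.eval_eq he) h0 hx, hQ⟩

/-- A loop that performs exactly `N` iterations. -/
theorem Ends.loop {e : Expr} {c : Cmd} (N : ℕ) (I : ℕ → State → Prop)
    (hstep : ∀ i < N, ∀ s, I i s → e.Ok E s ∧ e.val E s ≠ 0 ∧ Ends E c s (I (i + 1)))
    (hdone : ∀ s, I N s → e.Ok E s ∧ e.val E s = 0) (h0 : I 0 s) :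
    Ends E (.loop e c) s (I N) := by
  have key : ∀ k i s, i + k = N → I i s → Ends E (.loop e c) s (I N) := by
    intro k
    induction k with
    | zero =>
      intro i s hi hs
      obtain rfl : i = N := by omega
      obtain ⟨h1, h2⟩ := hdone s hs
      exact ⟨s, _, .loopDone e c s (by rw [Expr.eval_eq h1, h2]), hs⟩
    | succ k ih =>
      intro i s hi hs
      obtain ⟨h1, h2, s', t, hx, hs'⟩ := hstep i (by omega) s hs
      obtain ⟨s'', t', hx', hs''⟩ := ih (i + 1) s' (by omega) hs'
      exact ⟨s'', _, .loopStep e c s s' s'' _ t t' (Expr.eval_eq h1) h2 hx hx', hs''⟩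
  exact key N 0 s (by omega) h0

/-- `for r < e do c`. -/
def Cmd.forLoop (r : ℕ) (e : Expr) (c : Cmd) : Cmd :=
  .seq (.assign r (.const 0))
    (.loop (.bin .lt (.reg r) e) (.seq c (.assign r (.bin .add (.reg r) (.const 1)))))

/-- The bound `e` is evaluated again in every round, so the invariant has to preserve its value as
well as the counter. -/
theorem Ends.forLoop {r : ℕ} {e : Expr} {c : Cmd} (N : ℕ) (I : ℕ → State → Prop)
    (hN : N + 1 < E.wordLimit) (h0 : I 0 (s.setReg r 0))
    (hI : ∀ i ≤ N, ∀ s, I i s → s.reg r = i ∧ e.Ok E s ∧ e.val E s = N)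
    (hstep : ∀ i < N, ∀ s, I i s →
      Ends E c s fun s' => s'.reg r = i ∧ I (i + 1) (s'.setReg r (i + 1))) :
    Ends E (.forLoop r e c) s (I N) := by
  have hcond : ∀ i ≤ N, ∀ s, I i s → (Expr.bin .lt (.reg r) e).Ok E s ∧
      (Expr.bin .lt (.reg r) e).val E s = if i < N then 1 else 0 := by
    intro i hi s hs
    obtain ⟨h1, h2, h3⟩ := hI i hi s hs
    refine ⟨⟨?_, h2, ?_⟩, ?_⟩
    · simp only [Expr.Ok, h1]; omega
    · simp only [Expr.val, Op.apply, h1, h3]; split_ifs <;> omega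
    · simp only [Expr.val, Op.apply, h1, h3]
  refine Ends.seq (Ends.assign (by simp only [Expr.Ok]; omega) ?_)
  refine Ends.loop N I ?_ ?_ h0
  · intro i hi s hs
    obtain ⟨h1, h2⟩ := hcond i hi.le s hs
    refine ⟨h1, by rw [h2, if_pos hi]; omega, Ends.seq ((hstep i hi s hs).mono ?_)⟩
    rintro s' ⟨h3, h4⟩
    refine Ends.assign ?_ ?_
    · simp only [Expr.Ok, Expr.val, Op.apply, h3]; omega
    · simpa only [Expr.val, Op.apply, h3] using h4
  · intro s hs
    obtain ⟨h1, h2⟩ := hcond N le_rfl s hs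
    exact ⟨h1, by rw [h2, if_neg (lt_irrefl N)]⟩

end Logic

/-! ### Matrices in memory and the basic routines -/

section Routines

variable {n : ℕ}

/-- The memory is used as a matrix whose rows have length `n + 1`. -/
def State.cell (n : ℕ) (s : State) (r c : ℕ) : ℕ := s.mem (r * (n + 1) + c)

/-- The address of a matrix entry; register `2` holds the row length. -/
def addrOf (row col : Expr) : Expr := .bin .add (.bin .mul row (.reg 2)) col

/-- A matrix entry. -/
def cellAt (row col : Expr) : Expr := .mem (addrOf row col)

/-- The limits of `E` allow for `W` rows and for words up to `P`. -/
structure Fits (E : Env n) (W P : ℕ) : Prop where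
  mem : W * (n + 1) ≤ E.memLimit
  addr : W * (n + 1) ≤ P
  sq : n * n ≤ P
  one : n + 1 ≤ P
  word : P + 1 < E.wordLimit

/-- All matrix entries are bounded by `P`. -/
def State.Bounded (n W P : ℕ) (s : State) : Prop := ∀ i < W * (n + 1), s.mem i ≤ P

/-- The states agree on the memory and on the registers below `b`. -/
def Agree (b : ℕ) (s s' : State) : Prop := (∀ r < b, s'.reg r = s.reg r) ∧ s'.mem = s.mem

theorem Agree.refl (b : ℕ) (s : State) : Agree b s s := ⟨fun _ _ => rfl, rfl⟩

theorem Agree.trans {b : ℕ} {s s' s'' : State} (h : Agree b s s') (h' : Agree b s' s'') :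
    Agree b s s'' :=
  ⟨fun r hr => (h'.1 r hr).trans (h.1 r hr), h'.2.trans h.2⟩

theorem Agree.mono {b b' : ℕ} {s s' : State} (h : Agree b s s') (hb : b' ≤ b) : Agree b' s s' :=
  ⟨fun r hr => h.1 r (by omega), h.2⟩

theorem Agree.setReg {b : ℕ} {s s' : State} (h : Agree b s s') {r x : ℕ} (hr : b ≤ r) :
    Agree b s (s'.setReg r x) :=
  ⟨fun r' hr' => by rw [State.setReg_reg, if_neg (by omega)]; exact h.1 r' hr', h.2⟩

theorem Agree.cell {b : ℕ} {s s' : State} (h : Agree b s s') (r c : ℕ) :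
    s'.cell n r c = s.cell n r c := by
  rw [State.cell, h.2]; rfl

theorem Agree.bounded {b W P : ℕ} {s s' : State} (h : Agree b s s') (hs : s.Bounded n W P) :
    s'.Bounded n W P := by
  intro i hi
  rw [h.2]; exact hs i hi

theorem addr_lt {W r c : ℕ} (hr : r < W) (hc : c ≤ n) : r * (n + 1) + c < W * (n + 1) := by
  calc r * (n + 1) + c < r * (n + 1) + (n + 1) := by omega
    _ = (r + 1) * (n + 1) := by ring
    _ ≤ W * (n + 1) := Nat.mul_le_mul_right _ hr

theorem addr_inj {r c r' c' : ℕ} (hc : c ≤ n) (hc' : c' ≤ n)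
    (h : r' * (n + 1) + c' = r * (n + 1) + c) : r' = r ∧ c' = c := by
  have h1 : (r' * (n + 1) + c') / (n + 1) = r' := by
    rw [mul_comm, Nat.mul_add_div (by omega), Nat.div_eq_of_lt (by omega)]; rfl
  have h2 : (r * (n + 1) + c) / (n + 1) = r := by
    rw [mul_comm, Nat.mul_add_div (by omega), Nat.div_eq_of_lt (by omega)]; rfl
  have h3 : r' = r := by rw [← h1, h, h2]
  subst h3
  exact ⟨rfl, by omega⟩

@[simp] theorem State.setReg_cell (s : State) (r x i j : ℕ) :
    (s.setReg r x).cell n i j = s.cell n i j := rfl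

theorem State.setMem_cell (s : State) {r c r' c' x : ℕ} (hc : c ≤ n) (hc' : c' ≤ n) :
    (s.setMem (r * (n + 1) + c) x).cell n r' c' =
      if r' = r ∧ c' = c then x else s.cell n r' c' := by
  unfold State.cell
  rw [State.setMem_mem]
  by_cases h : r' = r ∧ c' = c
  · rw [if_pos h, if_pos (by rw [h.1, h.2])]
  · rw [if_neg h, if_neg fun h' => h (addr_inj hc hc' h')]

theorem State.Bounded.setMem {W P : ℕ} {s : State} (h : s.Bounded n W P) {i x : ℕ} (hx : x ≤ P) :
    (s.setMem i x).Bounded n W P := by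
  intro j hj
  rw [State.setMem_mem]
  split_ifs
  · exact hx
  · exact h j hj

theorem State.Bounded.cell {W P : ℕ} {s : State} (h : s.Bounded n W P) {r c : ℕ} (hr : r < W)
    (hc : c ≤ n) : s.cell n r c ≤ P :=
  h _ (addr_lt hr hc)

variable {E : Env n} {W P : ℕ} {s : State} {Q : State → Prop}

theorem addrOf_ok (hE : Fits E W P) (h2 : s.reg 2 = n + 1) {row col : Expr}
    (hrow : row.Ok E s) (hcol : col.Ok E s) (hr : row.val E s < W) (hc : col.val E s ≤ n) :
    (addrOf row col).Ok E s ∧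
      (addrOf row col).val E s = row.val E s * (n + 1) + col.val E s := by
  have h1 := addr_lt hr hc
  have := hE.addr
  have := hE.word
  have := hE.one
  refine ⟨⟨⟨hrow, ?_, ?_⟩, hcol, ?_⟩, ?_⟩
  · simp only [Expr.Ok, h2]; omega
  · simp only [Expr.val, Op.apply, h2]; omega
  · simp only [Expr.val, Op.apply, h2]; omega
  · simp only [addrOf, Expr.val, Op.apply, h2]

theorem cellAt_ok (hE : Fits E W P) (h2 : s.reg 2 = n + 1) (hs : s.Bounded n W P)
    {row col : Expr} (hrow : row.Ok E s) (hcol : col.Ok E s) (hr : row.val E s < W)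
    (hc : col.val E s ≤ n) : (cellAt row col).Ok E s := by
  obtain ⟨h1, h3⟩ := addrOf_ok hE h2 hrow hcol hr hc
  have h4 := addr_lt hr hc
  have := hE.mem
  have := hE.word
  have := hs.cell hr hc
  refine ⟨h1, by omega, ?_⟩
  rw [h3]
  unfold State.cell at this
  omega

theorem cellAt_val (h2 : s.reg 2 = n + 1) {row col : Expr} :
    (cellAt row col).val E s = s.cell n (row.val E s) (col.val E s) := by
  simp only [cellAt, addrOf, Expr.val, Op.apply, h2, State.cell]

theorem Ends.storeCell (hE : Fits E W P) (h2 : s.reg 2 = n + 1) {row col e : Expr}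
    (hrow : row.Ok E s) (hcol : col.Ok E s) (hr : row.val E s < W) (hc : col.val E s ≤ n)
    (he : e.Ok E s) (h : Q (s.setMem (row.val E s * (n + 1) + col.val E s) (e.val E s))) :
    Ends E (.store (addrOf row col) e) s Q := by
  obtain ⟨h1, h3⟩ := addrOf_ok hE h2 hrow hcol hr hc
  have h4 := addr_lt hr hc
  have := hE.mem
  exact Ends.store h1 (by omega) he (by rw [h3]; exact h)

theorem Fits.reg_ok (hE : Fits E W P) {r : ℕ} (h : s.reg r ≤ P) : (Expr.reg r).Ok E s := by
  have := hE.word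
  simp only [Expr.Ok]; omega

theorem Fits.const_ok (hE : Fits E W P) {k : ℕ} (h : k ≤ P) : (Expr.const k).Ok E s := by
  have := hE.word
  simp only [Expr.Ok]; omega

theorem Fits.bin_ok (hE : Fits E W P) {o : Op} {a b : Expr} (ha : a.Ok E s) (hb : b.Ok E s)
    (h : o.apply (a.val E s) (b.val E s) ≤ P) : (Expr.bin o a b).Ok E s :=
  ⟨ha, hb, by have := hE.word; omega⟩

theorem Fits.lt_ok (hE : Fits E W P) {a b : Expr} (ha : a.Ok E s) (hb : b.Ok E s) :
    (Expr.bin .lt a b).Ok E s :=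
  hE.bin_ok ha hb (by have := hE.one; simp only [Op.apply]; split_ifs <;> omega)

theorem Fits.eq_ok (hE : Fits E W P) {a b : Expr} (ha : a.Ok E s) (hb : b.Ok E s) :
    (Expr.bin .eq a b).Ok E s :=
  hE.bin_ok ha hb (by have := hE.one; simp only [Op.apply]; split_ifs <;> omega)

theorem Fits.numVertices_ok (hE : Fits E W P) : Expr.numVertices.Ok E s := by
  have := hE.word
  have := hE.one
  simp only [Expr.Ok]; omega

/-! ### Distances of label arrays -/

/-- The contribution of the pair `u, v` to the distance of two label arrays. -/
def pairTerm (f g : ℕ → ℕ) (u v : ℕ) : ℕ :=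
  (if u < v then 1 else 0) *
    (1 - if (if f u = f v then 1 else 0) = (if g u = g v then 1 else 0) then 1 else 0)

theorem pairTerm_le_one (f g : ℕ → ℕ) (u v : ℕ) : pairTerm f g u v ≤ 1 := by
  unfold pairTerm
  calc _ ≤ 1 * 1 := Nat.mul_le_mul (by split_ifs <;> omega) (by omega)
    _ = 1 := rfl

/-- The distance of the clusterings described by the first `n` labels of two arrays. -/
def labelDist (n : ℕ) (f g : ℕ → ℕ) : ℕ :=
  ∑ u ∈ Finset.range n, ∑ v ∈ Finset.range n, pairTerm f g u v

theorem labelDist_congr {f f' g g' : ℕ → ℕ} (hf : ∀ u < n, f u = f' u) (hg : ∀ u < n, g u = g' u) :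
    labelDist n f g = labelDist n f' g' := by
  refine Finset.sum_congr rfl fun u hu => Finset.sum_congr rfl fun v hv => ?_
  rw [Finset.mem_range] at hu hv
  simp only [pairTerm, hf u hu, hf v hv, hg u hu, hg v hv]

/-- Needed because the accumulator must fit into a word at every intermediate step. -/
theorem partial_labelDist_le (f g : ℕ → ℕ) {i j : ℕ} (hi : i < n) (hj : j ≤ n) :
    ∑ u ∈ Finset.range i, ∑ v ∈ Finset.range n, pairTerm f g u v +
      ∑ v ∈ Finset.range j, pairTerm f g i v ≤ n * n := by
  have h1 : ∑ u ∈ Finset.range i, ∑ v ∈ Finset.range n, pairTerm f g u v ≤ i * n := by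
    calc _ ≤ ∑ _u ∈ Finset.range i, ∑ _v ∈ Finset.range n, 1 :=
          Finset.sum_le_sum fun u _ => Finset.sum_le_sum fun v _ => pairTerm_le_one f g u v
      _ = i * n := by simp
  have h2 : ∑ v ∈ Finset.range j, pairTerm f g i v ≤ j := by
    calc _ ≤ ∑ _v ∈ Finset.range j, 1 := Finset.sum_le_sum fun v _ => pairTerm_le_one f g i v
      _ = j := by simp
  calc _ ≤ i * n + n := by omega
    _ = (i + 1) * n := by ring
    _ ≤ n * n := Nat.mul_le_mul_right _ hi

theorem labelDist_le (f g : ℕ → ℕ) : labelDist n f g ≤ n * n := by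
  calc _ ≤ ∑ _u ∈ Finset.range n, ∑ _v ∈ Finset.range n, 1 :=
        Finset.sum_le_sum fun u _ => Finset.sum_le_sum fun v _ => pairTerm_le_one f g u v
    _ = n * n := by simp

/-- The distance of the rows given in registers `20` and `21` is put into register `24`. -/
def distCmd : Cmd :=
  .seq (.assign 24 (.const 0))
    (.forLoop 22 .numVertices (.forLoop 23 .numVertices
      (.assign 24 (.bin .add (.reg 24) (.bin .mul (.bin .lt (.reg 22) (.reg 23))
        (.bin .sub (.const 1) (.bin .eq
          (.bin .eq (cellAt (.reg 20) (.reg 22)) (cellAt (.reg 20) (.reg 23)))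
          (.bin .eq (cellAt (.reg 21) (.reg 22)) (cellAt (.reg 21) (.reg 23))))))))))

/-- Register discipline: a routine is specified by the least register that it may change. `distCmd`
and `copyCmd` change only registers from 22 on, so their callers keep counters in lower registers
and arguments in 20 and 21. -/
theorem distCmd_ends (hE : Fits E W P) (h2 : s.reg 2 = n + 1) (hs : s.Bounded n W P)
    {A B : ℕ} (hA : s.reg 20 = A) (hB : s.reg 21 = B) (hAW : A < W) (hBW : B < W) :
    Ends E distCmd s fun s' => Agree 22 s s' ∧
      s'.reg 24 = labelDist n (s.cell n A) (s.cell n B) := by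
  have hP := hE.one
  have hsq := hE.sq
  have haddr := hE.addr
  have hAP : A ≤ P := by
    have := addr_lt hAW (Nat.zero_le n); nlinarith
  have hBP : B ≤ P := by
    have := addr_lt hBW (Nat.zero_le n); nlinarith
  have hword := hE.word
  set f := s.cell n A with hf
  set g := s.cell n B with hg
  refine Ends.seq (Ends.assign (hE.const_ok (by omega)) ?_)
  refine (Ends.forLoop n (fun i s' => Agree 22 s s' ∧ s'.reg 22 = i ∧
    s'.reg 24 = ∑ u ∈ Finset.range i, ∑ v ∈ Finset.range n, pairTerm f g u v) (by omega)
    ⟨((Agree.refl 22 s).setReg (by norm_num)).setReg (by norm_num), by simp,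
      by simp [Expr.val]⟩ ?_ ?_).mono ?_
  · rintro i hi s' ⟨h1, h3, h4⟩
    exact ⟨h3, hE.numVertices_ok, rfl⟩
  · rintro i hi s' ⟨h1, h3, h4⟩
    refine (Ends.forLoop n (fun j s'' => Agree 22 s s'' ∧ s''.reg 22 = i ∧ s''.reg 23 = j ∧
      s''.reg 24 = ∑ u ∈ Finset.range i, ∑ v ∈ Finset.range n, pairTerm f g u v +
        ∑ v ∈ Finset.range j, pairTerm f g i v) (by omega)
      ⟨h1.setReg (by norm_num), by simpa using h3, by simp, by simpa using h4⟩ ?_ ?_).mono ?_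
    · rintro j hj s'' ⟨_, _, h5, _⟩
      exact ⟨h5, hE.numVertices_ok, rfl⟩
    · rintro j hj s'' ⟨h5, h6, h7, h8⟩
      have hr2 : s''.reg 2 = n + 1 := by rw [h5.1 2 (by norm_num), h2]
      have hr20 : s''.reg 20 = A := by rw [h5.1 20 (by norm_num), hA]
      have hr21 : s''.reg 21 = B := by rw [h5.1 21 (by norm_num), hB]
      have hb := h5.bounded hs
      have hcell : ∀ r u, (Expr.reg r).val E s'' < W → (Expr.reg u).val E s'' ≤ n →
          s''.reg r ≤ P → s''.reg u ≤ P → (cellAt (.reg r) (.reg u)).Ok E s'' := fun r u a b c d =>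
        cellAt_ok hE hr2 hb (hE.reg_ok c) (hE.reg_ok d) a b
      have hsum : s''.reg 24 + pairTerm f g i j ≤ n * n := by
        rw [h8, add_assoc, ← Finset.sum_range_succ]
        exact partial_labelDist_le f g hi hj
      have hval : (Expr.bin .mul (.bin .lt (.reg 22) (.reg 23))
          (.bin .sub (.const 1) (.bin .eq
          (.bin .eq (cellAt (.reg 20) (.reg 22)) (cellAt (.reg 20) (.reg 23)))
          (.bin .eq (cellAt (.reg 21) (.reg 22)) (cellAt (.reg 21) (.reg 23)))))).val E s'' =
          pairTerm f g i j := by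
        simp only [Expr.val, Op.apply, cellAt_val hr2, h6, h7, hr20, hr21, h5.cell, pairTerm,
          hf, hg]
      have hone : ∀ p : Prop, ∀ [Decidable p], (if p then 1 else 0) ≤ P := fun p _ => by
        split_ifs <;> omega
      refine Ends.assign ?_ ?_
      · refine hE.bin_ok (hE.reg_ok (by omega)) (hE.bin_ok (hE.bin_ok (hE.reg_ok (by omega))
          (hE.reg_ok (by omega)) (hone _)) (hE.bin_ok (hE.const_ok (by omega))
          (hE.bin_ok (hE.bin_ok ?_ ?_ (hone _)) (hE.bin_ok ?_ ?_ (hone _)) (hone _)) ?_) ?_) ?_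
        · exact hcell _ _ (by simp only [Expr.val]; omega) (by simp only [Expr.val]; omega)
            (by omega) (by omega)
        · exact hcell _ _ (by simp only [Expr.val]; omega) (by simp only [Expr.val]; omega)
            (by omega) (by omega)
        · exact hcell _ _ (by simp only [Expr.val]; omega) (by simp only [Expr.val]; omega)
            (by omega) (by omega)
        · exact hcell _ _ (by simp only [Expr.val]; omega) (by simp only [Expr.val]; omega)
            (by omega) (by omega)
        · simp only [Expr.val, Op.apply]; omega
        · have h9 := pairTerm_le_one f g i j
          rw [← hval] at h9
          exact h9.trans (by omega)
        · rw [hval]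
          simp only [Op.apply, Expr.val]; omega
      · have hnew : (Expr.bin .add (.reg 24) (Expr.bin .mul (.bin .lt (.reg 22) (.reg 23))
          (.bin .sub (.const 1) (.bin .eq
          (.bin .eq (cellAt (.reg 20) (.reg 22)) (cellAt (.reg 20) (.reg 23)))
          (.bin .eq (cellAt (.reg 21) (.reg 22)) (cellAt (.reg 21) (.reg 23))))))).val E s'' =
          s''.reg 24 + pairTerm f g i j := by rw [← hval]; rfl
        rw [hnew]
        refine ⟨by simpa using h7, (h5.setReg (by norm_num)).setReg (by norm_num),
          by simpa using h6, by simp, ?_⟩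
        simp only [State.setReg_reg]
        norm_num
        rw [h8, Finset.sum_range_succ, add_assoc]
    · rintro s'' ⟨h5, h6, h7, h8⟩
      refine ⟨h6, h5.setReg (by norm_num), by simp, ?_⟩
      rw [State.setReg_reg, if_neg (by norm_num), h8, Finset.sum_range_succ]
  · rintro s' ⟨h1, _, h4⟩
    exact ⟨h1, h4⟩

end Routines

/-! ### The exhaustive search for candidates -/

section Search

variable {n : ℕ}

/-- The states agree on the registers below `b`. -/
def RegEq (b : ℕ) (s s' : State) : Prop := ∀ r < b, s'.reg r = s.reg r

theorem RegEq.refl (b : ℕ) (s : State) : RegEq b s s := fun _ _ => rfl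

theorem RegEq.trans {b : ℕ} {s s' s'' : State} (h : RegEq b s s') (h' : RegEq b s' s'') :
    RegEq b s s'' :=
  fun r hr => (h' r hr).trans (h r hr)

theorem RegEq.mono {b b' : ℕ} {s s' : State} (h : RegEq b s s') (hb : b' ≤ b) : RegEq b' s s' :=
  fun r hr => h r (by omega)

theorem RegEq.setReg {b : ℕ} {s s' : State} (h : RegEq b s s') {r x : ℕ} (hr : b ≤ r) :
    RegEq b s (s'.setReg r x) :=
  fun r' hr' => by rw [State.setReg_reg, if_neg (by omega)]; exact h r' hr'

theorem RegEq.setMem {b : ℕ} {s s' : State} (h : RegEq b s s') {i x : ℕ} :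
    RegEq b s (s'.setMem i x) := h

/-- The row given in register `20` is copied to the row given in register `21`. -/
def copyCmd : Cmd :=
  .forLoop 22 .numVertices (.store (addrOf (.reg 21) (.reg 22)) (cellAt (.reg 20) (.reg 22)))

variable {E : Env n} {W P : ℕ} {s : State} {Q : State → Prop}

theorem copyCmd_ends (hE : Fits E W P) (h2 : s.reg 2 = n + 1) (hs : s.Bounded n W P)
    {A B : ℕ} (hA : s.reg 20 = A) (hB : s.reg 21 = B) (hAW : A < W) (hBW : B < W) (hAB : A ≠ B) :
    Ends E copyCmd s fun s' => RegEq 22 s s' ∧ s'.Bounded n W P ∧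
      ∀ r, ∀ c ≤ n, s'.cell n r c = if r = B ∧ c < n then s.cell n A c else s.cell n r c := by
  have hP := hE.one
  have haddr := hE.addr
  have hword := hE.word
  have hAP : A ≤ P := by have := addr_lt hAW (Nat.zero_le n); nlinarith
  have hBP : B ≤ P := by have := addr_lt hBW (Nat.zero_le n); nlinarith
  refine (Ends.forLoop n (fun i s' => RegEq 22 s s' ∧ s'.reg 22 = i ∧ s'.Bounded n W P ∧
    ∀ r, ∀ c ≤ n, s'.cell n r c = if r = B ∧ c < i then s.cell n A c else s.cell n r c) (by omega)
    ⟨(RegEq.refl 22 s).setReg (by norm_num), by simp, hs, fun r c _ => by simp⟩ ?_ ?_).mono ?_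
  · rintro i hi s' ⟨h1, h3, h4⟩
    exact ⟨h3, hE.numVertices_ok, rfl⟩
  · rintro i hi s' ⟨h1, h3, h4, h5⟩
    have hr2 : s'.reg 2 = n + 1 := by rw [h1 2 (by norm_num), h2]
    have hr20 : s'.reg 20 = A := by rw [h1 20 (by norm_num), hA]
    have hr21 : s'.reg 21 = B := by rw [h1 21 (by norm_num), hB]
    have hok20 : (Expr.reg 20).Ok E s' := hE.reg_ok (by omega)
    have hok21 : (Expr.reg 21).Ok E s' := hE.reg_ok (by omega)
    have hok22 : (Expr.reg 22).Ok E s' := hE.reg_ok (by omega)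
    refine Ends.storeCell hE hr2 hok21 hok22 (by simp only [Expr.val]; omega)
      (by simp only [Expr.val]; omega) (cellAt_ok hE hr2 h4 hok20 hok22
        (by simp only [Expr.val]; omega) (by simp only [Expr.val]; omega)) ?_
    rw [cellAt_val hr2]
    simp only [Expr.val, hr20, hr21, h3]
    have hcell : s'.cell n A i = s.cell n A i := by
      rw [h5 A i (by omega), if_neg (fun h => hAB h.1)]
    rw [hcell]
    refine ⟨by simpa using h3, (h1.setMem).setReg (by norm_num), by simp, ?_, ?_⟩
    · exact h4.setMem (hs.cell hAW (by omega))
    · intro r c hc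
      rw [State.setReg_cell, State.setMem_cell s' (by omega) hc, h5 r c hc]
      by_cases hrB : r = B
      · by_cases hci : c = i
        · subst hci; subst hrB; simp
        · by_cases hlt : c < i
          · simp [hrB, hci, hlt, Nat.lt_succ_of_lt hlt]
          · have : ¬ c < i + 1 := by omega
            simp [hrB, hci, hlt, this]
      · simp [hrB]
  · rintro s' ⟨h1, _, h4, h5⟩
    exact ⟨h1, h4, h5⟩

/-- The parameters of the algorithm are in registers `0` to `3`. -/
structure Ctx (n G N V : ℕ) (s : State) : Prop where
  r0 : s.reg 0 = G
  r1 : s.reg 1 = N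
  r2 : s.reg 2 = n + 1
  r3 : s.reg 3 = V

theorem Ctx.of_regEq {G N V b : ℕ} {s s' : State} (h : Ctx n G N V s) (hr : RegEq b s s')
    (hb : 4 ≤ b) : Ctx n G N V s' :=
  ⟨(hr 0 (by omega)).trans h.r0, (hr 1 (by omega)).trans h.r1, (hr 2 (by omega)).trans h.r2,
    (hr 3 (by omega)).trans h.r3⟩

theorem Agree.regEq {b : ℕ} {s s' : State} (h : Agree b s s') : RegEq b s s' := h.1

/-- The row `N + G + i`. -/
def specialRow (i : ℕ) : Expr := .bin .add (.bin .add (.reg 1) (.reg 0)) (.const i)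

/-- The row of the candidate whose number is in register `r`. -/
def candRow (r : ℕ) : Expr := .bin .add (.reg 1) (.reg r)

variable {G N V : ℕ}

theorem specialRow_val (hc : Ctx n G N V s) (i : ℕ) : (specialRow i).val E s = N + G + i := by
  simp only [specialRow, Expr.val, Op.apply, hc.r0, hc.r1]

theorem Fits.rows_le (hE : Fits E W P) : W ≤ P :=
  le_trans (Nat.le_mul_of_pos_right W (by omega)) hE.addr

theorem specialRow_ok (hE : Fits E (N + G + 3) P) (hc : Ctx n G N V s) {i : ℕ} (hi : i ≤ 2) :
    (specialRow i).Ok E s := by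
  have := hE.rows_le
  refine hE.bin_ok (hE.bin_ok (hE.reg_ok ?_) (hE.reg_ok ?_) ?_) (hE.const_ok ?_) ?_
  · rw [hc.r1]; omega
  · rw [hc.r0]; omega
  · simp only [Expr.val, Op.apply, hc.r0, hc.r1]; omega
  · omega
  · simp only [Expr.val, Op.apply, hc.r0, hc.r1]; omega

theorem candRow_val (hc : Ctx n G N V s) (r : ℕ) : (candRow r).val E s = N + s.reg r := by
  simp only [candRow, Expr.val, Op.apply, hc.r1]

theorem candRow_ok (hE : Fits E (N + G + 3) P) (hc : Ctx n G N V s) {r : ℕ} (hr : s.reg r < G) :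
    (candRow r).Ok E s := by
  have := hE.rows_le
  refine hE.bin_ok (hE.reg_ok ?_) (hE.reg_ok ?_) ?_
  · rw [hc.r1]; omega
  · omega
  · simp only [Expr.val, Op.apply, hc.r1]; omega

/-- The largest distance from row `N + G + 1` to a sample of the group given in register `5` is
put into register `6`. -/
def maxDistCmd (q : ℕ) : Cmd :=
  .seq (.assign 6 (.const 0))
    (.forLoop 7 (.const q)
      (.seq (.assign 20 (.bin .add (.bin .mul (.const q) (.reg 5)) (.reg 7)))
        (.seq (.assign 21 (specialRow 1))
          (.seq distCmd (.ite (.bin .lt (.reg 6) (.reg 24)) (.assign 6 (.reg 24)) .skip)))))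

/-- The largest distance from `z` to a sample of group `g`. -/
def groupVal (n q : ℕ) (row : ℕ → ℕ → ℕ) (z : ℕ → ℕ) (g : ℕ) : ℕ :=
  (Finset.range q).sup fun t => labelDist n (row (q * g + t)) z

theorem groupVal_le (q : ℕ) (row : ℕ → ℕ → ℕ) (z : ℕ → ℕ) (g : ℕ) :
    groupVal n q row z g ≤ n * n :=
  Finset.sup_le fun _ _ => labelDist_le _ _

theorem maxDistCmd_ends {q g : ℕ} (hE : Fits E (N + G + 3) P) (hc : Ctx n G N V s)
    (hs : s.Bounded n (N + G + 3) P) (hg : s.reg 5 = g) (hgG : g < G) (hq : q * G ≤ N) :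
    Ends E (maxDistCmd q) s fun s' => Agree 6 s s' ∧
      s'.reg 6 = groupVal n q (s.cell n) (s.cell n (N + G + 1)) g := by
  have hW := hE.rows_le
  have hsq := hE.sq
  have hword := hE.word
  have hqG : q ≤ N := le_trans (Nat.le_mul_of_pos_right q (by omega)) hq
  refine Ends.seq (Ends.assign (hE.const_ok (by omega)) ?_)
  -- `groupVal` multiplies the group number by the group size, here the loop counter. Shifted rows
  -- and group 0 express the maximum over the first `i` samples.
  refine (Ends.forLoop q (fun i s' => Agree 6 s s' ∧ s'.reg 7 = i ∧
    s'.reg 6 = groupVal n i (fun t => s.cell n (q * g + t)) (s.cell n (N + G + 1)) 0) (by omega)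
    ⟨((Agree.refl 6 s).setReg (by norm_num)).setReg (by norm_num), by simp,
      by simp [Expr.val, groupVal]⟩ ?_ ?_).mono ?_
  · rintro i hi s' ⟨h1, h3, h4⟩
    exact ⟨h3, hE.const_ok (by omega), rfl⟩
  · rintro i hi s' ⟨h1, h3, h4⟩
    have hr5 : s'.reg 5 = g := by rw [h1.1 5 (by norm_num), hg]
    have hc' : Ctx n G N V s' := hc.of_regEq h1.regEq (by norm_num)
    have hrow : q * g + i < N := by
      calc q * g + i < q * g + q := by omega
        _ = q * (g + 1) := by ring
        _ ≤ q * G := Nat.mul_le_mul_left q hgG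
        _ ≤ N := hq
    have h20 : (Expr.bin .add (.bin .mul (.const q) (.reg 5)) (.reg 7)).val E s' = q * g + i := by
      simp only [Expr.val, Op.apply, hr5, h3]
    refine Ends.seq (Ends.assign ?_ ?_)
    · refine hE.bin_ok (hE.bin_ok (hE.const_ok (by omega)) (hE.reg_ok (by omega)) ?_)
        (hE.reg_ok (by omega)) ?_
      · simp only [Expr.val, Op.apply, hr5]; omega
      · exact h20.le.trans (by omega)
    rw [h20]
    have hc1 : Ctx n G N V (s'.setReg 20 (q * g + i)) :=
      hc'.of_regEq ((RegEq.refl 4 s').setReg (by norm_num)) le_rfl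
    refine Ends.seq (Ends.assign (specialRow_ok hE hc1 (by norm_num)) ?_)
    rw [specialRow_val hc1]
    refine Ends.seq ((distCmd_ends hE (A := q * g + i) (B := N + G + 1) (by simpa using hc'.r2)
      (fun j hj => by simpa using h1.bounded hs j hj) (by simp) (by simp) (by omega)
      (by omega)).mono ?_)
    rintro s'' ⟨h5, h6⟩
    have hagree : Agree 20 s' s'' :=
      (((Agree.refl 20 s').setReg le_rfl).setReg (by norm_num)).trans (h5.mono (by norm_num))
    have hr6 : s''.reg 6 = s'.reg 6 := hagree.1 6 (by norm_num)
    have hr7 : s''.reg 7 = i := by rw [hagree.1 7 (by norm_num), h3]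
    have hr24 : s''.reg 24 = labelDist n (s.cell n (q * g + i)) (s.cell n (N + G + 1)) := by
      rw [h6]
      refine labelDist_congr (fun u _ => ?_) fun u _ => ?_
      · simp only [State.setReg_cell]; exact h1.cell _ _
      · simp only [State.setReg_cell]; exact h1.cell _ _
    have hle6 := groupVal_le (n := n) i (fun t => s.cell n (q * g + t)) (s.cell n (N + G + 1)) 0
    have hle24 := labelDist_le (n := n) (s.cell n (q * g + i)) (s.cell n (N + G + 1))
    have hsucc : groupVal n (i + 1) (fun t => s.cell n (q * g + t)) (s.cell n (N + G + 1)) 0 =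
        max (s''.reg 6) (s''.reg 24) := by
      rw [hr6, h4, hr24, groupVal, Finset.range_add_one, Finset.sup_insert, groupVal, max_comm]
      simp only [mul_zero, zero_add]
    have hagree6 : Agree 6 s s'' := h1.trans (hagree.mono (by norm_num))
    refine Ends.ite (hE.lt_ok (hE.reg_ok (by omega)) (hE.reg_ok (by omega))) ?_ ?_
    · intro h
      rw [val_lt_ne_zero] at h
      simp only [Expr.val] at h
      refine Ends.assign (hE.reg_ok (by omega)) ⟨by simpa using hr7,
        (hagree6.setReg (by norm_num)).setReg (by norm_num), by simp, ?_⟩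
      rw [hsucc, max_eq_right h.le]
      simp [Expr.val]
    · intro h
      rw [val_lt_eq_zero] at h
      simp only [Expr.val] at h
      refine Ends.skip ⟨hr7, hagree6.setReg (by norm_num), by simp, ?_⟩
      rw [hsucc, max_eq_left h]
      simp
  · rintro s' ⟨h1, _, h4⟩
    refine ⟨h1, ?_⟩
    rw [h4]
    simp [groupVal]

/-- If row `N + G + 1` is better for the group given in register `5` than the present candidate,
it replaces this candidate. -/
def groupCmd (q : ℕ) : Cmd :=
  .seq (maxDistCmd q)
    (.ite (.bin .lt (.reg 6) (cellAt (candRow 5) .numVertices))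
      (.seq (.store (addrOf (candRow 5) .numVertices) (.reg 6))
        (.seq (.assign 20 (specialRow 1)) (.seq (.assign 21 (candRow 5)) copyCmd)))
      .skip)

/-- The contents of the candidate row of group `g` after an update. -/
def candUpdate (n q G N : ℕ) (row : ℕ → ℕ → ℕ) (g c : ℕ) : ℕ :=
  if groupVal n q row (row (N + G + 1)) g < row (N + g) n then
    if c = n then groupVal n q row (row (N + G + 1)) g else row (N + G + 1) c
  else row (N + g) c

theorem groupCmd_ends {q g : ℕ} (hE : Fits E (N + G + 3) P) (hc : Ctx n G N V s)
    (hs : s.Bounded n (N + G + 3) P) (hg : s.reg 5 = g) (hgG : g < G) (hq : q * G ≤ N) :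
    Ends E (groupCmd q) s fun s' => RegEq 6 s s' ∧ s'.Bounded n (N + G + 3) P ∧
      ∀ r, ∀ c ≤ n, s'.cell n r c =
        if r = N + g then candUpdate n q G N (s.cell n) g c else s.cell n r c := by
  have hW := hE.rows_le
  have hsq := hE.sq
  have hone := hE.one
  refine Ends.seq ((maxDistCmd_ends hE hc hs hg hgG hq).mono ?_)
  rintro s₁ ⟨h1, h6⟩
  have hc1 : Ctx n G N V s₁ := hc.of_regEq h1.regEq (by norm_num)
  have hs1 : s₁.Bounded n (N + G + 3) P := h1.bounded hs
  have hr5 : s₁.reg 5 = g := by rw [h1.1 5 (by norm_num), hg]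
  have hval := groupVal_le (n := n) q (s.cell n) (s.cell n (N + G + 1)) g
  have hcand := candRow_ok hE hc1 (r := 5) (by omega)
  have hcandv : (candRow 5).val E s₁ = N + g := by rw [candRow_val hc1, hr5]
  have hcell : s₁.cell n = s.cell n := by funext r c; exact h1.cell r c
  refine Ends.ite (hE.lt_ok (hE.reg_ok (by omega)) (cellAt_ok hE hc1.r2 hs1 hcand
    hE.numVertices_ok (by omega) le_rfl)) ?_ ?_
  · intro h
    rw [val_lt_ne_zero] at h
    simp only [Expr.val, cellAt_val hc1.r2, hcandv, h6, hcell] at h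
    refine Ends.seq (Ends.storeCell hE hc1.r2 hcand hE.numVertices_ok (by omega) le_rfl
      (hE.reg_ok (by omega)) ?_)
    simp only [hcandv, Expr.val, h6]
    set x := groupVal n q (s.cell n) (s.cell n (N + G + 1)) g with hx
    set s₂ := s₁.setMem ((N + g) * (n + 1) + n) x with hs2
    have hc2 : Ctx n G N V s₂ := hc1.of_regEq (RegEq.refl 4 s₁) le_rfl
    refine Ends.seq (Ends.assign (specialRow_ok hE hc2 (by norm_num)) ?_)
    rw [specialRow_val hc2]
    have hc3 : Ctx n G N V (s₂.setReg 20 (N + G + 1)) :=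
      hc2.of_regEq ((RegEq.refl 4 s₂).setReg (by norm_num)) le_rfl
    have hr53 : (s₂.setReg 20 (N + G + 1)).reg 5 = g := by simpa [hs2] using hr5
    refine Ends.seq (Ends.assign (candRow_ok hE hc3 (by omega)) ?_)
    rw [candRow_val hc3, hr53]
    have hb2 : s₂.Bounded n (N + G + 3) P := hs1.setMem (by omega)
    refine (copyCmd_ends hE (A := N + G + 1) (B := N + g) (by simpa using hc2.r2)
      (fun j hj => by simpa using hb2 j hj) (by simp) (by simp) (by omega) (by omega)
      (by omega)).mono ?_
    rintro s₃ ⟨h7, h8, h9⟩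
    refine ⟨?_, h8, ?_⟩
    · intro r hr
      rw [h7 r (by omega), State.setReg_reg, if_neg (by omega), State.setReg_reg,
        if_neg (by omega)]
      exact h1.1 r hr
    · intro r c hcn
      rw [h9 r c hcn]
      simp only [State.setReg_cell, hs2]
      rw [State.setMem_cell _ le_rfl hcn, State.setMem_cell _ le_rfl hcn, hcell]
      by_cases hr : r = N + g
      · subst hr
        rw [candUpdate, ← hx, if_pos h]
        by_cases hcn' : c = n
        · simp [hcn']
        · have : c < n := by omega
          simp [hcn', this]
      · simp [hr]
  · intro h
    rw [val_lt_eq_zero] at h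
    simp only [Expr.val, cellAt_val hc1.r2, hcandv, h6, hcell] at h
    refine Ends.skip ⟨h1.regEq, hs1, fun r c _ => ?_⟩
    rw [hcell]
    by_cases hr : r = N + g
    · subst hr
      rw [if_pos rfl, candUpdate, if_neg (not_lt.mpr h)]
    · simp [hr]

/-- The groups are updated in place one after another. The update of group `g` reads only sample
rows and rows from `N + g` on, which the earlier groups have left untouched. -/
theorem candUpdate_congr {q g c : ℕ} {row row' : ℕ → ℕ → ℕ} (hq : q * G ≤ N) (hgG : g < G)
    (hc : c ≤ n) (h : ∀ r, ∀ c ≤ n, r < N ∨ N + g ≤ r → row r c = row' r c) :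
    candUpdate n q G N row g c = candUpdate n q G N row' g c := by
  have hval : groupVal n q row (row (N + G + 1)) g = groupVal n q row' (row' (N + G + 1)) g := by
    refine Finset.sup_congr rfl fun t ht => ?_
    rw [Finset.mem_range] at ht
    have hrow : q * g + t < N := by
      calc q * g + t < q * g + q := by omega
        _ = q * (g + 1) := by ring
        _ ≤ q * G := Nat.mul_le_mul_left q hgG
        _ ≤ N := hq
    exact labelDist_congr (fun u hu => h _ u (by omega) (Or.inl hrow))
      (fun u hu => h _ u (by omega) (Or.inr (by omega)))
  unfold candUpdate
  rw [hval, h (N + g) n le_rfl (Or.inr le_rfl), h (N + g) c hc (Or.inr le_rfl),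
    h (N + G + 1) c hc (Or.inr (by omega))]

theorem groupsCmd_ends {q : ℕ} (hE : Fits E (N + G + 3) P) (hc : Ctx n G N V s)
    (hs : s.Bounded n (N + G + 3) P) (hq : q * G ≤ N) :
    Ends E (.forLoop 5 (.reg 0) (groupCmd q)) s fun s' => RegEq 5 s s' ∧
      s'.Bounded n (N + G + 3) P ∧
      (∀ g < G, ∀ c ≤ n, s'.cell n (N + g) c = candUpdate n q G N (s.cell n) g c) ∧
      ∀ r, ∀ c ≤ n, r < N ∨ N + G ≤ r → s'.cell n r c = s.cell n r c := by
  have hW := hE.rows_le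
  have hword := hE.word
  refine (Ends.forLoop G (fun i s' => RegEq 5 s s' ∧ s'.reg 5 = i ∧ s'.Bounded n (N + G + 3) P ∧
      (∀ g < i, ∀ c ≤ n, s'.cell n (N + g) c = candUpdate n q G N (s.cell n) g c) ∧
      ∀ r, ∀ c ≤ n, r < N ∨ N + i ≤ r → s'.cell n r c = s.cell n r c) (by omega)
      ⟨(RegEq.refl 5 s).setReg le_rfl, by simp, hs, by omega, fun r c _ _ => rfl⟩ ?_ ?_).mono ?_
  · rintro i hi s' ⟨h1, h3, _⟩
    have hc' := hc.of_regEq h1 (by norm_num)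
    have := hc'.r0
    exact ⟨h3, hE.reg_ok (by omega), hc'.r0⟩
  · rintro i hi s' ⟨h1, h3, h4, h5, h6⟩
    refine (groupCmd_ends hE (hc.of_regEq h1 (by norm_num)) h4 h3 hi hq).mono ?_
    rintro s'' ⟨h7, h8, h9⟩
    refine ⟨(h7 5 (by norm_num)).trans h3, (h1.trans (h7.mono (by norm_num))).setReg le_rfl,
      by simp, h8, ?_, ?_⟩
    · intro g hg c hcn
      rw [State.setReg_cell, h9 _ c hcn]
      by_cases hgi : g = i
      · subst hgi
        rw [if_pos rfl]
        exact candUpdate_congr hq hi hcn fun r c hc hr => h6 r c hc hr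
      · rw [if_neg (by omega)]
        exact h5 g (by omega) c hcn
    · intro r c hcn hr
      rw [State.setReg_cell, h9 _ c hcn, if_neg (by omega)]
      exact h6 r c hcn (by omega)
  · rintro s' ⟨h1, _, h4, h5, h6⟩
    exact ⟨h1, h4, h5, h6⟩

end Search

/-! ### Enumeration of all labellings and running minima -/

section Search

variable {n : ℕ} {E : Env n} {P : ℕ} {s : State} {Q : State → Prop} {G N V : ℕ}

/-- Digit `u` of `κ` in base `n`. -/
def digit (n κ u : ℕ) : ℕ := κ / n ^ u % n

theorem digit_succ_of_not_dvd {κ u : ℕ} (h : ¬ n ^ u ∣ κ + 1) : digit n (κ + 1) u = digit n κ u := by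
  unfold digit
  rw [Nat.succ_div, if_neg h, add_zero]

theorem div_succ_of_dvd {κ u : ℕ} (h : n ^ u ∣ κ + 1) : (κ + 1) / n ^ u = κ / n ^ u + 1 := by
  rw [Nat.succ_div, if_pos h]

/-- Carry propagation: the carry enters position `u` when `n ^ u` divides `κ + 1`, and passes on
exactly when the digit there is maximal. -/
theorem pow_succ_dvd_iff {κ u : ℕ} (hn : 1 ≤ n) (h : n ^ u ∣ κ + 1) :
    n ^ (u + 1) ∣ κ + 1 ↔ digit n κ u + 1 = n := by
  have h1 : n ^ (u + 1) ∣ κ + 1 ↔ n ∣ κ / n ^ u + 1 := by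
    rw [← div_succ_of_dvd h, pow_succ]
    exact (Nat.dvd_div_iff_mul_dvd h).symm
  rw [h1, digit]
  have hlt := Nat.mod_lt (κ / n ^ u) (show n > 0 by omega)
  constructor
  · intro h2
    rw [Nat.dvd_iff_mod_eq_zero, Nat.add_mod] at h2
    by_contra hne
    have h3 : κ / n ^ u % n + 1 < n := by omega
    have h4 : 1 < n := by omega
    rw [Nat.mod_eq_of_lt h4, Nat.mod_eq_of_lt h3] at h2
    omega
  · intro h2
    rw [← Nat.div_add_mod (κ / n ^ u) n, add_assoc, h2]
    exact (Nat.dvd_mul_right _ _).add (dvd_refl n)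

theorem digit_succ_of_dvd {κ u : ℕ} (hn : 1 ≤ n) (h : n ^ u ∣ κ + 1) :
    digit n (κ + 1) u = if digit n κ u + 1 = n then 0 else digit n κ u + 1 := by
  have hlt := Nat.mod_lt (κ / n ^ u) (show n > 0 by omega)
  split_ifs with h1
  · rw [← pow_succ_dvd_iff hn h] at h1
    unfold digit
    have : n ∣ (κ + 1) / n ^ u := by
      rw [pow_succ] at h1
      exact (Nat.dvd_div_iff_mul_dvd h).mpr h1
    exact Nat.mod_eq_zero_of_dvd this
  · unfold digit at *
    rw [div_succ_of_dvd h, Nat.add_mod, Nat.mod_eq_of_lt (show 1 < n by omega),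
      Nat.mod_eq_of_lt (by omega)]

theorem digit_lt {κ u : ℕ} (hn : 1 ≤ n) : digit n κ u < n := Nat.mod_lt _ (by omega)

/-- Row `N + G` is incremented as a number in base `n`; register `4` tells whether
there was no overflow. -/
def incrementCmd : Cmd :=
  .seq (.assign 6 (.const 1))
    (.seq (.forLoop 5 .numVertices
      (.ite (.reg 6)
        (.ite (.bin .eq (.bin .add (cellAt (specialRow 0) (.reg 5)) (.const 1)) .numVertices)
          (.store (addrOf (specialRow 0) (.reg 5)) (.const 0))
          (.seq (.store (addrOf (specialRow 0) (.reg 5))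
              (.bin .add (cellAt (specialRow 0) (.reg 5)) (.const 1)))
            (.assign 6 (.const 0))))
        .skip))
    (.assign 4 (.bin .sub (.const 1) (.reg 6))))

/-- The number `κ` runs up to `n ^ n`, which need not fit into a word, so it exists only as a row of
digits. Register 6 is the carry, and it equals 1 before position `i` iff `n ^ i` divides `κ + 1`. A
carry left after `n` positions means `κ + 1 = n ^ n`, the end of the enumeration. -/
theorem incrementCmd_ends (hE : Fits E (N + G + 3) P) (hc : Ctx n G N V s) (hn : 1 ≤ n)
    (hs : s.Bounded n (N + G + 3) P) {κ : ℕ} (hκ : κ < n ^ n)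
    (hdig : ∀ u < n, s.cell n (N + G) u = digit n κ u) :
    Ends E incrementCmd s fun s' => RegEq 4 s s' ∧ s'.Bounded n (N + G + 3) P ∧
      (s'.reg 4 = if κ + 1 < n ^ n then 1 else 0) ∧
      (∀ u < n, s'.cell n (N + G) u = digit n (κ + 1) u) ∧
      ∀ r, ∀ c ≤ n, r ≠ N + G → s'.cell n r c = s.cell n r c := by
  have hW := hE.rows_le
  have hword := hE.word
  have hone := hE.one
  refine Ends.seq (Ends.assign (hE.const_ok (by omega)) ?_)
  refine Ends.seq ((Ends.forLoop n (fun i s' => RegEq 4 s s' ∧ s'.reg 5 = i ∧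
      s'.Bounded n (N + G + 3) P ∧ (s'.reg 6 = if n ^ i ∣ κ + 1 then 1 else 0) ∧
      (∀ u < n, s'.cell n (N + G) u = if u < i then digit n (κ + 1) u else digit n κ u) ∧
      ∀ r, ∀ c ≤ n, r ≠ N + G → s'.cell n r c = s.cell n r c) (by omega)
      ⟨((RegEq.refl 4 s).setReg (by norm_num)).setReg (by norm_num), by simp, hs,
        by simp [Expr.val], fun u hu => by simpa using hdig u hu, fun r c _ _ => rfl⟩
      ?_ ?_).mono ?_)
  · rintro i hi s' ⟨_, h3, _⟩
    exact ⟨h3, hE.numVertices_ok, rfl⟩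
  · rintro i hi s' ⟨h1, h3, h4, h5, h6, h7⟩
    have hc' : Ctx n G N V s' := hc.of_regEq h1 le_rfl
    have hrow : (specialRow 0).Ok E s' := specialRow_ok hE hc' (by norm_num)
    have hrowv : (specialRow 0).val E s' = N + G := specialRow_val hc' 0
    have h5ok : (Expr.reg 5).Ok E s' := hE.reg_ok (by omega)
    have hcell : s'.cell n (N + G) i = digit n κ i := by rw [h6 i hi, if_neg (lt_irrefl i)]
    have hlt : digit n κ i < n := digit_lt hn
    have hcok : (cellAt (specialRow 0) (.reg 5)).Ok E s' :=
      cellAt_ok hE hc'.r2 h4 hrow h5ok (by omega) (by simp only [Expr.val]; omega)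
    have hcv : (cellAt (specialRow 0) (.reg 5)).val E s' = digit n κ i := by
      rw [cellAt_val hc'.r2, hrowv]; simp only [Expr.val, h3, hcell]
    have hsucc : (Expr.bin .add (cellAt (specialRow 0) (.reg 5)) (.const 1)).val E s' =
        digit n κ i + 1 := by rw [← hcv]; rfl
    have hsok : (Expr.bin .add (cellAt (specialRow 0) (.reg 5)) (.const 1)).Ok E s' :=
      hE.bin_ok hcok (hE.const_ok (by omega)) (hsucc.le.trans (by omega))
    have hstep : ∀ s'' x, RegEq 6 s' s'' → s''.reg 6 = (if n ^ (i + 1) ∣ κ + 1 then 1 else 0) →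
        s''.Bounded n (N + G + 3) P → x = digit n (κ + 1) i →
        (∀ r, ∀ c ≤ n, s''.cell n r c = if r = N + G ∧ c = i then x else s'.cell n r c) →
        s''.reg 5 = i ∧ (RegEq 4 s (s''.setReg 5 (i + 1)) ∧ (s''.setReg 5 (i + 1)).reg 5 = i + 1 ∧
          (s''.setReg 5 (i + 1)).Bounded n (N + G + 3) P ∧
          ((s''.setReg 5 (i + 1)).reg 6 = if n ^ (i + 1) ∣ κ + 1 then 1 else 0) ∧
          (∀ u < n, (s''.setReg 5 (i + 1)).cell n (N + G) u =
            if u < i + 1 then digit n (κ + 1) u else digit n κ u) ∧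
          ∀ r, ∀ c ≤ n, r ≠ N + G → (s''.setReg 5 (i + 1)).cell n r c = s.cell n r c) := by
      intro s'' x hr h6' hb hx hcells
      refine ⟨(hr 5 (by norm_num)).trans h3,
        (h1.trans (hr.mono (by norm_num))).setReg (by norm_num), by simp, hb, by simpa using h6',
        ?_, ?_⟩
      · intro u hu
        rw [State.setReg_cell, hcells _ u (by omega), h6 u hu]
        by_cases hui : u = i
        · subst hui; simp [hx]
        · by_cases hlt : u < i
          · simp [hui, hlt, Nat.lt_succ_of_lt hlt]
          · simp [hui, hlt, show ¬ u < i + 1 by omega]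
      · intro r c hcn hrN
        rw [State.setReg_cell, hcells r c hcn, if_neg (fun h => hrN h.1), h7 r c hcn hrN]
    refine Ends.ite (hE.reg_ok ?_) ?_ ?_
    · rw [h5]; split_ifs <;> omega
    · intro h
      have hdvd : n ^ i ∣ κ + 1 := by
        by_contra hnd
        rw [if_neg hnd] at h5
        exact h h5
      have hiff := pow_succ_dvd_iff hn hdvd
      have hds := digit_succ_of_dvd hn hdvd
      refine Ends.ite (hE.eq_ok hsok hE.numVertices_ok) ?_ ?_
      · intro h8
        rw [val_eq_ne_zero, hsucc] at h8
        simp only [Expr.val] at h8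
        refine Ends.storeCell hE hc'.r2 hrow h5ok (by omega) (by simp only [Expr.val]; omega)
          (hE.const_ok (by omega)) ?_
        rw [hrowv]
        simp only [Expr.val, h3]
        refine hstep _ 0 (RegEq.refl 6 s') ?_ (h4.setMem (by omega)) (by rw [hds, if_pos h8]) ?_
        · rw [if_pos (hiff.mpr h8), State.setMem_reg, h5, if_pos hdvd]
        · intro r c hcn
          rw [State.setMem_cell _ (by omega) hcn]
      · intro h8
        rw [val_eq_eq_zero, hsucc] at h8
        simp only [Expr.val] at h8
        refine Ends.seq (Ends.storeCell hE hc'.r2 hrow h5ok (by omega)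
          (by simp only [Expr.val]; omega) hsok ?_)
        rw [hrowv, hsucc]
        simp only [Expr.val, h3]
        refine Ends.assign (hE.const_ok (by omega)) ?_
        refine hstep _ (digit n κ i + 1) ?_ ?_ ?_ (by rw [hds, if_neg h8]) ?_
        · intro r hr
          rw [State.setReg_reg, if_neg (by omega)]; rfl
        · rw [if_neg (fun h9 => h8 (hiff.mp h9))]; simp [Expr.val]
        · exact h4.setMem (by omega)
        · intro r c hcn
          rw [State.setReg_cell, State.setMem_cell _ (by omega) hcn]
    · intro h
      have hdvd : ¬ n ^ i ∣ κ + 1 := by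
        intro hd
        rw [if_pos hd] at h5
        simp only [Expr.val] at h
        omega
      refine Ends.skip (hstep s' (digit n κ i) (RegEq.refl 6 s') ?_ h4
        (digit_succ_of_not_dvd hdvd).symm ?_)
      · rw [h5, if_neg hdvd, if_neg fun h9 => hdvd ((pow_dvd_pow n (Nat.le_succ i)).trans h9)]
      · intro r c hcn
        split_ifs with h9
        · rw [h9.1, h9.2, hcell]
        · rfl
  · rintro s' ⟨h1, _, h4, h5, h6, h7⟩
    refine Ends.assign (hE.bin_ok (hE.const_ok (by omega)) (hE.reg_ok ?_) ?_) ?_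
    · rw [h5]; split_ifs <;> omega
    · simp only [Op.apply, Expr.val]; omega
    · have hval : (Expr.bin .sub (.const 1) (.reg 6)).val E s' = 1 - s'.reg 6 := rfl
      rw [hval]
      refine ⟨h1.setReg le_rfl, h4, ?_, ?_, fun r c hcn hr => h7 r c hcn hr⟩
      · rw [State.setReg_reg, if_pos rfl, h5]
        by_cases hlt : κ + 1 < n ^ n
        · rw [if_pos hlt, if_neg (fun hd => absurd (Nat.le_of_dvd (by omega) hd) (by omega))]
        · have : κ + 1 = n ^ n := by omega
          rw [if_neg hlt, this, if_pos dvd_rfl]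
      · intro u hu
        rw [State.setReg_cell, h6 u hu, if_pos hu]

/-- The fair clustering that the oracle returns for the labelling with number `κ`. -/
def oracleRow (E : Env n) (κ : ℕ) : ℕ → ℕ :=
  labelsToCells (E.closest fun u => digit n κ u)

theorem oracleRow_lt (hn : 1 ≤ n) (κ u : ℕ) : oracleRow E κ u < n := by
  unfold oracleRow labelsToCells
  split_ifs
  · exact Fin.is_lt _
  · omega

/-- The closest fair clustering oracle is applied to row `N + G`; its answer is put into
row `N + G + 1`. -/
def oracleCmd : Cmd :=
  .seq (.forLoop 5 .numVertices (.ask (.reg 5) (cellAt (specialRow 0) (.reg 5))))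
    (.seq .callClosest
      (.forLoop 5 .numVertices (.store (addrOf (specialRow 1) (.reg 5)) (.answer (.reg 5)))))

theorem oracleCmd_ends (hE : Fits E (N + G + 3) P) (hc : Ctx n G N V s) (hn : 1 ≤ n)
    (hs : s.Bounded n (N + G + 3) P) {κ : ℕ}
    (hdig : ∀ u < n, s.cell n (N + G) u = digit n κ u) :
    Ends E oracleCmd s fun s' => RegEq 5 s s' ∧ s'.Bounded n (N + G + 3) P ∧
      (∀ u < n, s'.cell n (N + G + 1) u = oracleRow E κ u) ∧
      ∀ r, ∀ c ≤ n, r ≠ N + G + 1 → s'.cell n r c = s.cell n r c := by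
  have hword := hE.word
  have hone := hE.one
  refine Ends.seq ((Ends.forLoop n (fun i s' => Agree 5 s s' ∧ s'.reg 5 = i ∧
      ∀ u < i, s'.qry u = digit n κ u) (by omega)
      ⟨(Agree.refl 5 s).setReg le_rfl, by simp, by omega⟩ ?_ ?_).mono ?_)
  · rintro i hi s' ⟨_, h3, _⟩
    exact ⟨h3, hE.numVertices_ok, rfl⟩
  · rintro i hi s' ⟨h1, h3, h4⟩
    have hc' : Ctx n G N V s' := hc.of_regEq h1.regEq (by norm_num)
    have hrow : (specialRow 0).Ok E s' := specialRow_ok hE hc' (by norm_num)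
    have hrowv : (specialRow 0).val E s' = N + G := specialRow_val hc' 0
    refine Ends.ask (hE.reg_ok (by omega)) (cellAt_ok hE hc'.r2 (h1.bounded hs) hrow
      (hE.reg_ok (by omega)) (by omega) (by simp only [Expr.val]; omega)) ?_
    rw [cellAt_val hc'.r2, hrowv]
    simp only [Expr.val, h3]
    refine ⟨by simpa using h3, ?_, by simp, ?_⟩
    · exact Agree.setReg ⟨h1.1, h1.2⟩ le_rfl
    · intro u hu
      rw [State.setReg_qry, State.setQry_qry]
      split_ifs with hui
      · rw [hui, h1.cell, hdig i hi]
      · exact h4 u (by omega)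
  rintro s₁ ⟨h1, _, h4⟩
  refine Ends.seq (Ends.callClosest ?_)
  have hans : labelsToCells (E.closest fun u => s₁.qry u) = oracleRow E κ := by
    unfold oracleRow
    congr 2
    funext u
    exact h4 u u.2
  rw [hans]
  set s₂ : State := { s₁ with ans := oracleRow E κ, qry := fun _ => 0 } with hs2
  have h12 : Agree 5 s s₂ := ⟨h1.1, h1.2⟩
  refine (Ends.forLoop n (fun i s' => RegEq 5 s s' ∧ s'.reg 5 = i ∧
    s'.Bounded n (N + G + 3) P ∧ s'.ans = oracleRow E κ ∧
    (∀ u < i, s'.cell n (N + G + 1) u = oracleRow E κ u) ∧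
      ∀ r, ∀ c ≤ n, r ≠ N + G + 1 → s'.cell n r c = s.cell n r c) (by omega)
    ⟨h12.regEq.setReg le_rfl, by simp, h12.bounded hs, rfl, by omega,
      fun r c _ _ => h12.cell r c⟩ ?_ ?_).mono ?_
  · rintro i hi s' ⟨_, h3, _⟩
    exact ⟨h3, hE.numVertices_ok, rfl⟩
  · rintro i hi s' ⟨h5, h6, h7, h8, h9, h10⟩
    have hc' : Ctx n G N V s' := hc.of_regEq h5 (by norm_num)
    have hrow : (specialRow 1).Ok E s' := specialRow_ok hE hc' (by norm_num)
    have hrowv : (specialRow 1).val E s' = N + G + 1 := specialRow_val hc' 1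
    have hlt := oracleRow_lt (E := E) hn κ i
    have h5ok : (Expr.reg 5).Ok E s' := hE.reg_ok (by omega)
    refine Ends.storeCell hE hc'.r2 hrow h5ok (by omega)
      (by simp only [Expr.val]; omega) ⟨h5ok, by simp only [Expr.val]; omega, ?_⟩ ?_
    · simp only [Expr.val, h6, h8]; omega
    · rw [hrowv]
      simp only [Expr.val, h6, h8]
      refine ⟨by simpa using h6, (h5.setMem).setReg le_rfl, by simp, h7.setMem (by omega), h8, ?_, ?_⟩
      · intro u hu
        rw [State.setReg_cell, State.setMem_cell _ (by omega) (by omega)]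
        by_cases hui : u = i
        · simp [hui]
        · rw [if_neg (fun h => hui h.2)]
          exact h9 u (by omega)
      · intro r c hcn hr
        rw [State.setReg_cell, State.setMem_cell _ (by omega) hcn, if_neg (fun h => hr h.1)]
        exact h10 r c hcn hr
  · rintro s' ⟨h5, _, h7, _, h9, h10⟩
    exact ⟨h5, h7, h9, h10⟩

/-- The minimum of `B` and `val 0, …, val (κ - 1)`, and the first place where it is attained. -/
def runMin (B : ℕ) (val : ℕ → ℕ) : ℕ → ℕ × ℕ
  | 0 => (B, 0)
  | κ + 1 => if val κ < (runMin B val κ).1 then (val κ, κ) else runMin B val κ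

theorem runMin_le (B : ℕ) (val : ℕ → ℕ) {κ κ' : ℕ} (h : κ' < κ) : (runMin B val κ).1 ≤ val κ' := by
  induction κ with
  | zero => omega
  | succ κ ih =>
    rw [runMin]
    rcases Nat.lt_succ_iff_lt_or_eq.mp h with h1 | rfl
    · have := ih h1
      split_ifs <;> (try simp only) <;> omega
    · split_ifs <;> (try simp only) <;> omega

/-- The initial value exceeds all others and is replaced in the first round, so from then on the
recorded place is genuine. -/
theorem runMin_attained (B : ℕ) (val : ℕ → ℕ) (hval : ∀ κ, val κ < B) (κ : ℕ) :
    (runMin B val (κ + 1)).1 = val (runMin B val (κ + 1)).2 ∧ (runMin B val (κ + 1)).2 < κ + 1 := by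
  induction κ with
  | zero => simp [runMin, hval]
  | succ κ ih =>
    rw [runMin]
    split_ifs
    · exact ⟨rfl, by simp⟩
    · exact ⟨ih.1, by omega⟩

/-- The exhaustive search: candidates for all groups are stored in rows `N, …, N + G - 1`. -/
def searchCmd (q : ℕ) : Cmd :=
  .seq (.forLoop 5 (.reg 0)
      (.store (addrOf (candRow 5) .numVertices)
        (.bin .add (.bin .mul .numVertices .numVertices) (.const 1))))
    (.seq (.forLoop 5 .numVertices (.store (addrOf (specialRow 0) (.reg 5)) (.const 0)))
      (.seq (.assign 4 (.const 1))
        (.loop (.reg 4)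
          (.seq oracleCmd (.seq (.forLoop 5 (.reg 0) (groupCmd q)) incrementCmd)))))

/-- The number of the candidate for group `g` after `κ` rounds of the search. -/
def candIndex (E : Env n) (q : ℕ) (row : ℕ → ℕ → ℕ) (g κ : ℕ) : ℕ × ℕ :=
  runMin (n * n + 1) (fun κ => groupVal n q row (oracleRow E κ) g) κ

theorem groupVal_congr {q g : ℕ} {row row' : ℕ → ℕ → ℕ} {z z' : ℕ → ℕ} (hq : q * G ≤ N)
    (hgG : g < G) (h : ∀ r < N, ∀ u < n, row r u = row' r u) (hz : ∀ u < n, z u = z' u) :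
    groupVal n q row z g = groupVal n q row' z' g := by
  refine Finset.sup_congr rfl fun t ht => ?_
  rw [Finset.mem_range] at ht
  have hrow : q * g + t < N := by
    calc q * g + t < q * g + q := by omega
      _ = q * (g + 1) := by ring
      _ ≤ q * G := Nat.mul_le_mul_left q hgG
      _ ≤ N := hq
  exact labelDist_congr (fun u hu => h _ hrow u hu) hz

theorem searchCmd_ends {q : ℕ} (hE : Fits E (N + G + 3) P) (hc : Ctx n G N V s) (hn : 1 ≤ n)
    (hsq : n * n + 1 ≤ P) (hs : s.Bounded n (N + G + 3) P) (hq : q * G ≤ N) :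
    Ends E (searchCmd q) s fun s' => RegEq 4 s s' ∧ s'.Bounded n (N + G + 3) P ∧
      (∀ g < G, ∀ u < n, s'.cell n (N + g) u =
        oracleRow E (candIndex E q (s.cell n) g (n ^ n)).2 u) ∧
      ∀ r < N, ∀ c ≤ n, s'.cell n r c = s.cell n r c := by
  have hword := hE.word
  have hone := hE.one
  have hW := hE.rows_le
  refine Ends.seq ((Ends.forLoop G (fun i s' => RegEq 4 s s' ∧ s'.reg 5 = i ∧
    s'.Bounded n (N + G + 3) P ∧ (∀ g < i, s'.cell n (N + g) n = n * n + 1) ∧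
    ∀ r < N, ∀ c ≤ n, s'.cell n r c = s.cell n r c) (by omega)
    ⟨(RegEq.refl 4 s).setReg (by norm_num), by simp, hs, by omega, fun r _ c _ => rfl⟩
      ?_ ?_).mono ?_)
  · rintro i hi s' ⟨h1, h3, _⟩
    have hc' : Ctx n G N V s' := hc.of_regEq h1 le_rfl
    exact ⟨h3, hE.reg_ok (by rw [hc'.r0]; omega), hc'.r0⟩
  · rintro i hi s' ⟨h1, h3, h4, h5, h6⟩
    have hc' : Ctx n G N V s' := hc.of_regEq h1 le_rfl
    have hv : (candRow 5).val E s' = N + i := by rw [candRow_val hc', h3]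
    have hsq' := hE.sq
    refine Ends.storeCell hE hc'.r2 (candRow_ok hE hc' (by omega)) hE.numVertices_ok (by omega)
      le_rfl (hE.bin_ok (hE.bin_ok hE.numVertices_ok hE.numVertices_ok hE.sq)
        (hE.const_ok (by omega)) hsq) ?_
    rw [hv]
    simp only [Expr.val, Op.apply]
    refine ⟨by simpa using h3, (h1.setMem).setReg (by norm_num), by simp, h4.setMem hsq, ?_, ?_⟩
    · intro g hg
      rw [State.setReg_cell, State.setMem_cell _ le_rfl le_rfl]
      by_cases hgi : g = i
      · simp [hgi]
      · rw [if_neg (by omega)]; exact h5 g (by omega)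
    · intro r hr c hcn
      rw [State.setReg_cell, State.setMem_cell _ le_rfl hcn, if_neg (by omega)]
      exact h6 r hr c hcn
  rintro s₁ ⟨a1, _, a4, a5, a6⟩
  have hc1 : Ctx n G N V s₁ := hc.of_regEq a1 le_rfl
  refine Ends.seq ((Ends.forLoop n (fun i s' => RegEq 4 s s' ∧ s'.reg 5 = i ∧
    s'.Bounded n (N + G + 3) P ∧ (∀ u < i, s'.cell n (N + G) u = 0) ∧
    ∀ r < N + G, ∀ c ≤ n, s'.cell n r c = s₁.cell n r c) (by omega)
    ⟨a1.setReg (by norm_num), by simp, a4, by omega, fun r _ c _ => rfl⟩ ?_ ?_).mono ?_)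
  · rintro i hi s' ⟨_, h3, _⟩
    exact ⟨h3, hE.numVertices_ok, rfl⟩
  · rintro i hi s' ⟨h1, h3, h4, h5, h6⟩
    have hc' : Ctx n G N V s' := hc.of_regEq h1 le_rfl
    have hrow : (specialRow 0).Ok E s' := specialRow_ok hE hc' (by norm_num)
    have hrowv : (specialRow 0).val E s' = N + G := specialRow_val hc' 0
    refine Ends.storeCell hE hc'.r2 hrow (hE.reg_ok (by omega)) (by omega)
      (by simp only [Expr.val]; omega) (hE.const_ok (by omega)) ?_
    rw [hrowv]
    simp only [Expr.val, h3]
    refine ⟨by simpa using h3, (h1.setMem).setReg (by norm_num), by simp, h4.setMem (by omega),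
      ?_, ?_⟩
    · intro u hu
      rw [State.setReg_cell, State.setMem_cell _ (by omega) (by omega)]
      by_cases hui : u = i
      · simp [hui]
      · rw [if_neg (by omega)]; exact h5 u (by omega)
    · intro r hr c hcn
      rw [State.setReg_cell, State.setMem_cell _ (by omega) hcn, if_neg (by omega)]
      exact h6 r hr c hcn
  rintro s₂ ⟨b1, _, b4, b5, b6⟩
  refine Ends.seq (Ends.assign (hE.const_ok (by omega)) ?_)
  have hnn : 0 < n ^ n := Nat.pow_pos hn
  -- Column `n` of a candidate row holds the best value so far. The labels are meaningful only after
  -- the first round, which always replaces the initial value `n * n + 1`.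
  refine (Ends.loop (n ^ n) (fun κ s' => RegEq 4 s s' ∧ s'.Bounded n (N + G + 3) P ∧
    (s'.reg 4 = if κ < n ^ n then 1 else 0) ∧
    (∀ u < n, s'.cell n (N + G) u = digit n κ u) ∧
    (∀ g < G, s'.cell n (N + g) n = (candIndex E q (s.cell n) g κ).1) ∧
    (∀ g < G, 0 < κ → ∀ u < n, s'.cell n (N + g) u =
      oracleRow E (candIndex E q (s.cell n) g κ).2 u) ∧
    ∀ r < N, ∀ c ≤ n, s'.cell n r c = s.cell n r c) ?_ ?_ ?_).mono ?_
  · rintro κ hκ s' ⟨h1, h2, h3, h4, h5, h6, h7⟩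
    rw [if_pos hκ] at h3
    refine ⟨hE.reg_ok (by omega), by simp only [Expr.val]; omega, ?_⟩
    have hc' : Ctx n G N V s' := hc.of_regEq h1 le_rfl
    refine Ends.seq ((oracleCmd_ends hE hc' hn h2 h4).mono ?_)
    rintro t₁ ⟨c1, c2, c3, c4⟩
    have hct1 : Ctx n G N V t₁ := hc'.of_regEq c1 (by norm_num)
    refine Ends.seq ((groupsCmd_ends hE hct1 c2 hq).mono ?_)
    rintro t₂ ⟨d1, d2, d3, d4⟩
    have hct2 : Ctx n G N V t₂ := hct1.of_regEq d1 (by norm_num)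
    refine (incrementCmd_ends hE hct2 hn d2 hκ (fun u hu => by
      rw [d4 _ u (by omega) (by omega), c4 _ u (by omega) (by omega), h4 u hu])).mono ?_
    rintro t₃ ⟨e1, e2, e3, e4, e5⟩
    have hsame : ∀ g < G, ∀ c ≤ n, t₃.cell n (N + g) c = candUpdate n q G N (t₁.cell n) g c := by
      intro g hg c hcn
      rw [e5 _ c hcn (by omega), d3 g hg c hcn]
    have hval : ∀ g < G, groupVal n q (t₁.cell n) (t₁.cell n (N + G + 1)) g =
        groupVal n q (s.cell n) (oracleRow E κ) g := fun g hg =>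
      groupVal_congr hq hg (fun r hr u hu => by
        rw [c4 r u (by omega) (by omega), h7 r hr u (by omega)]) c3
    have hbest : ∀ g < G, t₁.cell n (N + g) n = (candIndex E q (s.cell n) g κ).1 := by
      intro g hg
      rw [c4 _ n le_rfl (by omega), h5 g hg]
    have hstep : ∀ g, candIndex E q (s.cell n) g (κ + 1) =
        if groupVal n q (s.cell n) (oracleRow E κ) g < (candIndex E q (s.cell n) g κ).1 then
          (groupVal n q (s.cell n) (oracleRow E κ) g, κ)
        else candIndex E q (s.cell n) g κ := fun g => rfl
    refine ⟨(h1.trans (c1.mono (by norm_num))).trans ((d1.mono (by norm_num)).trans e1), e2, e3, e4,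
      ?_, ?_, ?_⟩
    · intro g hg
      rw [hsame g hg n le_rfl, candUpdate, hval g hg, hbest g hg, if_pos rfl, hstep]
      split_ifs <;> rfl
    · intro g hg _ u hu
      rw [hsame g hg u (by omega), candUpdate, hval g hg, hbest g hg,
        if_neg (show ¬ u = n by omega), c3 u hu,
        hstep]
      by_cases hlt : groupVal n q (s.cell n) (oracleRow E κ) g < (candIndex E q (s.cell n) g κ).1
      · rw [if_pos hlt, if_pos hlt]
      · rw [if_neg hlt, if_neg hlt, c4 _ u (by omega) (by omega)]
        refine h6 g hg ?_ u hu
        rcases Nat.eq_zero_or_pos κ with h0 | h0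
        · exfalso
          apply hlt
          rw [h0]
          exact Nat.lt_succ_of_le (groupVal_le q _ _ g)
        · exact h0
    · intro r hr c hcn
      rw [e5 r c hcn (by omega), d4 r c hcn (Or.inl hr), c4 r c hcn (by omega), h7 r hr c hcn]
  · rintro s' ⟨_, _, h3, _⟩
    rw [if_neg (lt_irrefl _)] at h3
    exact ⟨hE.reg_ok (by omega), h3⟩
  · refine ⟨b1.setReg le_rfl, b4, by simp [Expr.val, hnn], ?_, ?_, by omega, ?_⟩
    · intro u hu
      rw [State.setReg_cell, b5 u hu]
      simp [digit]
    · intro g hg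
      rw [State.setReg_cell, b6 _ (by omega) n le_rfl, a5 g hg]
      rfl
    · intro r hr c hcn
      rw [State.setReg_cell, b6 r (by omega) c hcn, a6 r hr c hcn]
  · rintro s' ⟨h1, h2, _, _, _, h6, h7⟩
    exact ⟨h1, h2, fun g hg => h6 g hg hnn, h7⟩

end Search

/-! ### The tournament between the candidates -/

section Tournament

variable {n : ℕ} {E : Env n} {P : ℕ} {s : State} {Q : State → Prop} {G N V : ℕ}

/-- The `j`-th power of register `24`. -/
def powExpr : ℕ → Expr
  | 0 => .const 1
  | j + 1 => .bin .mul (powExpr j) (.reg 24)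

theorem powExpr_val (j : ℕ) : (powExpr j).val E s = s.reg 24 ^ j := by
  induction j with
  | zero => rfl
  | succ j ih => rw [pow_succ, ← ih]; rfl

theorem powExpr_ok {W : ℕ} (hE : Fits E W P) {ℓ : ℕ} (hx : s.reg 24 ≤ P)
    (h : ∀ j ≤ ℓ, s.reg 24 ^ j ≤ P) : (powExpr ℓ).Ok E s := by
  induction ℓ with
  | zero => exact hE.const_ok (by have := hE.one; omega)
  | succ ℓ ih =>
    refine hE.bin_ok (ih fun j hj => h j (by omega)) (hE.reg_ok hx) ?_
    have := h (ℓ + 1) le_rfl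
    rw [powExpr_val]
    simpa only [Op.apply, Expr.val, ← pow_succ] using this

/-- The sum over the rows `base, …, base + V - 1` of the `ℓ`-th powers of the distances to `z`,
truncated at `A`. -/
def scoreSum (n ℓ A V : ℕ) (row : ℕ → ℕ → ℕ) (base : ℕ) (z : ℕ → ℕ) : ℕ :=
  ∑ j ∈ Finset.range V, min (labelDist n (row (base + j)) z) A ^ ℓ

theorem scoreSum_congr {ℓ A base : ℕ} {row row' : ℕ → ℕ → ℕ} {z z' : ℕ → ℕ}
    (h : ∀ j < V, ∀ u < n, row (base + j) u = row' (base + j) u) (hz : ∀ u < n, z u = z' u) :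
    scoreSum n ℓ A V row base z = scoreSum n ℓ A V row' base z' := by
  refine Finset.sum_congr rfl fun j hj => ?_
  rw [labelDist_congr (h j (Finset.mem_range.mp hj)) hz]

theorem scoreSum_le (ℓ A V : ℕ) (row : ℕ → ℕ → ℕ) (base : ℕ) (z : ℕ → ℕ) :
    scoreSum n ℓ A V row base z ≤ V * A ^ ℓ := by
  calc _ ≤ ∑ _j ∈ Finset.range V, A ^ ℓ :=
        Finset.sum_le_sum fun j _ => Nat.pow_le_pow_left (min_le_right _ _) ℓ
    _ = V * A ^ ℓ := by simp

/-- The truncated score, with the threshold in register `8`, of the row given in register `10`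
is put into register `12`. -/
def scoreCmd (q ℓ : ℕ) : Cmd :=
  .seq (.assign 12 (.const 0))
    (.forLoop 11 (.reg 3)
      (.seq (.assign 20 (.bin .add (.bin .mul (.const q) (.reg 0)) (.reg 11)))
        (.seq (.assign 21 (.reg 10))
          (.seq distCmd
            (.seq (.ite (.bin .lt (.reg 8) (.reg 24)) (.assign 24 (.reg 8)) .skip)
              (.assign 12 (.bin .add (.reg 12) (powExpr ℓ))))))))

/-- The powers that occur in the tournament are words. -/
structure FitsPow (n C ℓ V P : ℕ) : Prop where
  pow : ∀ j ≤ ℓ, (C * (n * n)) ^ j ≤ P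
  mul : V * (C * (n * n)) ^ ℓ ≤ P
  base : C * (n * n) ≤ P
  const : C ≤ P

theorem scoreCmd_ends {q C ℓ A R : ℕ} (hE : Fits E (N + G + 3) P) (hF : FitsPow n C ℓ V P)
    (hc : Ctx n G N V s) (hs : s.Bounded n (N + G + 3) P) (hN : N = q * G + V) (hG : 1 ≤ G)
    (hA : s.reg 8 = A) (hAC : A ≤ C * (n * n)) (hR : s.reg 10 = R) (hRW : R < N + G + 3) :
    Ends E (scoreCmd q ℓ) s fun s' => Agree 11 s s' ∧
      s'.reg 12 = scoreSum n ℓ A V (s.cell n) (q * G) (s.cell n R) := by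
  have hW := hE.rows_le
  have hword := hE.word
  have hsq := hE.sq
  have hbase := hF.base
  have hqP : q ≤ P := by
    have : q ≤ q * G := Nat.le_mul_of_pos_right q hG
    omega
  refine Ends.seq (Ends.assign (hE.const_ok (by omega)) ?_)
  refine (Ends.forLoop V (fun i s' => Agree 11 s s' ∧ s'.reg 11 = i ∧
    s'.reg 12 = scoreSum n ℓ A i (s.cell n) (q * G) (s.cell n R)) (by omega)
    ⟨((Agree.refl 11 s).setReg (by norm_num)).setReg (by norm_num), by simp,
      by simp [Expr.val, scoreSum]⟩ ?_ ?_).mono ?_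
  · rintro i hi s' ⟨h1, h3, h4⟩
    have hc' : Ctx n G N V s' := hc.of_regEq h1.regEq (by norm_num)
    exact ⟨h3, hE.reg_ok (by rw [hc'.r3]; omega), hc'.r3⟩
  · rintro i hi s' ⟨h1, h3, h4⟩
    have hc' : Ctx n G N V s' := hc.of_regEq h1.regEq (by norm_num)
    have hr0 := hc'.r0
    have h20 : (Expr.bin .add (.bin .mul (.const q) (.reg 0)) (.reg 11)).val E s' = q * G + i := by
      simp only [Expr.val, Op.apply, hc'.r0, h3]
    refine Ends.seq (Ends.assign ?_ ?_)
    · refine hE.bin_ok (hE.bin_ok (hE.const_ok hqP) (hE.reg_ok (by omega)) ?_)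
        (hE.reg_ok (by omega)) ?_
      · simp only [Expr.val, Op.apply, hc'.r0]; omega
      · exact h20.le.trans (by omega)
    rw [h20]
    have hr10 : (s'.setReg 20 (q * G + i)).reg 10 = R := by
      simp [h1.1 10 (by norm_num), hR]
    refine Ends.seq (Ends.assign (hE.reg_ok (by omega)) ?_)
    simp only [Expr.val, hr10]
    refine Ends.seq ((distCmd_ends hE (A := q * G + i) (B := R) (by simpa using hc'.r2)
      (fun j hj => by simpa using h1.bounded hs j hj) (by simp) (by simp) (by omega)
      hRW).mono ?_)
    rintro s'' ⟨h5, h6⟩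
    have hagree : Agree 20 s' s'' :=
      (((Agree.refl 20 s').setReg le_rfl).setReg (by norm_num)).trans (h5.mono (by norm_num))
    have hagree11 : Agree 11 s s'' := h1.trans (hagree.mono (by norm_num))
    set d := labelDist n (s.cell n (q * G + i)) (s.cell n R) with hd
    have hr24 : s''.reg 24 = d := by
      rw [h6]
      refine labelDist_congr (fun u _ => ?_) fun u _ => ?_
      · simp only [State.setReg_cell]; exact h1.cell _ _
      · simp only [State.setReg_cell]; exact h1.cell _ _
    have hr8 : s''.reg 8 = A := by rw [hagree11.1 8 (by norm_num), hA]
    have hr11 : s''.reg 11 = i := by rw [hagree.1 11 (by norm_num), h3]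
    have hr12 : s''.reg 12 = scoreSum n ℓ A i (s.cell n) (q * G) (s.cell n R) := by
      rw [hagree.1 12 (by norm_num), h4]
    have hdle : d ≤ n * n := labelDist_le _ _
    refine Ends.seq (Ends.mono (R := fun t => Agree 11 s t ∧ t.reg 11 = i ∧
      t.reg 12 = scoreSum n ℓ A i (s.cell n) (q * G) (s.cell n R) ∧ t.reg 24 = min d A) ?_ ?_)
    · refine Ends.ite (hE.lt_ok (hE.reg_ok (by omega)) (hE.reg_ok (by omega))) ?_ ?_
      · intro h
        rw [val_lt_ne_zero] at h
        simp only [Expr.val, hr8, hr24] at h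
        refine Ends.assign (hE.reg_ok (by omega)) ⟨hagree11.setReg (by norm_num),
          by simpa using hr11, by simpa using hr12, ?_⟩
        simp [Expr.val, hr8, h.le]
      · intro h
        rw [val_lt_eq_zero] at h
        simp only [Expr.val, hr8, hr24] at h
        exact Ends.skip ⟨hagree11, hr11, hr12, by rw [hr24, min_eq_left h]⟩
    · rintro t ⟨b1, b2, b3, b4⟩
      have hmin : min d A ≤ C * (n * n) := (min_le_right _ _).trans hAC
      have hpow : ∀ j ≤ ℓ, t.reg 24 ^ j ≤ P := fun j hj => by
        rw [b4]; exact (Nat.pow_le_pow_left hmin j).trans (hF.pow j hj)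
      have hsum : scoreSum n ℓ A (i + 1) (s.cell n) (q * G) (s.cell n R) =
          t.reg 12 + t.reg 24 ^ ℓ := by
        rw [b3, b4, scoreSum, Finset.sum_range_succ]; rfl
      have hle : scoreSum n ℓ A (i + 1) (s.cell n) (q * G) (s.cell n R) ≤ P := by
        refine (scoreSum_le _ _ _ _ _ _).trans (le_trans ?_ hF.mul)
        exact Nat.mul_le_mul hi (Nat.pow_le_pow_left hAC ℓ)
      have hval : (Expr.bin .add (.reg 12) (powExpr ℓ)).val E t =
          t.reg 12 + t.reg 24 ^ ℓ := by
        simp only [Expr.val, Op.apply, powExpr_val]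
      refine Ends.assign (hE.bin_ok (hE.reg_ok (by omega)) (powExpr_ok hE (by omega) hpow)
        (hval.le.trans (by omega))) ?_
      rw [hval, ← hsum]
      exact ⟨by simpa using b2, (b1.setReg (by norm_num)).setReg (by norm_num), by simp, by simp⟩
  · rintro s' ⟨h1, _, h4⟩
    exact ⟨h1, h4⟩

/-- Candidate `g` beats candidate `h` on the validation rows. -/
def RowBeats (n q C ℓ G N V : ℕ) (row : ℕ → ℕ → ℕ) (g h : ℕ) : Prop :=
  scoreSum n ℓ (C * labelDist n (row (N + g)) (row (N + h))) V row (q * G) (row (N + g)) ≤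
    scoreSum n ℓ (C * labelDist n (row (N + g)) (row (N + h))) V row (q * G) (row (N + h))

instance (q C ℓ : ℕ) (row : ℕ → ℕ → ℕ) (g h : ℕ) : Decidable (RowBeats n q C ℓ G N V row g h) :=
  inferInstanceAs (Decidable (_ ≤ _))

/-- The number of the candidates `0, …, i - 1` that are beaten by candidate `g`. -/
def winCount (n q C ℓ G N V : ℕ) (row : ℕ → ℕ → ℕ) (g i : ℕ) : ℕ :=
  ∑ h ∈ Finset.range i, if RowBeats n q C ℓ G N V row g h then 1 else 0

theorem winCount_le (q C ℓ : ℕ) (row : ℕ → ℕ → ℕ) (g i : ℕ) :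
    winCount n q C ℓ G N V row g i ≤ i := by
  calc _ ≤ ∑ _h ∈ Finset.range i, 1 := Finset.sum_le_sum fun h _ => by split_ifs <;> omega
    _ = i := by simp

/-- A candidate ties with itself. Hence the first candidate exceeds the initial record 0 of the
tournament, and the winner row is filled in the first round. -/
theorem winCount_pos (q C ℓ : ℕ) (row : ℕ → ℕ → ℕ) {g i : ℕ} (hg : g < i) :
    0 < winCount n q C ℓ G N V row g i := by
  refine Finset.sum_pos' (fun _ _ => Nat.zero_le _) ⟨g, Finset.mem_range.mpr hg, ?_⟩
  have h : RowBeats n q C ℓ G N V row g g := le_refl _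
  rw [if_pos h]
  exact one_pos

theorem rowBeats_congr {q C ℓ g h : ℕ} {row row' : ℕ → ℕ → ℕ} (hN : N = q * G + V)
    (hg : g < G) (hh : h < G) (hrow : ∀ r < N + G, ∀ u < n, row r u = row' r u) :
    RowBeats n q C ℓ G N V row g h ↔ RowBeats n q C ℓ G N V row' g h := by
  have h1 : ∀ u < n, row (N + g) u = row' (N + g) u := hrow _ (by omega)
  have h2 : ∀ u < n, row (N + h) u = row' (N + h) u := hrow _ (by omega)
  have h3 : ∀ j < V, ∀ u < n, row (q * G + j) u = row' (q * G + j) u :=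
    fun j hj => hrow _ (by omega)
  unfold RowBeats
  rw [labelDist_congr h1 h2, scoreSum_congr h3 h1, scoreSum_congr h3 h2]

/-- Win counts ignore the winner row and column `n`, so overwriting the winner during the tournament
does not affect later counts. -/
theorem winCount_congr {q C ℓ g i : ℕ} {row row' : ℕ → ℕ → ℕ} (hN : N = q * G + V)
    (hg : g < G) (hi : i ≤ G) (hrow : ∀ r < N + G, ∀ u < n, row r u = row' r u) :
    winCount n q C ℓ G N V row g i = winCount n q C ℓ G N V row' g i := by
  refine Finset.sum_congr rfl fun h hh => ?_
  have := Finset.mem_range.mp hh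
  simp only [rowBeats_congr hN hg (show h < G by omega) hrow]

/-- The number of candidates beaten by the candidate given in register `5` is put into
register `6`. -/
def winsCmd (q C ℓ : ℕ) : Cmd :=
  .seq (.assign 6 (.const 0))
    (.forLoop 7 (.reg 0)
      (.seq (.assign 20 (candRow 5))
        (.seq (.assign 21 (candRow 7))
          (.seq distCmd
            (.seq (.assign 8 (.bin .mul (.const C) (.reg 24)))
              (.seq (.assign 10 (candRow 5))
                (.seq (scoreCmd q ℓ)
                  (.seq (.assign 9 (.reg 12))
                    (.seq (.assign 10 (candRow 7))
                      (.seq (scoreCmd q ℓ)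
                        (.ite (.bin .lt (.reg 12) (.reg 9)) .skip
                          (.assign 6 (.bin .add (.reg 6) (.const 1))))))))))))))

theorem winsCmd_ends {q C ℓ g : ℕ} (hE : Fits E (N + G + 3) P) (hF : FitsPow n C ℓ V P)
    (hc : Ctx n G N V s) (hs : s.Bounded n (N + G + 3) P) (hN : N = q * G + V)
    (hg : s.reg 5 = g) (hgG : g < G) :
    Ends E (winsCmd q C ℓ) s fun s' => Agree 6 s s' ∧
      s'.reg 6 = winCount n q C ℓ G N V (s.cell n) g G := by
  have hW := hE.rows_le
  have hword := hE.word
  have hsq := hE.sq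
  have hbase := hF.base
  have hmul := hF.mul
  have hG : 1 ≤ G := by omega
  refine Ends.seq (Ends.assign (hE.const_ok (by omega)) ?_)
  refine (Ends.forLoop G (fun i s' => Agree 6 s s' ∧ s'.reg 7 = i ∧
    s'.reg 6 = winCount n q C ℓ G N V (s.cell n) g i) (by omega)
    ⟨((Agree.refl 6 s).setReg (by norm_num)).setReg (by norm_num), by simp,
      by simp [Expr.val, winCount]⟩ ?_ ?_).mono ?_
  · rintro i hi s' ⟨h1, h3, h4⟩
    have hc' : Ctx n G N V s' := hc.of_regEq h1.regEq (by norm_num)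
    exact ⟨h3, hE.reg_ok (by rw [hc'.r0]; omega), hc'.r0⟩
  · rintro i hi s₀ ⟨h1, h3, h4⟩
    have hc0 : Ctx n G N V s₀ := hc.of_regEq h1.regEq (by norm_num)
    have hr5 : s₀.reg 5 = g := by rw [h1.1 5 (by norm_num), hg]
    -- every state from now on agrees with `s₀` on the registers below `8`
    have hctx : ∀ t, Agree 8 s₀ t → Ctx n G N V t ∧ t.reg 5 = g ∧ t.reg 7 = i ∧
        t.Bounded n (N + G + 3) P ∧ t.cell n = s.cell n := fun t ht =>
      ⟨hc0.of_regEq ht.regEq (by norm_num), by rw [ht.1 5 (by norm_num), hr5],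
        by rw [ht.1 7 (by norm_num), h3], ht.bounded (h1.bounded hs),
        by funext r c; rw [ht.cell, h1.cell]⟩
    have hset : ∀ {t : State} {r x : ℕ}, Agree 8 s₀ t → 8 ≤ r → Agree 8 s₀ (t.setReg r x) :=
      fun ht hr => ht.setReg hr
    set D := labelDist n (s.cell n (N + g)) (s.cell n (N + i)) with hD
    have hDle : D ≤ n * n := labelDist_le _ _
    have hCD : C * D ≤ C * (n * n) := Nat.mul_le_mul_left C hDle
    have hCP : C ≤ P := hF.const
    have hscore : ∀ z, scoreSum n ℓ (C * D) V (s.cell n) (q * G) z ≤ P := fun z =>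
      (scoreSum_le _ _ _ _ _ _).trans (le_trans (Nat.mul_le_mul_left V
        (Nat.pow_le_pow_left hCD ℓ)) hmul)
    have a0 : Agree 8 s₀ s₀ := Agree.refl 8 s₀
    obtain ⟨c0, c5, c7, _, _⟩ := hctx _ a0
    refine Ends.seq (Ends.assign (candRow_ok hE c0 (by omega)) ?_)
    rw [candRow_val c0, c5]
    have a1 := hset (x := N + g) a0 (show 8 ≤ 20 by norm_num)
    obtain ⟨c0, c5, c7, _, _⟩ := hctx _ a1
    refine Ends.seq (Ends.assign (candRow_ok hE c0 (by omega)) ?_)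
    rw [candRow_val c0, c7]
    have a2 := hset (x := N + i) a1 (show 8 ≤ 21 by norm_num)
    obtain ⟨c0, c5, c7, cb, cc⟩ := hctx _ a2
    refine Ends.seq ((distCmd_ends hE (A := N + g) (B := N + i) c0.r2 cb (by simp) (by simp)
      (by omega) (by omega)).mono ?_)
    rintro s₁ ⟨d1, d2⟩
    rw [cc, ← hD] at d2
    have a3 : Agree 8 s₀ s₁ := a2.trans (d1.mono (by norm_num))
    refine Ends.seq (Ends.assign (hE.bin_ok (hE.const_ok hCP) (hE.reg_ok (by omega)) ?_) ?_)
    · simp only [Op.apply, Expr.val, d2]; omega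
    have hval8 : (Expr.bin .mul (.const C) (.reg 24)).val E s₁ = C * D := by
      simp only [Expr.val, Op.apply, d2]
    rw [hval8]
    have a4 := hset (x := C * D) a3 (show 8 ≤ 8 by norm_num)
    obtain ⟨c0, c5, c7, _, _⟩ := hctx _ a4
    refine Ends.seq (Ends.assign (candRow_ok hE c0 (by omega)) ?_)
    rw [candRow_val c0, c5]
    have a5 := hset (x := N + g) a4 (show 8 ≤ 10 by norm_num)
    obtain ⟨c0, c5, c7, cb, cc⟩ := hctx _ a5
    refine Ends.seq ((scoreCmd_ends (A := C * D) (R := N + g) hE hF c0 cb hN hG (by simp) hCD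
      (by simp) (by omega)).mono ?_)
    rintro s₂ ⟨e1, e2⟩
    rw [cc] at e2
    have a6 : Agree 8 s₀ s₂ := a5.trans (e1.mono (by norm_num))
    have hs28 : s₂.reg 8 = C * D := by rw [e1.1 8 (by norm_num)]; simp
    refine Ends.seq (Ends.assign (hE.reg_ok (by rw [e2]; exact hscore _)) ?_)
    simp only [Expr.val]
    rw [e2]
    set x := scoreSum n ℓ (C * D) V (s.cell n) (q * G) (s.cell n (N + g)) with hx
    have a7 := hset (x := x) a6 (show 8 ≤ 9 by norm_num)
    obtain ⟨c0, c5, c7, _, _⟩ := hctx _ a7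
    refine Ends.seq (Ends.assign (candRow_ok hE c0 (by omega)) ?_)
    rw [candRow_val c0, c7]
    have a8 := hset (x := N + i) a7 (show 8 ≤ 10 by norm_num)
    obtain ⟨c0, c5, c7, cb, cc⟩ := hctx _ a8
    refine Ends.seq ((scoreCmd_ends (A := C * D) (R := N + i) hE hF c0 cb hN hG
      (by simpa using hs28) hCD (by simp) (by omega)).mono ?_)
    rintro s₃ ⟨f1, f2⟩
    rw [cc] at f2
    have a9 : Agree 8 s₀ s₃ := a8.trans (f1.mono (by norm_num))
    have hs39 : s₃.reg 9 = x := by rw [f1.1 9 (by norm_num)]; simp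
    set y := scoreSum n ℓ (C * D) V (s.cell n) (q * G) (s.cell n (N + i)) with hy
    obtain ⟨c0, c5, c7, cb, cc⟩ := hctx _ a9
    have a9' : Agree 6 s s₃ := h1.trans (a9.mono (by norm_num))
    have hr6 : s₃.reg 6 = winCount n q C ℓ G N V (s.cell n) g i := by
      rw [a9.1 6 (by norm_num), h4]
    have hwle := winCount_le (n := n) (G := G) (N := N) (V := V) q C ℓ (s.cell n) g i
    have hsucc : winCount n q C ℓ G N V (s.cell n) g (i + 1) =
        s₃.reg 6 + if x ≤ y then 1 else 0 := by
      rw [hr6, winCount, Finset.sum_range_succ]; rfl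
    have hxP : x ≤ P := hscore _
    have hyP : y ≤ P := hscore _
    refine Ends.ite (hE.lt_ok (hE.reg_ok (by omega)) (hE.reg_ok (by omega))) ?_ ?_
    · intro h
      rw [val_lt_ne_zero] at h
      simp only [Expr.val, f2, hs39] at h
      refine Ends.skip ⟨c7, a9'.setReg (by norm_num), by simp, ?_⟩
      rw [hsucc, if_neg (by omega)]
      simp
    · intro h
      rw [val_lt_eq_zero] at h
      simp only [Expr.val, f2, hs39] at h
      refine Ends.assign (hE.bin_ok (hE.reg_ok (by omega)) (hE.const_ok (by omega)) ?_)
        ⟨by simpa using c7, (a9'.setReg (by norm_num)).setReg (by norm_num), by simp, ?_⟩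
      · simp only [Op.apply, Expr.val]; omega
      · rw [hsucc, if_pos h]
        simp [Expr.val, Op.apply]
  · rintro s' ⟨h1, _, h4⟩
    exact ⟨h1, h4⟩

/-- The candidate with the largest number of wins is put into row `N + G + 2`. -/
def tournamentCmd (q C ℓ : ℕ) : Cmd :=
  .seq (.assign 4 (.const 0))
    (.forLoop 5 (.reg 0)
      (.seq (winsCmd q C ℓ)
        (.ite (.bin .lt (.reg 4) (.reg 6))
          (.seq (.assign 4 (.reg 6))
            (.seq (.assign 20 (candRow 5)) (.seq (.assign 21 (specialRow 2)) copyCmd)))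
          .skip)))

theorem tournamentCmd_ends {q C ℓ : ℕ} (hE : Fits E (N + G + 3) P) (hF : FitsPow n C ℓ V P)
    (hc : Ctx n G N V s) (hs : s.Bounded n (N + G + 3) P) (hN : N = q * G + V) (hG : 1 ≤ G) :
    Ends E (tournamentCmd q C ℓ) s fun s' => RegEq 4 s s' ∧ s'.Bounded n (N + G + 3) P ∧
      (∀ r, ∀ c ≤ n, r ≠ N + G + 2 → s'.cell n r c = s.cell n r c) ∧
      ∃ b < G, (∀ u < n, s'.cell n (N + G + 2) u = s.cell n (N + b) u) ∧
        ∀ g < G, winCount n q C ℓ G N V (s.cell n) g G ≤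
          winCount n q C ℓ G N V (s.cell n) b G := by
  have hW := hE.rows_le
  have hword := hE.word
  refine Ends.seq (Ends.assign (hE.const_ok (by omega)) ?_)
  refine (Ends.forLoop G (fun i s' => RegEq 4 s s' ∧ s'.reg 5 = i ∧
    s'.Bounded n (N + G + 3) P ∧ s'.reg 4 ≤ G ∧
    (∀ r, ∀ c ≤ n, r ≠ N + G + 2 → s'.cell n r c = s.cell n r c) ∧
    (i = 0 → s'.reg 4 = 0) ∧
    (0 < i → ∃ b < G, (∀ u < n, s'.cell n (N + G + 2) u = s.cell n (N + b) u) ∧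
      s'.reg 4 = winCount n q C ℓ G N V (s.cell n) b G) ∧
    ∀ g < i, winCount n q C ℓ G N V (s.cell n) g G ≤ s'.reg 4) (by omega)
    ⟨((RegEq.refl 4 s).setReg (by norm_num)).setReg (by norm_num), by simp, hs,
      by simp [Expr.val], fun r c _ _ => rfl, by simp [Expr.val], by omega, by omega⟩ ?_ ?_).mono ?_
  · rintro i hi s' ⟨h1, h3, _⟩
    have hc' : Ctx n G N V s' := hc.of_regEq h1 le_rfl
    exact ⟨h3, hE.reg_ok (by rw [hc'.r0]; omega), hc'.r0⟩
  · rintro i hi s₀ ⟨h1, h3, h4, h5, h6, h7, h8, h9⟩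
    have hc0 : Ctx n G N V s₀ := hc.of_regEq h1 le_rfl
    refine Ends.seq ((winsCmd_ends hE hF hc0 h4 hN h3 hi).mono ?_)
    rintro s₁ ⟨d1, d2⟩
    rw [winCount_congr hN hi le_rfl (fun r hr u hu => h6 r u (by omega) (by omega))] at d2
    set w := winCount n q C ℓ G N V (s.cell n) i G with hw
    have hwG : w ≤ G := winCount_le _ _ _ _ _ _
    have hw0 : 0 < w := winCount_pos _ _ _ _ hi
    have hc1 : Ctx n G N V s₁ := hc0.of_regEq d1.regEq (by norm_num)
    have hr4 : s₁.reg 4 = s₀.reg 4 := d1.1 4 (by norm_num)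
    have hr5 : s₁.reg 5 = i := by rw [d1.1 5 (by norm_num), h3]
    have hcell : s₁.cell n = s₀.cell n := by funext r c; exact d1.cell r c
    refine Ends.ite (hE.lt_ok (hE.reg_ok (by omega)) (hE.reg_ok (by omega))) ?_ ?_
    · intro h
      rw [val_lt_ne_zero] at h
      simp only [Expr.val, d2, hr4] at h
      refine Ends.seq (Ends.assign (hE.reg_ok (by omega)) ?_)
      simp only [Expr.val, d2]
      have hcA : Ctx n G N V (s₁.setReg 4 w) :=
        hc1.of_regEq ((RegEq.refl 4 s₁).setReg le_rfl) le_rfl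
      have hr5A : (s₁.setReg 4 w).reg 5 = i := by simpa using hr5
      refine Ends.seq (Ends.assign (candRow_ok hE hcA (by omega)) ?_)
      rw [candRow_val hcA, hr5A]
      have hcB : Ctx n G N V ((s₁.setReg 4 w).setReg 20 (N + i)) :=
        hcA.of_regEq ((RegEq.refl 4 _).setReg (by norm_num)) le_rfl
      refine Ends.seq (Ends.assign (specialRow_ok hE hcB le_rfl) ?_)
      rw [specialRow_val hcB]
      refine (copyCmd_ends hE (A := N + i) (B := N + G + 2) (by simpa using hc1.r2)
        (fun j hj => by simpa using d1.bounded h4 j hj) (by simp) (by simp) (by omega) (by omega)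
        (by omega)).mono ?_
      rintro s₂ ⟨e1, e2, e3⟩
      simp only [State.setReg_cell, hcell] at e3
      have hr24 : s₂.reg 4 = w := by rw [e1 4 (by norm_num)]; simp
      refine ⟨?_, ?_, by simp, e2, by simpa [hr24] using hwG, ?_, by omega, ?_, ?_⟩
      · rw [e1 5 (by norm_num)]; simpa using hr5
      · refine RegEq.setReg (fun r hr => ?_) (by norm_num)
        rw [e1 r (by omega), State.setReg_reg, if_neg (by omega), State.setReg_reg,
          if_neg (by omega), State.setReg_reg, if_neg (by omega), d1.1 r (by omega), h1 r hr]
      · intro r c hcn hr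
        rw [State.setReg_cell, e3 r c hcn, if_neg (fun h => hr h.1), h6 r c hcn hr]
      · intro _
        refine ⟨i, hi, fun u hu => ?_, by simpa using hr24⟩
        rw [State.setReg_cell, e3 _ u (by omega), if_pos ⟨rfl, hu⟩, h6 _ u (by omega) (by omega)]
      · intro g hg
        have hr : (s₂.setReg 5 (i + 1)).reg 4 = w := by simpa using hr24
        rw [hr]
        rcases Nat.lt_succ_iff_lt_or_eq.mp hg with hg' | rfl
        · exact (h9 g hg').trans h.le
        · exact le_rfl
    · intro h
      rw [val_lt_eq_zero] at h
      simp only [Expr.val, d2, hr4] at h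
      have hi0 : 0 < i := by
        rcases Nat.eq_zero_or_pos i with h0 | h0
        · have := h7 h0; omega
        · exact h0
      obtain ⟨b, hb, hb1, hb2⟩ := h8 hi0
      refine Ends.skip ⟨hr5, (h1.trans (d1.regEq.mono (by norm_num))).setReg (by norm_num), by simp,
        d1.bounded h4, by simpa [hr4] using h5, ?_, by omega, ?_, ?_⟩
      · intro r c hcn hr
        rw [State.setReg_cell, hcell, h6 r c hcn hr]
      · intro _
        refine ⟨b, hb, fun u hu => ?_, ?_⟩
        · rw [State.setReg_cell, hcell, hb1 u hu]
        · rw [State.setReg_reg, if_neg (by norm_num), hr4, hb2]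
      · intro g hg
        rw [State.setReg_reg, if_neg (by norm_num), hr4]
        rcases Nat.lt_succ_iff_lt_or_eq.mp hg with hg' | rfl
        · exact h9 g hg'
        · exact h
  · rintro s' ⟨h1, _, h4, _, h6, _, h8, h9⟩
    obtain ⟨b, hb, hb1, hb2⟩ := h8 (by omega)
    exact ⟨h1, h4, h6, b, hb, hb1, fun g hg => by rw [← hb2]; exact h9 g hg⟩

end Tournament

/-! ### Initialisation, stream processing and output -/

section Streaming

variable {n : ℕ} {E : Env n} {P : ℕ} {s : State} {Q : State → Prop} {G N V : ℕ}

/-- The logarithm of the number of clusterings is put into register `10`. -/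
def logCmd : Cmd :=
  .seq (.assign 10 (.const 0)) (.seq (.assign 11 (.const 1))
    (.loop (.bin .lt (.reg 11) .numClusterings)
      (.seq (.assign 11 (.bin .mul (.reg 11) (.const 2)))
        (.assign 10 (.bin .add (.reg 10) (.const 1))))))

theorem logCmd_ends {W : ℕ} (hE : Fits E W P) (hm : 2 ≤ E.m) (hP : 2 * E.m ≤ P) :
    Ends E logCmd s fun s' => s'.reg 10 = Nat.clog 2 E.m ∧ s'.mem = s.mem ∧
      s'.coins = s.coins := by
  have hword := hE.word
  refine Ends.seq (Ends.assign (hE.const_ok (by omega)) ?_)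
  refine Ends.seq (Ends.assign (hE.const_ok (by omega)) ?_)
  refine (Ends.loop (Nat.clog 2 E.m) (fun i s' => s'.reg 10 = i ∧ s'.reg 11 = 2 ^ i ∧
    s'.mem = s.mem ∧ s'.coins = s.coins) ?_ ?_ ?_).mono ?_
  · rintro i hi s' ⟨h1, h2, h3, h4⟩
    have hlt : 2 ^ i < E.m := Nat.pow_lt_of_lt_clog hi
    have hi2 : i < 2 ^ i := Nat.lt_two_pow_self
    have hok : (Expr.reg 11).Ok E s' := hE.reg_ok (by omega)
    refine ⟨hE.lt_ok hok (by simp only [Expr.Ok]; omega), ?_, ?_⟩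
    · rw [val_lt_ne_zero]
      simp only [Expr.val]; omega
    · refine Ends.seq (Ends.assign (hE.bin_ok hok (hE.const_ok (by omega)) ?_) ?_)
      · simp only [Op.apply, Expr.val]; omega
      · refine Ends.assign (hE.bin_ok (hE.reg_ok ?_) (hE.const_ok (by omega)) ?_) ?_
        · simp [h1]; omega
        · simp [Op.apply, Expr.val, h1]; omega
        · refine ⟨by simp [Expr.val, Op.apply, h1], ?_, h3, h4⟩
          simp [Expr.val, Op.apply, h2, pow_succ]
  · rintro s' ⟨h1, h2, h3, h4⟩
    have hle := Nat.le_pow_clog (b := 2) (by norm_num) E.m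
    have hlt : 2 ^ (Nat.clog 2 E.m - 1) < E.m := Nat.pow_pred_clog_lt_self (by norm_num) (by omega)
    have hpos : 0 < Nat.clog 2 E.m := Nat.clog_pos (by norm_num) (by omega)
    have hp : 2 ^ Nat.clog 2 E.m = 2 ^ (Nat.clog 2 E.m - 1) * 2 := by
      rw [← pow_succ, Nat.sub_add_cancel hpos]
    refine ⟨hE.lt_ok (hE.reg_ok (by omega)) (by simp only [Expr.Ok]; omega), ?_⟩
    rw [val_lt_eq_zero]
    simp only [Expr.val]; omega
  · exact ⟨by simp [Expr.val], by simp [Expr.val], rfl, rfl⟩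
  · rintro s' ⟨h1, _, h3, h4⟩
    exact ⟨h1, h3, h4⟩

/-- Initialisation: the parameters are computed, and all random indices are drawn. -/
def initCmd (a b q : ℕ) : Cmd :=
  .seq logCmd
    (.seq (.assign 0 (.bin .mul (.const a) (.reg 10)))
      (.seq (.assign 3 (.bin .mul (.const b) (.reg 10)))
        (.seq (.assign 1 (.bin .add (.bin .mul (.const q) (.reg 0)) (.reg 3)))
          (.seq (.assign 2 (.bin .add .numVertices (.const 1)))
            (.forLoop 4 (.reg 1)
              (.seq (.sample 5)
                (.seq (.store (addrOf (.reg 4) .numVertices) (.reg 5))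
                  (.forLoop 6 .numVertices (.store (addrOf (.reg 4) (.reg 6)) (.reg 6))))))))))

/-- All random indices are drawn before the stream, so the result is a function of the coins. Column
`n` of a sample row stores the index drawn, and the labels start with every vertex alone. -/
theorem initCmd_ends {a b q : ℕ} (hG : G = a * Nat.clog 2 E.m) (hV : V = b * Nat.clog 2 E.m)
    (hN : N = q * G + V) (hE : Fits E (N + G + 3) P) (hm : 2 ≤ E.m) (hmP : 2 * E.m ≤ P)
    (ha : a ≤ P) (hb : b ≤ P) (hq : q ≤ P) (hs : s.Bounded n (N + G + 3) P)
    (hl : s.coins.length = N) (hlm : ∀ x ∈ s.coins, x ≤ P) :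
    Ends E (initCmd a b q) s fun s' => Ctx n G N V s' ∧ s'.Bounded n (N + G + 3) P ∧
      ∀ r < N, s'.cell n r n = s.coins.getD r 0 ∧ ∀ u < n, s'.cell n r u = u := by
  have hW := hE.rows_le
  have hword := hE.word
  have hone := hE.one
  have hclog : Nat.clog 2 E.m ≤ P := by
    have : Nat.clog 2 E.m ≤ E.m := Nat.clog_le_of_le_pow Nat.lt_two_pow_self.le
    omega
  refine Ends.seq ((logCmd_ends hE hm hmP).mono ?_)
  rintro s₁ ⟨h1, h2, h3⟩
  refine Ends.seq (Ends.assign (hE.bin_ok (hE.const_ok ha) (hE.reg_ok (by omega)) ?_) ?_)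
  · simp only [Op.apply, Expr.val, h1, ← hG]; omega
  have hv0 : (Expr.bin .mul (.const a) (.reg 10)).val E s₁ = G := by
    simp only [Expr.val, Op.apply, h1, hG]
  rw [hv0]
  refine Ends.seq (Ends.assign (hE.bin_ok (hE.const_ok hb) (hE.reg_ok ?_) ?_) ?_)
  · simp [h1, hclog]
  · have : (Op.mul).apply ((Expr.const b).val E (s₁.setReg 0 G))
        ((Expr.reg 10).val E (s₁.setReg 0 G)) = V := by simp [Expr.val, Op.apply, h1, hV]
    rw [this]; omega
  have hv3 : (Expr.bin .mul (.const b) (.reg 10)).val E (s₁.setReg 0 G) = V := by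
    simp [Expr.val, Op.apply, h1, hV]
  rw [hv3]
  set s₂ := (s₁.setReg 0 G).setReg 3 V with hs2
  have hv1 : (Expr.bin .add (.bin .mul (.const q) (.reg 0)) (.reg 3)).val E s₂ = N := by
    simp [Expr.val, Op.apply, hs2, hN]
  refine Ends.seq (Ends.assign (hE.bin_ok (hE.bin_ok (hE.const_ok hq) (hE.reg_ok ?_) ?_)
    (hE.reg_ok ?_) (hv1.le.trans (by omega))) ?_)
  · simp [hs2]; omega
  · simp [hs2, Op.apply, Expr.val]; omega
  · simp [hs2]; omega
  rw [hv1]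
  refine Ends.seq (Ends.assign (hE.bin_ok hE.numVertices_ok (hE.const_ok (by omega)) ?_) ?_)
  · simp only [Op.apply, Expr.val]; omega
  have hv2 : (Expr.bin .add .numVertices (.const 1)).val E (s₂.setReg 1 N) = n + 1 := rfl
  rw [hv2]
  set s₃ := (s₂.setReg 1 N).setReg 2 (n + 1) with hs3
  have hc3 : Ctx n G N V s₃ := ⟨by simp [hs3, hs2], by simp [hs3], by simp [hs3],
    by simp [hs3, hs2]⟩
  have hb3 : s₃.Bounded n (N + G + 3) P := fun j hj => by
    rw [hs3, hs2]
    simp only [State.setReg_mem, h2]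
    exact hs j hj
  refine (Ends.forLoop N (fun i s' => RegEq 4 s₃ s' ∧ s'.reg 4 = i ∧
    s'.Bounded n (N + G + 3) P ∧ s'.coins = s.coins.drop i ∧
    ∀ r < i, s'.cell n r n = s.coins.getD r 0 ∧ ∀ u < n, s'.cell n r u = u) (by omega)
    ⟨(RegEq.refl 4 s₃).setReg le_rfl, by simp, hb3, by simp [hs3, hs2, h3], by omega⟩ ?_ ?_).mono ?_
  · rintro i hi s' ⟨h5, h6, _⟩
    have hc' := hc3.of_regEq h5 le_rfl
    exact ⟨h6, hE.reg_ok (by rw [hc'.r1]; omega), hc'.r1⟩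
  · rintro i hi t ⟨h5, h6, h7, h8, h9⟩
    have hil : i < s.coins.length := by omega
    have hcoin : t.coins = s.coins[i] :: s.coins.drop (i + 1) := by
      rw [h8, List.drop_eq_getElem_cons hil]
    have hx : s.coins[i] ≤ P := hlm _ (List.getElem_mem hil)
    have hgetD : s.coins.getD i 0 = s.coins[i] := by simp [hil]
    refine Ends.seq (Ends.sample hcoin ?_)
    set t₁ : State := { t.setReg 5 s.coins[i] with coins := s.coins.drop (i + 1) } with ht1
    have hreg1 : RegEq 5 t t₁ := (RegEq.refl 5 t).setReg le_rfl
    have hc1 : Ctx n G N V t₁ := (hc3.of_regEq h5 le_rfl).of_regEq hreg1 (by norm_num)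
    have hr4 : t₁.reg 4 = i := (hreg1 4 (by norm_num)).trans h6
    have hr5 : t₁.reg 5 = s.coins[i] := by simp [ht1, State.setReg]
    have hb1 : t₁.Bounded n (N + G + 3) P := h7
    refine Ends.seq (Ends.storeCell hE hc1.r2 (hE.reg_ok (by omega)) hE.numVertices_ok
      (by simp only [Expr.val]; omega) le_rfl (hE.reg_ok (by omega)) ?_)
    simp only [Expr.val, hr4, hr5]
    set t₂ := t₁.setMem (i * (n + 1) + n) s.coins[i] with ht2
    have hc2 : Ctx n G N V t₂ := hc1.of_regEq (RegEq.refl 4 t₁) le_rfl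
    refine (Ends.forLoop n (fun j t' => RegEq 5 t₂ t' ∧ t'.reg 6 = j ∧
      t'.Bounded n (N + G + 3) P ∧ t'.coins = t₂.coins ∧ (∀ u < j, t'.cell n i u = u) ∧
      ∀ r, ∀ c ≤ n, r ≠ i ∨ c = n → t'.cell n r c = t₂.cell n r c) (by omega)
      ⟨(RegEq.refl 5 t₂).setReg (by norm_num), by simp, hb1.setMem hx, rfl, by omega,
        fun r c _ _ => rfl⟩ ?_ ?_).mono ?_
    · rintro j hj t' ⟨_, k2, _⟩
      exact ⟨k2, hE.numVertices_ok, rfl⟩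
    · rintro j hj t' ⟨k1, k2, k3, k4, k5, k6⟩
      have hc' : Ctx n G N V t' := hc2.of_regEq k1 (by norm_num)
      have hr4' : t'.reg 4 = i := (k1 4 (by norm_num)).trans hr4
      refine Ends.storeCell hE hc'.r2 (hE.reg_ok (by omega)) (hE.reg_ok (by omega))
        (by simp only [Expr.val]; omega) (by simp only [Expr.val]; omega) (hE.reg_ok (by omega)) ?_
      simp only [Expr.val, hr4', k2]
      refine ⟨by simpa using k2, (k1.setMem).setReg (by norm_num), by simp, k3.setMem (by omega),
        k4, ?_, ?_⟩
      · intro u hu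
        rw [State.setReg_cell, State.setMem_cell _ (by omega) (by omega)]
        by_cases huj : u = j
        · simp [huj]
        · rw [if_neg (by omega)]; exact k5 u (by omega)
      · intro r c hcn hr
        rw [State.setReg_cell, State.setMem_cell _ (by omega) hcn, if_neg (by omega)]
        exact k6 r c hcn hr
    · rintro t₃ ⟨k1, k2, k3, k4, k5, k6⟩
      refine ⟨(k1 4 (by norm_num)).trans hr4, ?_, by simp, k3, k4, ?_⟩
      · refine RegEq.setReg (fun r hr => ?_) le_rfl
        rw [k1 r (by omega)]
        exact (hreg1 r (by omega)).trans (h5 r hr)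
      · intro r hr
        have hcell2 : ∀ r' c, c ≤ n → t₂.cell n r' c =
            if r' = i ∧ c = n then s.coins[i] else t.cell n r' c := fun r' c hcn =>
          State.setMem_cell t₁ le_rfl hcn
        simp only [State.setReg_cell]
        rcases Nat.lt_succ_iff_lt_or_eq.mp hr with hr' | rfl
        · refine ⟨?_, fun u hu => ?_⟩
          · rw [k6 r n le_rfl (Or.inr rfl), hcell2 r n le_rfl, if_neg (by omega)]
            exact (h9 r hr').1
          · rw [k6 r u (by omega) (Or.inl (by omega)), hcell2 r u (by omega), if_neg (by omega)]
            exact (h9 r hr').2 u hu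
        · refine ⟨?_, k5⟩
          rw [k6 r n le_rfl (Or.inr rfl), hcell2 r n le_rfl, if_pos ⟨rfl, rfl⟩, hgetD]
  · rintro s' ⟨h5, _, h7, _, h9⟩
    exact ⟨hc3.of_regEq h5 le_rfl, h7, h9⟩

/-- The stored labels are updated with the present stream element. -/
def recordCmd : Cmd :=
  .ite (.item 3) .skip
    (.seq (.ite (.bin .lt (.item 0) (.item 1))
        (.seq (.assign 4 (.item 0)) (.assign 5 (.item 1)))
        (.seq (.assign 4 (.item 1)) (.assign 5 (.item 0))))
      (.forLoop 6 (.reg 1)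
        (.ite (.bin .eq (cellAt (.reg 6) .numVertices) (.item 2))
          (.ite (.bin .lt (.reg 4) (cellAt (.reg 6) (.reg 5)))
            (.store (addrOf (.reg 6) (.reg 5)) (.reg 4)) .skip)
          .skip)))

/-- The stored labels after a stream element `(u, v, j, b)`. -/
def recorded (n : ℕ) (row : ℕ → ℕ → ℕ) (x : Fin 4 → ℕ) (r c : ℕ) : ℕ :=
  if x 3 = 0 ∧ row r n = x 2 ∧ c = max (x 0) (x 1) then min (row r c) (min (x 0) (x 1))
  else row r c

theorem recordCmd_ends (hE : Fits E (N + G + 3) P) (hc : Ctx n G N V s)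
    (hs : s.Bounded n (N + G + 3) P) (hu : s.item 0 < n) (hv : s.item 1 < n)
    (hj : s.item 2 ≤ P) (hb : s.item 3 ≤ P) :
    Ends E recordCmd s fun s' => RegEq 4 s s' ∧ s'.Bounded n (N + G + 3) P ∧
      ∀ r < N, ∀ c ≤ n, s'.cell n r c = recorded n (s.cell n) s.item r c := by
  have hW := hE.rows_le
  have hword := hE.word
  have hone := hE.one
  have hitem : ∀ {t : State} {i : Fin 4}, t.item i ≤ P → (Expr.item i).Ok E t := fun h => by
    simp only [Expr.Ok]; omega
  refine Ends.ite (hitem hb) ?_ ?_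
  · intro h
    refine Ends.skip ⟨RegEq.refl 4 s, hs, fun r _ c _ => ?_⟩
    rw [recorded, if_neg (fun h' => h h'.1)]
  · intro h
    simp only [Expr.val] at h
    refine Ends.seq (Ends.mono (R := fun t => Agree 4 s t ∧ t.item = s.item ∧
      t.reg 4 = min (s.item 0) (s.item 1) ∧ t.reg 5 = max (s.item 0) (s.item 1)) ?_ ?_)
    · refine Ends.ite (hE.lt_ok (hitem (by omega)) (hitem (by omega))) ?_ ?_
      · intro h1
        rw [val_lt_ne_zero] at h1
        simp only [Expr.val] at h1
        refine Ends.seq (Ends.assign (hitem (by omega)) (Ends.assign (hitem (by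
          simp only [State.setReg_item]; omega)) ⟨((Agree.refl 4 s).setReg le_rfl).setReg
          (by norm_num), rfl, ?_, ?_⟩))
        · simp [Expr.val, h1.le]
        · simp [Expr.val, h1.le]
      · intro h1
        rw [val_lt_eq_zero] at h1
        simp only [Expr.val] at h1
        refine Ends.seq (Ends.assign (hitem (by omega)) (Ends.assign (hitem (by
          simp only [State.setReg_item]; omega)) ⟨((Agree.refl 4 s).setReg le_rfl).setReg
          (by norm_num), rfl, ?_, ?_⟩))
        · simp [Expr.val, h1]
        · simp [Expr.val, h1]
    · rintro t ⟨a1, a2, a3, a4⟩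
      set lo := min (s.item 0) (s.item 1) with hlo
      set hi := max (s.item 0) (s.item 1) with hhi
      have hlon : lo < n := lt_of_le_of_lt (min_le_left _ _) hu
      have hhin : hi < n := max_lt hu hv
      refine (Ends.forLoop N (fun i t' => RegEq 6 t t' ∧ t'.reg 6 = i ∧
        t'.Bounded n (N + G + 3) P ∧ t'.item = s.item ∧
        ∀ r, ∀ c ≤ n, t'.cell n r c = if r < i then recorded n (s.cell n) s.item r c
          else s.cell n r c) (by omega)
        ⟨(RegEq.refl 6 t).setReg le_rfl, by simp, a1.bounded hs, a2,
          fun r c _ => by simpa using a1.cell r c⟩ ?_ ?_).mono ?_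
      · rintro i hi' t' ⟨b1, b2, _⟩
        have hc' : Ctx n G N V t' :=
          (hc.of_regEq a1.regEq le_rfl).of_regEq b1 (by norm_num)
        exact ⟨b2, hE.reg_ok (by rw [hc'.r1]; omega), hc'.r1⟩
      · rintro i hi' t' ⟨b1, b2, b3, b4, b5⟩
        have hc' : Ctx n G N V t' :=
          (hc.of_regEq a1.regEq le_rfl).of_regEq b1 (by norm_num)
        have hr4 : t'.reg 4 = lo := (b1 4 (by norm_num)).trans a3
        have hr5 : t'.reg 5 = hi := (b1 5 (by norm_num)).trans a4
        have h6ok : (Expr.reg 6).Ok E t' := hE.reg_ok (by omega)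
        have h5ok : (Expr.reg 5).Ok E t' := hE.reg_ok (by omega)
        have h4ok : (Expr.reg 4).Ok E t' := hE.reg_ok (by omega)
        have h6W : (Expr.reg 6).val E t' < N + G + 3 := by simp only [Expr.val]; omega
        have h5n : (Expr.reg 5).val E t' ≤ n := by simp only [Expr.val]; omega
        have hcell : ∀ c ≤ n, t'.cell n i c = s.cell n i c := fun c hcn => by
          rw [b5 i c hcn, if_neg (lt_irrefl i)]
        have hskip : (∀ c ≤ n, recorded n (s.cell n) s.item i c = s.cell n i c) →
            t'.reg 6 = i ∧ (RegEq 6 t (t'.setReg 6 (i + 1)) ∧ (t'.setReg 6 (i + 1)).reg 6 = i + 1 ∧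
            (t'.setReg 6 (i + 1)).Bounded n (N + G + 3) P ∧ (t'.setReg 6 (i + 1)).item = s.item ∧
            ∀ r, ∀ c ≤ n, (t'.setReg 6 (i + 1)).cell n r c =
              if r < i + 1 then recorded n (s.cell n) s.item r c else s.cell n r c) := by
          intro hrec
          refine ⟨b2, b1.setReg le_rfl, by simp, b3, b4, fun r c hcn => ?_⟩
          rw [State.setReg_cell, b5 r c hcn]
          by_cases hri : r = i
          · subst hri
            rw [if_neg (lt_irrefl r), if_pos (Nat.lt_succ_self r), hrec c hcn]
          · by_cases hlt : r < i
            · rw [if_pos hlt, if_pos (by omega)]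
            · rw [if_neg hlt, if_neg (by omega)]
        refine Ends.ite (hE.eq_ok (cellAt_ok hE hc'.r2 b3 h6ok hE.numVertices_ok h6W le_rfl)
          (hitem (by rw [b4]; exact hj))) ?_ ?_
        · intro h1
          rw [val_eq_ne_zero, cellAt_val hc'.r2] at h1
          simp only [Expr.val, b2, b4, hcell n le_rfl] at h1
          refine Ends.ite (hE.lt_ok h4ok (cellAt_ok hE hc'.r2 b3 h6ok h5ok h6W h5n)) ?_ ?_
          · intro h2
            rw [val_lt_ne_zero, cellAt_val hc'.r2] at h2
            simp only [Expr.val, b2, hr4, hr5, hcell hi hhin.le] at h2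
            refine Ends.storeCell hE hc'.r2 h6ok h5ok h6W h5n h4ok ?_
            simp only [Expr.val, b2, hr4, hr5]
            refine ⟨by simpa using b2, (b1.setMem).setReg le_rfl, by simp, b3.setMem (by omega),
              b4, fun r c hcn => ?_⟩
            rw [State.setReg_cell, State.setMem_cell _ hhin.le hcn, b5 r c hcn]
            by_cases hri : r = i
            · subst hri
              rw [if_pos (Nat.lt_succ_self r), if_neg (lt_irrefl r), recorded, ← hhi, ← hlo]
              by_cases hch : c = hi
              · rw [if_pos ⟨rfl, hch⟩, if_pos ⟨h, h1, hch⟩, hch, min_eq_right h2.le]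
              · rw [if_neg (fun h' => hch h'.2), if_neg (fun h' => hch h'.2.2)]
            · rw [if_neg (fun h' => hri h'.1)]
              by_cases hlt : r < i
              · rw [if_pos hlt, if_pos (by omega)]
              · rw [if_neg hlt, if_neg (by omega)]
          · intro h2
            rw [val_lt_eq_zero, cellAt_val hc'.r2] at h2
            simp only [Expr.val, b2, hr4, hr5, hcell hi hhin.le] at h2
            refine Ends.skip (hskip fun c hcn => ?_)
            rw [recorded, ← hhi, ← hlo]
            split_ifs with h3
            · rw [h3.2.2, min_eq_left h2]
            · rfl
        · intro h1
          rw [val_eq_eq_zero, cellAt_val hc'.r2] at h1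
          simp only [Expr.val, b2, b4, hcell n le_rfl] at h1
          refine Ends.skip (hskip fun c hcn => ?_)
          rw [recorded, if_neg (fun h' => h1 h'.2.1)]
      · rintro t' ⟨b1, _, b3, _, b5⟩
        refine ⟨fun r hr => (b1 r (by omega)).trans (a1.1 r hr), b3, fun r hr c hcn => ?_⟩
        rw [b5 r c hcn, if_pos hr]

/-- The rows of the samples, followed by the candidates found by an exhaustive search. -/
def fullRow (E : Env n) (q N : ℕ) (row : ℕ → ℕ → ℕ) (r : ℕ) : ℕ → ℕ :=
  if r < N then row r else oracleRow E (candIndex E q row (r - N) (n ^ n)).2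

theorem candIndex_congr {q g κ : ℕ} {row row' : ℕ → ℕ → ℕ} (hq : q * G ≤ N) (hgG : g < G)
    (h : ∀ r < N, ∀ u < n, row r u = row' r u) :
    candIndex E q row g κ = candIndex E q row' g κ := by
  unfold candIndex
  congr 1
  funext κ
  exact groupVal_congr hq hgG h fun _ _ => rfl

/-- Row `N + G + 2` holds a candidate with the largest number of wins. -/
def HoldsWinner (E : Env n) (q C ℓ G N V : ℕ) (row : ℕ → ℕ → ℕ) : Prop :=
  ∃ b < G, (∀ u < n, row (N + G + 2) u = fullRow E q N row (N + b) u) ∧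
    ∀ g < G, winCount n q C ℓ G N V (fullRow E q N row) g G ≤
      winCount n q C ℓ G N V (fullRow E q N row) b G

/-- The program that processes one stream element. -/
def updateCmd (q C ℓ : ℕ) : Cmd :=
  .seq recordCmd (.seq (searchCmd q) (tournamentCmd q C ℓ))

/-- `HoldsWinner` rebuilds the candidates from the sample rows through `fullRow`. The result thus
concerns the final memory only and does not depend on earlier rounds. -/
theorem updateCmd_ends {q C ℓ : ℕ} (hE : Fits E (N + G + 3) P) (hF : FitsPow n C ℓ V P)
    (hc : Ctx n G N V s) (hs : s.Bounded n (N + G + 3) P) (hn : 1 ≤ n) (hsq : n * n + 1 ≤ P)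
    (hN : N = q * G + V) (hG : 1 ≤ G) (hu : s.item 0 < n) (hv : s.item 1 < n)
    (hj : s.item 2 ≤ P) (hb : s.item 3 ≤ P) :
    Ends E (updateCmd q C ℓ) s fun s' => Ctx n G N V s' ∧ s'.Bounded n (N + G + 3) P ∧
      (∀ r < N, ∀ c ≤ n, s'.cell n r c = recorded n (s.cell n) s.item r c) ∧
      HoldsWinner E q C ℓ G N V (s'.cell n) := by
  have hq : q * G ≤ N := by omega
  refine Ends.seq ((recordCmd_ends hE hc hs hu hv hj hb).mono ?_)
  rintro s₁ ⟨a1, a2, a3⟩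
  have hc1 : Ctx n G N V s₁ := hc.of_regEq a1 le_rfl
  refine Ends.seq ((searchCmd_ends hE hc1 hn hsq a2 hq).mono ?_)
  rintro s₂ ⟨b1, b2, b3, b4⟩
  have hc2 : Ctx n G N V s₂ := hc1.of_regEq b1 le_rfl
  refine (tournamentCmd_ends hE hF hc2 b2 hN hG).mono ?_
  rintro s₃ ⟨c1, c2, c3, b, hbG, c4, c5⟩
  have h13 : ∀ r < N, ∀ u < n, s₁.cell n r u = s₃.cell n r u := fun r hr u hu => by
    rw [c3 r u (by omega) (by omega), b4 r hr u (by omega)]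
  have hcand : ∀ g < G, ∀ u < n, s₂.cell n (N + g) u =
      fullRow E q N (s₃.cell n) (N + g) u := fun g hg u hu => by
    rw [b3 g hg u hu, fullRow, if_neg (by omega), Nat.add_sub_cancel_left,
      candIndex_congr hq hg h13]
  have hrows : ∀ r < N + G, ∀ u < n, s₂.cell n r u = fullRow E q N (s₃.cell n) r u := by
    intro r hr u hu
    by_cases hrN : r < N
    · rw [fullRow, if_pos hrN, c3 r u (by omega) (by omega)]
    · have := hcand (r - N) (by omega) u hu
      rwa [Nat.add_sub_cancel' (by omega)] at this
  refine ⟨hc2.of_regEq c1 le_rfl, c2, ?_, b, hbG, ?_, ?_⟩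
  · intro r hr c hcn
    rw [c3 r c hcn (by omega), b4 r hr c hcn, a3 r hr c hcn]
  · intro u hu
    rw [c4 u hu, hcand b hbG u hu]
  · intro g hg
    rw [← winCount_congr hN hg le_rfl hrows, ← winCount_congr hN hbG le_rfl hrows]
    exact c5 g hg

/-- The stored labels after the part `L` of the stream: every label is a vertex of the same cluster,
and it is not larger than any vertex that was presented as being in the same cluster. -/
structure LabelInv {m : ℕ} (C : Fin m → Clustering n) (idx : Fin N → Fin m) (L : List (Item n m))
    (row : ℕ → ℕ → ℕ) : Prop where
  index : ∀ r : Fin N, row r n = idx r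
  lt : ∀ (r : Fin N) (w : Fin n), row r w < n
  le : ∀ (r : Fin N) (w : Fin n), row r w ≤ w
  rel : ∀ (r : Fin N) (w : Fin n), (C (idx r)).r ⟨row r w, lt r w⟩ w
  seen : ∀ (r : Fin N), ∀ x ∈ L, x.j = idx r → x.b = 0 →
    row r (max (x.u : ℕ) x.v) ≤ min (x.u : ℕ) x.v

/-- Labels only decrease, and a new label is a vertex just declared to be in the same cluster. So
each label remains a member of its vertex's cluster. -/
theorem LabelInv.step {m : ℕ} {C : Fin m → Clustering n} {idx : Fin N → Fin m}
    {L : List (Item n m)} {row row' : ℕ → ℕ → ℕ} (h : LabelInv C idx L row) (x : Item n m)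
    (hx : x.b = 0 ↔ (C x.j).r x.u x.v)
    (hrow : ∀ r < N, ∀ c ≤ n, row' r c = recorded n row x.code r c) :
    LabelInv C idx (L ++ [x]) row' := by
  have hcode : ∀ (r : Fin N), ∀ c ≤ n, row' r c =
      if x.b = 0 ∧ x.j = idx r ∧ c = max (x.u : ℕ) x.v then min (row r c) (min (x.u : ℕ) x.v)
      else row r c := by
    intro r c hc
    rw [hrow r r.2 c hc, recorded, h.index r]
    have h3 : x.code 3 = x.b := rfl
    have h2 : x.code 2 = x.j := rfl
    have h0 : x.code 0 = x.u := rfl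
    have h1 : x.code 1 = x.v := rfl
    rw [h0, h1, h2, h3]
    refine if_congr ?_ rfl rfl
    constructor
    · rintro ⟨a, b, c⟩
      exact ⟨Fin.ext (by simpa using a), Fin.ext b.symm, c⟩
    · rintro ⟨a, b, c⟩
      exact ⟨by rw [a]; rfl, by rw [b], c⟩
  have hle' : ∀ (r : Fin N), ∀ c ≤ n, row' r c ≤ row r c := by
    intro r c hc
    rw [hcode r c hc]
    split_ifs
    · exact min_le_left _ _
    · exact le_rfl
  have hlt : ∀ (r : Fin N) (w : Fin n), row' r w < n := fun r w =>
    lt_of_le_of_lt (hle' r w w.2.le) (h.lt r w)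
  refine ⟨?_, hlt, fun r w => (hle' r w w.2.le).trans (h.le r w), ?_, ?_⟩
  · intro r
    rw [hcode r n le_rfl, if_neg, h.index r]
    rintro ⟨_, _, hc⟩
    have := x.u.2
    have := x.v.2
    omega
  · intro r w
    by_cases hif : x.b = 0 ∧ x.j = idx r ∧ (w : ℕ) = max (x.u : ℕ) x.v
    · have heq := hcode r w w.2.le
      rw [if_pos hif] at heq
      have huv : (C (idx r)).r x.u x.v := by rw [← hif.2.1]; exact hx.mp hif.1
      rcases min_choice (row r w) (min (x.u : ℕ) x.v) with h1 | h1
      · have : (⟨row' r w, hlt r w⟩ : Fin n) = ⟨row r w, h.lt r w⟩ := Fin.ext (heq.trans h1)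
        rw [this]; exact h.rel r w
      · rw [h1] at heq
        rcases le_total (x.u : ℕ) x.v with h2 | h2
        · have e1 : (⟨row' r w, hlt r w⟩ : Fin n) = x.u := Fin.ext (heq.trans (min_eq_left h2))
          have e2 : w = x.v := Fin.ext (by rw [hif.2.2, max_eq_right h2])
          rw [e1, e2]; exact huv
        · have e1 : (⟨row' r w, hlt r w⟩ : Fin n) = x.v := Fin.ext (heq.trans (min_eq_right h2))
          have e2 : w = x.u := Fin.ext (by rw [hif.2.2, max_eq_left h2])
          rw [e1, e2]; exact (C (idx r)).symm' huv
    · have heq := hcode r w w.2.le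
      rw [if_neg hif] at heq
      have : (⟨row' r w, hlt r w⟩ : Fin n) = ⟨row r w, h.lt r w⟩ := Fin.ext heq
      rw [this]; exact h.rel r w
  · intro r y hy hyj hyb
    have hmax : max (y.u : ℕ) y.v ≤ n := max_le y.u.2.le y.v.2.le
    rcases List.mem_append.mp hy with hyL | hyx
    · exact (hle' r _ hmax).trans (h.seen r y hyL hyj hyb)
    · rw [List.mem_singleton] at hyx
      subst hyx
      rw [hcode r _ hmax, if_pos ⟨hyb, hyj, rfl⟩]
      exact min_le_right _ _

/-- At the end of the stream, the stored labels describe the sampled clusterings. -/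
theorem LabelInv.ker_eq {m : ℕ} {C : Fin m → Clustering n} {idx : Fin N → Fin m}
    {L : List (Item n m)} {row : ℕ → ℕ → ℕ} (h : LabelInv C idx L row) (hL : IsStream C L)
    (r : Fin N) (u v : Fin n) : row r u = row r v ↔ (C (idx r)).r u v := by
  -- Every smaller vertex of the cluster of `w` is presented with `w`, in one of the two
  -- orientations, and bounds its label.
  have hle : ∀ x w : Fin n, x < w → (C (idx r)).r x w → row r w ≤ x := by
    intro x w hxw hrel
    obtain ⟨i, hi, hij, hs⟩ := hL.2 (idx r) x w (ne_of_lt hxw)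
    have hsub : (i.u = x ∧ i.v = w) ∨ (i.u = w ∧ i.v = x) := by
      simpa [Sym2.eq_iff] using hs
    have hb : i.b = 0 := by
      rw [hL.1 i hi, hij]
      rcases hsub with ⟨h1, h2⟩ | ⟨h1, h2⟩
      · rw [h1, h2]; exact hrel
      · rw [h1, h2]; exact (C (idx r)).symm' hrel
    have hseen := h.seen r i hi hij hb
    have hxw' : (x : ℕ) ≤ w := le_of_lt hxw
    rcases hsub with ⟨h1, h2⟩ | ⟨h1, h2⟩
    · rwa [h1, h2, max_eq_right hxw', min_eq_left hxw'] at hseen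
    · rwa [h1, h2, max_eq_left hxw', min_eq_right hxw'] at hseen
  -- The label of `u` is itself a vertex of the common cluster, hence bounds the label of `v`. By
  -- symmetry labels are constant on clusters.
  have key : ∀ u v : Fin n, (C (idx r)).r u v → row r v ≤ row r u := by
    intro u v huv
    have hrel : (C (idx r)).r ⟨row r u, h.lt r u⟩ v := (C (idx r)).trans' (h.rel r u) huv
    rcases lt_or_ge (row r u) v with h1 | h1
    · exact hle ⟨row r u, h.lt r u⟩ v h1 hrel
    · exact (h.le r v).trans h1
  constructor
  · intro heq
    have h1 := h.rel r u
    have h2 := h.rel r v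
    have : (⟨row r u, h.lt r u⟩ : Fin n) = ⟨row r v, h.lt r v⟩ := Fin.ext heq
    rw [this] at h1
    exact (C (idx r)).trans' ((C (idx r)).symm' h1) h2
  · intro huv
    exact le_antisymm (key v u ((C (idx r)).symm' huv)) (key u v huv)

/-- The processed prefix `L₀` is carried along so that the induction follows the stream forwards. A
winner exists only after some element, whence the proviso `L ≠ []`. -/
theorem exists_consumes {m q C' ℓ : ℕ} {C : Fin m → Clustering n} {idx : Fin N → Fin m}
    (hE : Fits E (N + G + 3) P) (hF : FitsPow n C' ℓ V P) (hn : 1 ≤ n) (hsq : n * n + 1 ≤ P)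
    (hN : N = q * G + V) (hG : 1 ≤ G) (hmP : m ≤ P) (L : List (Item n m)) :
    ∀ (L₀ : List (Item n m)) (s : State), Ctx n G N V s → s.Bounded n (N + G + 3) P →
      LabelInv C idx L₀ (s.cell n) → (∀ x ∈ L, x.b = 0 ↔ (C x.j).r x.u x.v) →
      ∃ s', Consumes E (updateCmd q C' ℓ) L s s' ∧ Ctx n G N V s' ∧ s'.Bounded n (N + G + 3) P ∧
        LabelInv C idx (L₀ ++ L) (s'.cell n) ∧
        (L ≠ [] → HoldsWinner E q C' ℓ G N V (s'.cell n)) := by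
  induction L with
  | nil =>
    intro L₀ s hc hs hl _
    exact ⟨s, .nil s, hc, hs, by simpa using hl, fun h => absurd rfl h⟩
  | cons x L ih =>
    intro L₀ s hc hs hl hL
    have hone := hE.one
    have hend := updateCmd_ends (s := s.next x.code) (q := q) (C := C') (ℓ := ℓ) hE hF
      ⟨hc.r0, hc.r1, hc.r2, hc.r3⟩ hs hn hsq hN hG x.u.2 x.v.2 (x.j.2.le.trans hmP)
      (le_trans (Nat.lt_succ_iff.mp x.b.2) (by omega))
    obtain ⟨s₁, t, hx, a1, a2, a3, a4⟩ := hend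
    have hl1 : LabelInv C idx (L₀ ++ [x]) (s₁.cell n) :=
      hl.step x (hL x (List.mem_cons_self ..)) a3
    obtain ⟨s₂, b1, b2, b3, b4, b5⟩ := ih (L₀ ++ [x]) s₁ a1 a2 hl1
      fun y hy => hL y (List.mem_cons_of_mem x hy)
    refine ⟨s₂, .cons x L s s₁ s₂ t hx b1, b2, b3, by simpa using b4, fun _ => ?_⟩
    rcases eq_or_ne L [] with h0 | h0
    · subst h0
      cases b1
      exact a4
    · exact b5 h0

/-- The winner is written on the output tape. -/
def queryCmd : Cmd :=
  .forLoop 5 .numVertices (.output (.reg 5) (cellAt (specialRow 2) (.reg 5)))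

/-- The only routine whose steps are counted. One round takes 4 steps for the test, 12 for the
output and 4 for the counter; the final test and the first assignment add 6. -/
theorem queryCmd_exec (hE : Fits E (N + G + 3) P) (hc : Ctx n G N V s)
    (hs : s.Bounded n (N + G + 3) P) :
    ∃ s' t, Exec E queryCmd s s' t ∧ t ≤ 20 * n + 6 ∧
      ∀ u < n, s'.out u = s.cell n (N + G + 2) u := by
  have hone := hE.one
  have hword := hE.word
  have key : ∀ k i s₀, i + k = n → Agree 5 s s₀ → s₀.reg 5 = i →
      ∃ s' t, Exec E (.loop (.bin .lt (.reg 5) .numVertices)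
        (.seq (.output (.reg 5) (cellAt (specialRow 2) (.reg 5)))
          (.assign 5 (.bin .add (.reg 5) (.const 1))))) s₀ s' t ∧ t ≤ 20 * k + 4 ∧
        (∀ u < i, s'.out u = s₀.out u) ∧
        ∀ u < n, i ≤ u → s'.out u = s.cell n (N + G + 2) u := by
    intro k
    induction k with
    | zero =>
      intro i s₀ hi ha hr
      obtain rfl : i = n := by omega
      have hok : (Expr.bin .lt (.reg 5) .numVertices).Ok E s₀ :=
        hE.lt_ok (hE.reg_ok (by omega)) hE.numVertices_ok
      have hv : (Expr.bin .lt (.reg 5) .numVertices).val E s₀ = 0 := by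
        rw [val_lt_eq_zero]; simp only [Expr.val]; omega
      refine ⟨s₀, _, .loopDone _ _ s₀ (by rw [Expr.eval_eq hok, hv]), by simp [Expr.size],
        fun _ _ => rfl, by omega⟩
    | succ k ih =>
      intro i s₀ hi ha hr
      have hc0 : Ctx n G N V s₀ := hc.of_regEq ha.regEq (by norm_num)
      have h5ok : (Expr.reg 5).Ok E s₀ := hE.reg_ok (by omega)
      have hok : (Expr.bin .lt (.reg 5) .numVertices).Ok E s₀ := hE.lt_ok h5ok hE.numVertices_ok
      have hv : (Expr.bin .lt (.reg 5) .numVertices).val E s₀ ≠ 0 := by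
        rw [val_lt_ne_zero]; simp only [Expr.val]; omega
      have hrow := specialRow_ok hE hc0 (i := 2) le_rfl
      have hrowv : (specialRow 2).val E s₀ = N + G + 2 := specialRow_val hc0 2
      have hcell := cellAt_ok hE hc0.r2 (ha.bounded hs) hrow h5ok (by omega)
        (by simp only [Expr.val]; omega)
      have hcv : (cellAt (specialRow 2) (.reg 5)).val E s₀ = s.cell n (N + G + 2) i := by
        rw [cellAt_val hc0.r2, hrowv, ha.cell]; simp only [Expr.val, hr]
      set s₁ : State := { s₀ with out := Function.update s₀.out i (s.cell n (N + G + 2) i) } with hs1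
      have hx1 : Exec E (.output (.reg 5) (cellAt (specialRow 2) (.reg 5))) s₀ s₁
          ((Expr.reg 5).size + (cellAt (specialRow 2) (.reg 5)).size + 1) :=
        .output s₀ _ _ i _ (by rw [Expr.eval_eq h5ok]; simp only [Expr.val, hr])
          (by rw [Expr.eval_eq hcell, hcv])
      have hinc : (Expr.bin .add (.reg 5) (.const 1)).Ok E s₁ :=
        hE.bin_ok (hE.reg_ok (show s₀.reg 5 ≤ P by omega)) (hE.const_ok (by omega))
          (show s₀.reg 5 + 1 ≤ P by omega)
      have hincv : (Expr.bin .add (.reg 5) (.const 1)).val E s₁ = i + 1 := by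
        change s₀.reg 5 + 1 = i + 1
        rw [hr]
      have hx2 : Exec E (.assign 5 (.bin .add (.reg 5) (.const 1))) s₁ (s₁.setReg 5 (i + 1))
          ((Expr.bin .add (.reg 5) (.const 1)).size + 1) :=
        .assign s₁ 5 _ _ (by rw [Expr.eval_eq hinc, hincv])
      obtain ⟨s', t, hx, ht, h1, h2⟩ := ih (i + 1) (s₁.setReg 5 (i + 1)) (by omega)
        (Agree.setReg ⟨ha.1, ha.2⟩ le_rfl) (by simp)
      refine ⟨s', _, .loopStep _ _ s₀ _ s' _ _ t (Expr.eval_eq hok) hv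
        (.seq _ _ s₀ s₁ _ _ _ hx1 hx2) hx, ?_, ?_, ?_⟩
      · simp only [Expr.size, cellAt, addrOf, specialRow]; omega
      · intro u hu
        rw [h1 u (by omega)]
        change Function.update s₀.out i _ u = _
        rw [Function.update_of_ne (by omega)]
      · intro u hu hiu
        rcases Nat.eq_or_lt_of_le hiu with h0 | h0
        · subst h0
          rw [h1 i (by omega)]
          change Function.update s₀.out i _ i = _
          rw [Function.update_self]
        · exact h2 u hu h0
  have h0 : (Expr.const 0).Ok E s := hE.const_ok (by omega)
  obtain ⟨s', t, hx, ht, _, h2⟩ := key n 0 (s.setReg 5 0) (by omega)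
    ((Agree.refl 5 s).setReg le_rfl) (by simp)
  refine ⟨s', _, .seq _ _ s _ s' _ t (.assign s 5 _ 0 (Expr.eval_eq h0)) hx, ?_,
    fun u hu => h2 u hu (Nat.zero_le u)⟩
  simp only [Expr.size]; omega

end Streaming

/-! ### Clusterings as sets of pairs -/

section Pairs

variable {n : ℕ}

open Classical in
/-- The pairs of vertices that are together in a clustering. -/
noncomputable def together (C : Clustering n) : Finset (Fin n × Fin n) :=
  Finset.univ.filter fun p => p.1 < p.2 ∧ C.r p.1 p.2

theorem mem_together {C : Clustering n} {p : Fin n × Fin n} :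
    p ∈ together C ↔ p.1 < p.2 ∧ C.r p.1 p.2 := by
  simp [together]

theorem pairDist_eq_hd (C D : Clustering n) : pairDist C D = hd (together C) (together D) := by
  rw [pairDist, hd, ← Set.ncard_coe_finset]
  congr 1
  ext p
  simp only [Set.mem_ofPred_eq, Finset.mem_coe, Finset.mem_symmDiff, mem_together]
  tauto

/-- The pairs that are together in the clustering given by the first `n` labels of an array. -/
noncomputable def rowSet (n : ℕ) (f : ℕ → ℕ) : Finset (Fin n × Fin n) :=
  together (ofLabels fun u : Fin n => f u)

theorem rowSet_eq {f : ℕ → ℕ} {C : Clustering n} (h : ∀ u v : Fin n, f u = f v ↔ C.r u v) :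
    rowSet n f = together C := by
  ext p
  rw [rowSet, mem_together, mem_together, ← h]
  rfl

theorem rowSet_congr {f g : ℕ → ℕ} (h : ∀ u < n, f u = g u) : rowSet n f = rowSet n g :=
  rowSet_eq fun u v => by
    rw [h u u.2, h v v.2]
    rfl

/-- The bridge between what the machine computes and the Hamming metric of the probabilistic
argument. -/
theorem labelDist_eq_hd (f g : ℕ → ℕ) : labelDist n f g = hd (rowSet n f) (rowSet n g) := by
  have h1 : symmDiff (rowSet n f) (rowSet n g) =
      Finset.univ.filter fun p : Fin n × Fin n => p.1 < p.2 ∧ ¬(f p.1 = f p.2 ↔ g p.1 = g p.2) := by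
    ext p
    simp only [Finset.mem_symmDiff, rowSet, mem_together, Finset.mem_filter, Finset.mem_univ,
      true_and]
    change (_ ∧ f p.1 = f p.2) ∧ ¬(_ ∧ g p.1 = g p.2) ∨ (_ ∧ g p.1 = g p.2) ∧ ¬(_ ∧ f p.1 = f p.2) ↔ _
    tauto
  rw [hd, h1, Finset.card_filter, Fintype.sum_prod_type, labelDist, Finset.sum_range]
  refine Finset.sum_congr rfl fun u _ => ?_
  rw [Finset.sum_range]
  refine Finset.sum_congr rfl fun v _ => ?_
  simp only [pairTerm, Fin.lt_def]
  by_cases h2 : (u : ℕ) < v <;> by_cases h3 : f u = f v <;> by_cases h4 : g u = g v <;>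
    simp [h2, h3, h4]

/-- Each vertex is labelled by a representative of its cluster, so `n` labels suffice and the
enumeration in base `n` meets every clustering. -/
theorem exists_labels (C : Clustering n) : ∃ f : Fin n → Fin n, ∀ u v, f u = f v ↔ C.r u v := by
  refine ⟨fun u => Quotient.out (Quotient.mk C u), fun u v => ?_⟩
  rw [Quotient.out_inj]
  exact Quotient.eq

theorem exists_digits (hn : 1 ≤ n) (f : Fin n → Fin n) :
    ∃ κ < n ^ n, ∀ u : Fin n, digit n κ u = f u := by
  have : NeZero n := ⟨by omega⟩
  refine ⟨finFunctionFinEquiv f, Fin.is_lt _, fun u => ?_⟩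
  conv_rhs => rw [← finFunctionFinEquiv.symm_apply_apply f]
  rfl

end Pairs

/-! ### The candidate of a tuple of samples -/

section Candidates

variable {n m : ℕ} {E : Env n}

/-- The candidate found by the exhaustive search for a tuple of clusterings. -/
noncomputable def tupleCandidate (E : Env n) {q : ℕ} (c : Fin m → Finset (Fin n × Fin n))
    (T : Fin q → Fin m) : Finset (Fin n × Fin n) :=
  rowSet n (oracleRow E (runMin (n * n + 1)
    (fun κ => Finset.univ.sup fun t => hd (c (T t)) (rowSet n (oracleRow E κ))) (n ^ n)).2)

theorem groupVal_eq_sup {q g : ℕ} {row : ℕ → ℕ → ℕ} {c : Fin m → Finset (Fin n × Fin n)}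
    {T : Fin q → Fin m} (h : ∀ t : Fin q, rowSet n (row (q * g + t)) = c (T t)) (z : ℕ → ℕ) :
    groupVal n q row z g = Finset.univ.sup fun t => hd (c (T t)) (rowSet n z) := by
  unfold groupVal
  refine le_antisymm (Finset.sup_le fun t ht => ?_) (Finset.sup_le fun t _ => ?_)
  · rw [Finset.mem_range] at ht
    rw [labelDist_eq_hd, h ⟨t, ht⟩]
    exact Finset.le_sup (f := fun t => hd (c (T t)) (rowSet n z)) (Finset.mem_univ _)
  · rw [← h t, ← labelDist_eq_hd]
    exact Finset.le_sup (f := fun t => labelDist n (row (q * g + t)) z)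
      (Finset.mem_range.mpr t.2)

/-- The search sees the samples only through distances. So the candidate depends on the tuple of
clusterings alone, not on the labels or the group number, as the sampling argument requires. -/
theorem rowSet_candidate {q g : ℕ} {row : ℕ → ℕ → ℕ} {c : Fin m → Finset (Fin n × Fin n)}
    {T : Fin q → Fin m} (h : ∀ t : Fin q, rowSet n (row (q * g + t)) = c (T t)) :
    rowSet n (oracleRow E (candIndex E q row g (n ^ n)).2) = tupleCandidate E c T := by
  unfold candIndex tupleCandidate
  simp only [groupVal_eq_sup h]

theorem pairDist_self (C : Clustering n) : pairDist C C = 0 := by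
  rw [pairDist_eq_hd, hd, symmDiff_self]; rfl

/-- The candidate is at least as central for its tuple as any fair clustering. -/
theorem tupleCandidate_le {χ q : ℕ} [NeZero q] {color : Fin n → Fin χ} {α : ℝ} (hn : 1 ≤ n)
    (hclosest : ∀ f : Fin n → ℕ, IsCloseFair color α (ofLabels f)
      (ofLabels fun u => (E.closest f u : ℕ)))
    {C : Fin m → Clustering n} {F : Clustering n} (hF : IsFair color F) (T : Fin q → Fin m)
    (j : Fin q) : ∃ i, hd (together (C (T j))) (tupleCandidate E (fun i => together (C i)) T) ≤
      hd (together (C (T i))) (together F) := by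
  obtain ⟨f, hf⟩ := exists_labels F
  obtain ⟨κ, hκ, hdig⟩ := exists_digits hn f
  have hlab : ofLabels (fun u : Fin n => digit n κ u) = F := by
    ext u v
    change digit n κ u = digit n κ v ↔ F.r u v
    rw [hdig, hdig, ← hf, Fin.val_inj]
  -- `F` is fair and at distance 0 from itself, so the oracle's answer to a labelling of `F` is at
  -- distance at most `α * 0`, hence equals `F`.
  have hrow : rowSet n (oracleRow E κ) = together F := by
    have h1 := (hclosest fun u => digit n κ u).2 F hF
    rw [hlab, pairDist_self, Nat.cast_zero, mul_zero, pairDist_eq_hd] at h1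
    have h2 : hd (together F) (together (ofLabels fun u =>
        (E.closest (fun u => digit n κ u) u : ℕ))) = 0 := by
      exact_mod_cast le_antisymm h1 (Nat.cast_nonneg _)
    rw [eq_of_hd_eq_zero h2]
    refine rowSet_eq fun u v => ?_
    simp only [oracleRow, labelsToCells, u.2, v.2, dif_pos]
    rfl
  set val : ℕ → ℕ := fun κ => Finset.univ.sup fun t =>
    hd (together (C (T t))) (rowSet n (oracleRow E κ)) with hval
  have hlt : ∀ κ, val κ < n * n + 1 := fun κ => Nat.lt_succ_of_le (Finset.sup_le fun t _ => by
    obtain ⟨g, hg⟩ := exists_labels (C (T t))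
    have : rowSet n (labelsToCells g) = together (C (T t)) := rowSet_eq fun u v => by
      simp only [labelsToCells, u.2, v.2, dif_pos, Fin.eta]
      rw [← hg, Fin.val_inj]
    rw [← this, ← labelDist_eq_hd]
    exact labelDist_le _ _)
  have hpos : n ^ n = n ^ n - 1 + 1 := (Nat.sub_add_cancel (Nat.one_le_pow _ _ hn)).symm
  have h1 := runMin_le (n * n + 1) val hκ
  have h2 := (runMin_attained (n * n + 1) val hlt (n ^ n - 1)).1
  rw [← hpos] at h2
  rw [h2] at h1
  obtain ⟨i, _, hi⟩ := Finset.exists_mem_eq_sup Finset.univ ⟨(0 : Fin q), Finset.mem_univ _⟩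
    fun t => hd (together (C (T t))) (rowSet n (oracleRow E κ))
  refine ⟨i, ?_⟩
  calc _ ≤ val (runMin (n * n + 1) val (n ^ n)).2 :=
        Finset.le_sup (f := fun t => hd (together (C (T t)))
          (rowSet n (oracleRow E (runMin (n * n + 1) val (n ^ n)).2))) (Finset.mem_univ j)
    _ ≤ val κ := h1
    _ = hd (together (C (T i))) (rowSet n (oracleRow E κ)) := hi
    _ = _ := by rw [hrow]

end Candidates

/-! ### Groups and validators -/

section Samples

/-- The samples are split into groups, followed by the validators. -/
def splitSamples (G q V : ℕ) (α : Type*) :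
    (Fin (G * q + V) → α) ≃ (Fin G → Fin q → α) × (Fin V → α) :=
  (finSumFinEquiv.symm.arrowCongr (Equiv.refl α)).trans
    ((Equiv.sumArrowEquivProdArrow _ _ _).trans
      (((finProdFinEquiv.symm.arrowCongr (Equiv.refl α)).trans (Equiv.curry _ _ _)).prodCongr
        (Equiv.refl _)))

theorem splitSamples_fst {G q V : ℕ} {α : Type*} (ω : Fin (G * q + V) → α) (g : Fin G) (t : Fin q) :
    (splitSamples G q V α ω).1 g t = ω (Fin.castAdd V (finProdFinEquiv (g, t))) := rfl

theorem splitSamples_snd {G q V : ℕ} {α : Type*} (ω : Fin (G * q + V) → α) (j : Fin V) :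
    (splitSamples G q V α ω).2 j = ω (Fin.natAdd (G * q) j) := rfl

variable {n m : ℕ} {E : Env n} {G q V N ℓ : ℕ} {row : ℕ → ℕ → ℕ}
  {c : Fin m → Finset (Fin n × Fin n)} {T : Fin G → Fin q → Fin m} {v : Fin V → Fin m}

open Classical in
theorem winCount_eq_card {K : ℕ} {Y : Fin G → Finset (Fin n × Fin n)}
    (hv : ∀ j : Fin V, rowSet n (row (q * G + j)) = c (v j))
    (hY : ∀ g : Fin G, rowSet n (row (N + g)) = Y g) (g : Fin G) :
    winCount n q K ℓ G N V row g G =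
      (Finset.univ.filter fun i => Beats ℓ K c v (Y g) (Y i)).card := by
  have hscore : ∀ (A : ℕ) (h : Fin G), scoreSum n ℓ A V row (q * G) (row (N + h)) =
      truncSum ℓ A c v (Y h) := by
    intro A h
    rw [scoreSum, truncSum, Finset.sum_range]
    refine Finset.sum_congr rfl fun j _ => ?_
    rw [labelDist_eq_hd, hv, hY]
  rw [winCount, Finset.card_filter, Finset.sum_range]
  refine Finset.sum_congr rfl fun i _ => if_congr ?_ rfl rfl
  rw [RowBeats, Beats, hscore, hscore, labelDist_eq_hd, hY, hY]

open Classical in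
/-- The row of the winner holds the candidate of a group with the largest number of wins. -/
theorem HoldsWinner.exists_group {K : ℕ} (hw : HoldsWinner E q K ℓ G N V row)
    (hN : N = q * G + V)
    (hT : ∀ (g : Fin G) (t : Fin q), rowSet n (row (q * g + t)) = c (T g t))
    (hv : ∀ j : Fin V, rowSet n (row (q * G + j)) = c (v j)) :
    ∃ g : Fin G, (∃ κ, ∀ u < n, row (N + G + 2) u = oracleRow E κ u) ∧
      rowSet n (row (N + G + 2)) = tupleCandidate E c (T g) ∧
      ∀ h : Fin G, (Finset.univ.filter fun i =>
          Beats ℓ K c v (tupleCandidate E c (T h)) (tupleCandidate E c (T i))).card ≤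
        (Finset.univ.filter fun i =>
          Beats ℓ K c v (tupleCandidate E c (T g)) (tupleCandidate E c (T i))).card := by
  obtain ⟨b, hb, h1, h2⟩ := hw
  have hcand : ∀ g, fullRow E q N row (N + g) = oracleRow E (candIndex E q row g (n ^ n)).2 :=
    fun g => by rw [fullRow, if_neg (by omega), Nat.add_sub_cancel_left]
  have hv' : ∀ j : Fin V, rowSet n (fullRow E q N row (q * G + j)) = c (v j) := fun j => by
    rw [fullRow, if_pos (by omega), hv]
  have hY : ∀ g : Fin G, rowSet n (fullRow E q N row (N + g)) = tupleCandidate E c (T g) :=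
    fun g => by rw [hcand, rowSet_candidate (hT g)]
  refine ⟨⟨b, hb⟩, ⟨_, fun u hu => (h1 u hu).trans (by rw [hcand])⟩,
    (rowSet_congr h1).trans (hY ⟨b, hb⟩), fun h => ?_⟩
  rw [← winCount_eq_card hv' hY h, ← winCount_eq_card hv' hY ⟨b, hb⟩]
  exact h2 h h.2

end Samples

/-! ### Runs of the algorithm -/

section Runs

variable {n m : ℕ}

/-- The streaming algorithm with `a * L` groups of `q` samples and `b * L` validators, where `L` is
the binary logarithm of the number of clusterings. It stores labels describing the sampled
clusterings. Since the time per stream element is not limited, after each element the algorithm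
calls the closest fair clustering oracle for all labellings in order to find, for each group, a
fair clustering which minimises the maximal distance to the samples of this group. The winner of a
tournament between these candidates is stored; it is the output when the stream has ended. The fair
correlation clustering oracle is not needed. -/
def samplingAlg (a b q K ℓ : ℕ) : StreamAlg where
  init := initCmd a b q
  update := updateCmd q K ℓ
  query := queryCmd

open Classical in
theorem samplingAlg_run {E : Env n} {a b q K ℓ G V P : ℕ} (hEm : E.m = m)
    (hG : G = a * Nat.clog 2 m) (hV : V = b * Nat.clog 2 m) (hE : Fits E (G * q + V + G + 3) P)
    (hF : FitsPow n K ℓ V P) (hn : 1 ≤ n) (hm : 2 ≤ m) (hmP : 2 * m ≤ P) (ha : a ≤ P) (hb : b ≤ P)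
    (hq : q ≤ P) (hsq : n * n + 1 ≤ P) (hG1 : 1 ≤ G) {C : Fin m → Clustering n}
    {L : List (Item n m)} (hL : IsStream C L) (ω : Fin (G * q + V) → Fin m) :
    ∃ (labels : Fin n → ℕ) (t : ℕ),
      Runs E (samplingAlg a b q K ℓ) (List.ofFn fun i => (ω i : ℕ)) L labels t ∧
      t ≤ 20 * n + 6 ∧ (L ≠ [] → ∃ g : Fin G,
        (∃ κ, ∀ u : Fin n, labels u = oracleRow E κ u) ∧
        together (ofLabels labels) =
          tupleCandidate E (fun i => together (C i)) ((splitSamples G q V _ ω).1 g) ∧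
        ∀ h : Fin G, (Finset.univ.filter fun i =>
          Beats ℓ K (fun i => together (C i)) (splitSamples G q V _ ω).2
            (tupleCandidate E (fun i => together (C i)) ((splitSamples G q V _ ω).1 h))
            (tupleCandidate E (fun i => together (C i)) ((splitSamples G q V _ ω).1 i))).card ≤
        (Finset.univ.filter fun i =>
          Beats ℓ K (fun i => together (C i)) (splitSamples G q V _ ω).2
            (tupleCandidate E (fun i => together (C i)) ((splitSamples G q V _ ω).1 g))
            (tupleCandidate E (fun i => together (C i))
              ((splitSamples G q V _ ω).1 i))).card) := by
  subst hEm
  have hN : G * q + V = q * G + V := by rw [mul_comm]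
  obtain ⟨s₀, t₀, hx₀, hc₀, hb₀, hcell⟩ := initCmd_ends
    (s := State.initial (List.ofFn fun i => (ω i : ℕ))) hG hV hN hE hm hmP ha hb hq
    (fun _ _ => Nat.zero_le _) (by simp [State.initial]) (fun x hx => by
      obtain ⟨i, rfl⟩ := List.mem_ofFn.mp hx
      have := (ω i).2
      omega)
  have hinv : LabelInv C ω [] (s₀.cell n) := by
    have hrow : ∀ (r : Fin (G * q + V)) (u : Fin n), s₀.cell n r u = u := fun r u =>
      (hcell r r.2).2 u u.2
    refine ⟨fun r => ?_, fun r w => (hrow r w).trans_lt w.2, fun r w => (hrow r w).le,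
      fun r w => ?_, fun r x hx => by simp at hx⟩
    · rw [(hcell r r.2).1]
      simp [State.initial]
    · have : (⟨s₀.cell n r w, (hrow r w).trans_lt w.2⟩ : Fin n) = w := Fin.ext (hrow r w)
      rw [this]
  obtain ⟨s₁, hx₁, hc₁, hb₁, hinv₁, hwin⟩ := exists_consumes hE hF hn hsq hN hG1 (by omega) L []
    s₀ hc₀ hb₀ hinv hL.1
  rw [List.nil_append] at hinv₁
  obtain ⟨s₂, t, hx₂, ht, hout⟩ := queryCmd_exec (s := s₁.next fun _ => 0) hE
    ⟨hc₁.r0, hc₁.r1, hc₁.r2, hc₁.r3⟩ hb₁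
  have hlab : ∀ u : Fin n, s₂.out u = s₁.cell n (G * q + V + G + 2) u := fun u => hout u u.2
  refine ⟨fun u => s₂.out u, t, ⟨s₀, s₁, s₂, t₀, hx₀, hx₁, hx₂, fun _ => rfl⟩, ht, fun hne => ?_⟩
  have hker : ∀ r : Fin (G * q + V), rowSet n (s₁.cell n r) = together (C (ω r)) := fun r =>
    rowSet_eq (hinv₁.ker_eq hL r)
  obtain ⟨g, ⟨κ, h1⟩, h2, h3⟩ := (hwin hne).exists_group (c := fun i => together (C i))
    (T := (splitSamples G q V _ ω).1) (v := (splitSamples G q V _ ω).2) hN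
    (fun g t => by
      rw [splitSamples_fst, ← hker]
      simp [add_comm])
    (fun j => by
      rw [splitSamples_snd, ← hker]
      simp [mul_comm])
  refine ⟨g, ⟨κ, fun u => (hlab u).trans (h1 u u.2)⟩, ?_, h3⟩
  rw [← h2, rowSet]
  simp only [hlab]

end Runs

/-! ### The consensus objective -/

section Consensus

variable {n m χ : ℕ} {color : Fin n → Fin χ} {ℓ : ℕ} {C : Fin m → Clustering n}

/-- The power sums are natural numbers, so a minimum is attained. -/
theorem exists_optimal_fair (ℓ : ℕ) (C : Fin m → Clustering n)
    (h : ∃ F, IsFair color F) : ∃ F, IsFair color F ∧ ∀ F', IsFair color F' →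
      ∑ i, pairDist (C i) F ^ ℓ ≤ ∑ i, pairDist (C i) F' ^ ℓ := by
  obtain ⟨F, hF, hmin⟩ := WellFounded.has_min
    (InvImage.wf (fun F : Clustering n => ∑ i, pairDist (C i) F ^ ℓ) Nat.lt_wfRel.wf)
    {F | IsFair color F} h
  exact ⟨F, hF, fun F' hF' => not_lt.mp (hmin F' hF')⟩

theorem consensusCost_le {β : ℝ} (hℓ : 1 ≤ ℓ) (hβ : 0 ≤ β) {F F' : Clustering n}
    (h : ∑ i, (pairDist (C i) F : ℝ) ^ ℓ ≤ β ^ ℓ * ∑ i, (pairDist (C i) F' : ℝ) ^ ℓ) :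
    consensusCost ℓ C F ≤ β * consensusCost ℓ C F' := by
  have h0 : ∀ F, 0 ≤ ∑ i, (pairDist (C i) F : ℝ) ^ ℓ := fun F =>
    Finset.sum_nonneg fun i _ => by positivity
  unfold consensusCost
  calc _ ≤ (β ^ ℓ * ∑ i, (pairDist (C i) F' : ℝ) ^ ℓ) ^ (1 / (ℓ : ℝ)) :=
        Real.rpow_le_rpow (h0 F) h (by positivity)
    _ = _ := by
        rw [Real.mul_rpow (by positivity) (h0 F'), one_div,
          Real.pow_rpow_inv_natCast hβ (by omega)]

/-- Covers `n = 1`, where the stream may be empty and the winner row is then never filled. -/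
theorem isApproxFairConsensus_of_subsingleton [Subsingleton (Fin n)] {β : ℝ} (hβ : 1 ≤ β)
    (h : ∃ F, IsFair color F) (F : Clustering n) : IsApproxFairConsensus color ℓ β C F := by
  have hall : ∀ D D' : Clustering n, D = D' := fun D D' => by
    ext u v
    rw [Subsingleton.elim u v]
    exact iff_of_true (D.refl' v) (D'.refl' v)
  obtain ⟨F₀, hF₀⟩ := h
  refine ⟨hall F₀ F ▸ hF₀, fun F' _ => ?_⟩
  rw [hall F' F]
  refine le_mul_of_one_le_left ?_ hβ
  unfold consensusCost
  exact Real.rpow_nonneg (Finset.sum_nonneg fun i _ => by positivity) _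

end Consensus

/-! ### Resources -/

section Resources

/-- Rounding up at most doubles the binary logarithm when `m ≥ 2`, and 2 / log 2 < 3. -/
theorem clog_le_three_mul_log {m : ℕ} (hm : 2 ≤ m) : (Nat.clog 2 m : ℝ) ≤ 3 * Real.log m := by
  have h1 : 2 ^ (Nat.clog 2 m - 1) < m := Nat.pow_pred_clog_lt_self (by norm_num) (by omega)
  have hpos : 0 < Nat.clog 2 m := Nat.clog_pos (by norm_num) hm
  have h2 : ((Nat.clog 2 m - 1 : ℕ) : ℝ) * Real.log 2 ≤ Real.log m := by
    rw [← Real.log_pow]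
    exact Real.log_le_log (by positivity) (by exact_mod_cast h1.le)
  rw [Nat.cast_sub hpos, Nat.cast_one] at h2
  have h3 : Real.log 2 ≤ Real.log m := Real.log_le_log (by norm_num) (by exact_mod_cast hm)
  have h4 := Real.log_two_gt_d9
  have h5 : (0 : ℝ) ≤ Nat.clog 2 m := Nat.cast_nonneg _
  nlinarith

/-- A single power of `x = n + m` bounds all words: as `x ≥ 3`, constants are absorbed into the
exponent by `i ≤ x ^ i`, and 10000 ≤ 3 ^ 9. In the memory bound, the factor 6 comes from `L ≤ 3 *
log m` and `n + 1 ≤ 2 * n`. -/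
theorem samplingAlg_fits {n m a b q ℓ : ℕ} (hn : 1 ≤ n) (hm : 2 ≤ m) {A J K L : ℕ}
    (hA : A = a * q + b + a + q + 3) (hJ : J = A + 11 * ℓ + 20) (hK : 6 * A + J + 1 ≤ K)
    (hL : L = Nat.clog 2 m) (E : Env n) (hmem : E.memLimit = ⌊(K : ℝ) * ((n : ℝ) * Real.log m)⌋₊)
    (hword : E.wordLimit = (n + m) ^ K) :
    Fits E (a * L * q + b * L + a * L + 3) ((n + m) ^ J) ∧
      FitsPow n truncFactor ℓ (b * L) ((n + m) ^ J) ∧ 2 * m ≤ (n + m) ^ J ∧ a ≤ (n + m) ^ J ∧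
      b ≤ (n + m) ^ J ∧ q ≤ (n + m) ^ J ∧ n * n + 1 ≤ (n + m) ^ J := by
  set x := n + m with hx
  have hx3 : 3 ≤ x := by omega
  have hpow : ∀ {i j : ℕ}, i ≤ j → x ^ i ≤ x ^ j := fun h => Nat.pow_le_pow_right (by omega) h
  have hself : ∀ i : ℕ, i ≤ x ^ i := fun i => (Nat.lt_pow_self (by omega)).le
  have hsq : n * n + 1 ≤ x ^ 2 := by rw [hx]; nlinarith
  have hL1 : 1 ≤ L := hL ▸ Nat.clog_pos (by norm_num) hm
  have hLm : L ≤ m := hL ▸ Nat.clog_le_of_le_pow Nat.lt_two_pow_self.le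
  have hW : a * L * q + b * L + a * L + 3 ≤ A * L := by
    rw [hA]; nlinarith [Nat.zero_le (q * L)]
  have hbase : truncFactor * (n * n) ≤ x ^ 11 := by
    calc truncFactor * (n * n) ≤ 3 ^ 9 * x ^ 2 := Nat.mul_le_mul (by norm_num) (by omega)
      _ ≤ x ^ 9 * x ^ 2 := Nat.mul_le_mul_right _ (Nat.pow_le_pow_left hx3 9)
      _ = x ^ 11 := by rw [← pow_add]
  have hbpow : ∀ j, (truncFactor * (n * n)) ^ j ≤ x ^ (11 * j) := fun j => by
    rw [pow_mul]; exact Nat.pow_le_pow_left hbase j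
  have hself' : ∀ i ≤ A, i ≤ x ^ J := fun i hi => (hself i).trans (hpow (by omega))
  have hn1 : n + 1 ≤ x := by omega
  refine ⟨⟨?_, ?_, ?_, ?_, ?_⟩, ⟨fun j hj => (hbpow j).trans (hpow (by omega)), ?_,
    hbase.trans (hpow (by omega)), ?_⟩, ?_, hself' a (by omega), hself' b (by omega),
    hself' q (by omega), hsq.trans (hpow (by omega))⟩
  · rw [hmem]
    refine Nat.le_floor ?_
    have hlog := hL ▸ clog_le_three_mul_log hm
    have hn' : (1 : ℝ) ≤ n := by exact_mod_cast hn
    have hKA : (6 * A : ℝ) ≤ K := by exact_mod_cast (by omega : 6 * A ≤ K)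
    have hlog0 : 0 ≤ Real.log m := Real.log_natCast_nonneg m
    calc (((a * L * q + b * L + a * L + 3) * (n + 1) : ℕ) : ℝ)
        ≤ ((A * L * (n + 1) : ℕ) : ℝ) := by
          exact_mod_cast Nat.mul_le_mul_right _ hW
      _ = A * (L * (n + 1)) := by push_cast; ring
      _ ≤ A * (3 * Real.log m * (2 * n)) := by gcongr; linarith
      _ = 6 * A * (n * Real.log m) := by ring
      _ ≤ K * (n * Real.log m) := by gcongr
  · calc _ ≤ A * L * (n + 1) := Nat.mul_le_mul_right _ hW
      _ ≤ x ^ A * x * x := Nat.mul_le_mul (Nat.mul_le_mul (hself A) (by omega)) hn1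
      _ = x ^ (A + 2) := by ring
      _ ≤ x ^ J := hpow (by omega)
  · exact le_trans (by omega) (hsq.trans (hpow (by omega)))
  · exact hn1.trans (by simpa using hpow (show 1 ≤ J by omega))
  · rw [hword]
    have h1 : 1 ≤ x ^ J := Nat.one_le_pow _ _ (by omega)
    calc x ^ J + 1 < x ^ J * 3 := by omega
      _ ≤ x ^ J * x := Nat.mul_le_mul_left _ hx3
      _ = x ^ (J + 1) := by rw [pow_succ]
      _ ≤ x ^ K := hpow (by omega)
  · calc _ ≤ x ^ A * x * x ^ (11 * ℓ) :=
          Nat.mul_le_mul (Nat.mul_le_mul ((show b ≤ A by omega).trans (hself A)) (by omega))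
            (hbpow ℓ)
      _ = x ^ (A + 1 + 11 * ℓ) := by ring
      _ ≤ x ^ J := hpow (by omega)
  · calc truncFactor ≤ 3 ^ 9 := by norm_num
      _ ≤ x ^ 9 := Nat.pow_le_pow_left hx3 9
      _ ≤ x ^ J := hpow (by omega)
  · calc 2 * m ≤ x * x := Nat.mul_le_mul (by omega) (by omega)
      _ = x ^ 2 := by ring
      _ ≤ x ^ J := hpow (by omega)

/-- The query is linear in `n`. As `m ≥ 2`, the fourth power of the logarithm exceeds 0.2, and 130 *
0.2 = 26 covers 20 + 6. -/
theorem queryTime_le {n m t K T : ℕ} (hn : 1 ≤ n) (hm : 2 ≤ m) (ht : t ≤ 20 * n + 6)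
    (hK : 130 ≤ K) :
    (t : ℝ) ≤ K * ((n : ℝ) ^ 2 * Real.log m ^ 4 + (T : ℝ) * Real.log m ^ 3) := by
  have hn' : (1 : ℝ) ≤ n := by exact_mod_cast hn
  have ht' : (t : ℝ) ≤ 20 * n + 6 := by exact_mod_cast ht
  have hK' : (130 : ℝ) ≤ K := by exact_mod_cast hK
  have h3 : Real.log 2 ≤ Real.log m := Real.log_le_log (by norm_num) (by exact_mod_cast hm)
  have h4 := Real.log_two_gt_d9
  have h5 : (0.2 : ℝ) ≤ Real.log m ^ 4 := by
    calc (0.2 : ℝ) ≤ 0.69 ^ 4 := by norm_num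
      _ ≤ _ := by gcongr; linarith
  have h6 : 0 ≤ (T : ℝ) * Real.log m ^ 3 :=
    mul_nonneg (Nat.cast_nonneg _) (pow_nonneg (by linarith) _)
  calc (t : ℝ) ≤ 130 * ((n : ℝ) ^ 2 * 0.2) := by nlinarith
    _ ≤ K * ((n : ℝ) ^ 2 * Real.log m ^ 4 + (T : ℝ) * Real.log m ^ 3) := by
        gcongr
        have : (n : ℝ) ^ 2 * 0.2 ≤ (n : ℝ) ^ 2 * Real.log m ^ 4 := by gcongr
        linarith

end Resources

/-! ### From good samples to good outputs -/

section Main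

variable {n m χ : ℕ}

open Classical in
/-- The random choices for which the tournament is won by a good candidate. -/
theorem card_good_samples_le {color : Fin n → Fin χ} {ℓ k a b L : ℕ} {β : ℝ} (hℓ : 1 ≤ ℓ)
    (hβ : 2.995 ≤ β) {C : Fin m → Clustering n}
    {Y : (Fin (k + 1) → Fin m) → Finset (Fin n × Fin n)} {F : Clustering n}
    (hmin : ∀ F', IsFair color F' →
      ∑ i, pairDist (C i) F ^ ℓ ≤ ∑ i, pairDist (C i) F' ^ ℓ)
    {out : (Fin (a * L * (k + 1) + b * L) → Fin m) → Clustering n}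
    (hfair : ∀ ω, IsFair color (out ω))
    (hout : ∀ ω, ∃ g, together (out ω) = Y ((splitSamples (a * L) (k + 1) (b * L) _ ω).1 g) ∧
      ∀ h, (Finset.univ.filter fun i =>
        Beats ℓ truncFactor (fun i => together (C i)) (splitSamples _ _ _ _ ω).2
          (Y ((splitSamples _ _ _ _ ω).1 h)) (Y ((splitSamples _ _ _ _ ω).1 i))).card ≤
      (Finset.univ.filter fun i =>
        Beats ℓ truncFactor (fun i => together (C i)) (splitSamples _ _ _ _ ω).2
          (Y ((splitSamples _ _ _ _ ω).1 g)) (Y ((splitSamples _ _ _ _ ω).1 i))).card) :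
    (Finset.univ.filter fun ω : (Fin (a * L) → Fin (k + 1) → Fin m) × (Fin (b * L) → Fin m) =>
      ∀ g, (∀ h, (Finset.univ.filter fun i =>
          Beats ℓ truncFactor (fun i => together (C i)) ω.2 (Y (ω.1 h)) (Y (ω.1 i))).card ≤
        (Finset.univ.filter fun i =>
          Beats ℓ truncFactor (fun i => together (C i)) ω.2 (Y (ω.1 g)) (Y (ω.1 i))).card) →
      ∑ i, (hd (together (C i)) (Y (ω.1 g)) : ℝ) ^ ℓ ≤
        2.995 ^ ℓ * ∑ i, (hd (together (C i)) (together F) : ℝ) ^ ℓ).card ≤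
    {ω | IsApproxFairConsensus color ℓ β C (out ω)}.ncard := by
  rw [← Set.ncard_coe_finset]
  -- Splitting the coins into groups and validators is a bijection, so probabilities can be compared
  -- by counting.
  refine Set.ncard_le_ncard_of_injOn (splitSamples (a * L) (k + 1) (b * L) (Fin m)).symm ?_
    (Equiv.injective _).injOn (Set.toFinite _)
  intro ω' hω'
  obtain ⟨ω, rfl⟩ := (splitSamples (a * L) (k + 1) (b * L) (Fin m)).surjective ω'
  rw [Finset.mem_coe, Finset.mem_filter] at hω'
  rw [Equiv.symm_apply_apply]
  refine ⟨hfair ω, fun F' hF' => consensusCost_le hℓ (by linarith) ?_⟩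
  obtain ⟨g, hg, hmax⟩ := hout ω
  have h1 := hω'.2 g hmax
  rw [← hg] at h1
  simp only [← pairDist_eq_hd] at h1
  have h2 : ∑ i, (pairDist (C i) F : ℝ) ^ ℓ ≤ ∑ i, (pairDist (C i) F' : ℝ) ^ ℓ := by
    exact_mod_cast hmin F' hF'
  calc _ ≤ 2.995 ^ ℓ * ∑ i, (pairDist (C i) F : ℝ) ^ ℓ := h1
    _ ≤ β ^ ℓ * ∑ i, (pairDist (C i) F' : ℝ) ^ ℓ := by gcongr

end Main

end FairConsensus

theorem mainTheorem8 (α γ : ℝ) (hα : 1 ≤ α) (hγ : 1 ≤ γ) (ℓ : ℕ) (hℓ : 1 ≤ ℓ) :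
    ∃ (A : FairConsensus.StreamAlg) (K : ℕ),
      ∀ (n m χ : ℕ), 1 ≤ n → 2 ≤ m →
      ∃ R : ℕ,
      ∀ (color : Fin n → Fin χ), Function.Surjective color →
      ∀ closest : (Fin n → ℕ) → (Fin n → Fin n),
        (∀ f : Fin n → ℕ, FairConsensus.IsCloseFair color α (FairConsensus.ofLabels f)
          (FairConsensus.ofLabels fun u => (closest f u : ℕ))) →
      ∀ fairCorr : SimpleGraph (Fin n) → (Fin n → Fin n),
        (∀ G : SimpleGraph (Fin n), FairConsensus.IsApproxFairCorr color γ G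
          (FairConsensus.ofLabels fun u => (fairCorr G u : ℕ))) →
      ∀ (T : ℕ → ℕ) (C : Fin m → FairConsensus.Clustering n)
        (L : List (FairConsensus.Item n m)), FairConsensus.IsStream C L →
      ∃ labels : (Fin R → Fin m) → Fin n → ℕ,
        (∀ ω : Fin R → Fin m, ∃ t : ℕ,
          FairConsensus.Runs
            { m := m
              color := fun v => (color v : ℕ)
              closest := closest
              fairCorr := fairCorr
              corrTime := T n
              memLimit := ⌊(K : ℝ) * ((n : ℝ) * Real.log m)⌋₊
              wordLimit := (n + m) ^ K }
            A (List.ofFn fun i => (ω i : ℕ)) L (labels ω) t ∧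
          (t : ℝ) ≤ (K : ℝ) *
            ((n : ℝ) ^ 2 * Real.log m ^ 4 + (T n : ℝ) * Real.log m ^ 3)) ∧
        1 - 1 / (m : ℝ) ≤
          ({ω : Fin R → Fin m | FairConsensus.IsApproxFairConsensus color ℓ (α + 1.995) C
            (FairConsensus.ofLabels (labels ω))}.ncard : ℝ) / (m : ℝ) ^ R := by
  obtain ⟨k, a, b, ha, hsampling⟩ := FairConsensus.exists_sampling_constants ℓ hℓ
  set A := a * (k + 1) + b + a + (k + 1) + 3 with hA
  set J := A + 11 * ℓ + 20 with hJ
  -- One constant for three purposes: at least `6 * A` for the memory, above `J` for the word size,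
  -- at least 130 for the query time.
  set K := 6 * A + J + 130 with hK
  refine ⟨FairConsensus.samplingAlg a b (k + 1) FairConsensus.truncFactor ℓ, K, ?_⟩
  intro n m χ hn hm
  set l := Nat.clog 2 m with hl
  refine ⟨a * l * (k + 1) + b * l, ?_⟩
  intro color _ closest hclosest fairCorr _ T C L hL
  set E : FairConsensus.Env n :=
    { m := m
      color := fun v => (color v : ℕ)
      closest := closest
      fairCorr := fairCorr
      corrTime := T n
      memLimit := ⌊(K : ℝ) * ((n : ℝ) * Real.log m)⌋₊
      wordLimit := (n + m) ^ K } with hE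
  have hm0 : (0 : ℝ) < m := by positivity
  have hl1 : 1 ≤ l := Nat.clog_pos (by norm_num) hm
  obtain ⟨hfits, hpow, hmP, haP, hbP, hqP, hsq⟩ :=
    FairConsensus.samplingAlg_fits (ℓ := ℓ) hn hm hA hJ (show 6 * A + J + 1 ≤ K by omega) hl E rfl
      rfl
  have hrun := FairConsensus.samplingAlg_run (E := E) rfl (congrArg (a * ·) hl) (congrArg (b * ·) hl)
    hfits hpow hn hm hmP haP hbP hqP hsq (Nat.mul_pos ha hl1) hL
  choose labels t hruns ht hspec using hrun
  refine ⟨labels, fun ω => ⟨t ω, hruns ω,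
    FairConsensus.queryTime_le hn hm (ht ω) (by omega)⟩, ?_⟩
  have hexists : ∃ F, FairConsensus.IsFair color F := ⟨_, (hclosest fun _ => 0).1⟩
  rw [le_div_iff₀ (by positivity)]
  -- An empty stream presents no pair, which forces `n = 1`.
  rcases eq_or_ne L [] with h0 | hne
  · have hsub : Subsingleton (Fin n) := by
      refine ⟨fun u v => ?_⟩
      by_contra huv
      obtain ⟨x, hx, _⟩ := hL.2 ⟨0, by omega⟩ u v huv
      rw [h0] at hx
      simp at hx
    have huniv : {ω : Fin (a * l * (k + 1) + b * l) → Fin m |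
        FairConsensus.IsApproxFairConsensus color ℓ (α + 1.995) C
          (FairConsensus.ofLabels (labels ω))} = Set.univ :=
      Set.eq_univ_of_forall fun ω =>
        FairConsensus.isApproxFairConsensus_of_subsingleton (by linarith) hexists _
    rw [huniv, Set.ncard_univ, Nat.card_eq_fintype_card]
    simp only [Fintype.card_fun, Fintype.card_fin, Nat.cast_pow]
    have : 0 ≤ 1 / (m : ℝ) := by positivity
    exact mul_le_of_le_one_left (by positivity) (by linarith)
  · obtain ⟨F, hF, hmin⟩ := FairConsensus.exists_optimal_fair ℓ C hexists
    have hcount := hsampling m hm l (Nat.le_pow_clog (by norm_num) m)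
      (fun i => FairConsensus.together (C i)) (FairConsensus.together F)
      (FairConsensus.tupleCandidate E fun i => FairConsensus.together (C i))
      (FairConsensus.tupleCandidate_le hn hclosest hF)
    -- Whatever the coins are, the output is literally an oracle answer, hence fair.
    have hfair : ∀ ω, FairConsensus.IsFair color (FairConsensus.ofLabels (labels ω)) := by
      intro ω
      obtain ⟨_, ⟨κ, hκ⟩, _⟩ := hspec ω hne
      have : labels ω = fun u => (closest (fun u => FairConsensus.digit n κ u) u : ℕ) := by
        funext u
        rw [hκ u]
        simp [FairConsensus.oracleRow, FairConsensus.labelsToCells, hE]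
      rw [this]
      exact (hclosest _).1
    have hpow' : (m : ℝ) ^ (a * l * (k + 1) + b * l) =
        ((m : ℝ) ^ (k + 1)) ^ (a * l) * (m : ℝ) ^ (b * l) := by
      rw [pow_add, ← pow_mul, mul_comm (k + 1)]
    rw [hpow']
    refine hcount.trans (Nat.cast_le.mpr ?_)
    convert FairConsensus.card_good_samples_le hℓ (show 2.995 ≤ α + 1.995 by linarith) hmin hfair
      fun ω => ?_
    obtain ⟨g, _, h1, h2⟩ := hspec ω hne
    exact ⟨g, h1, h2⟩
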